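/- Let $n:\mathbb N\to\mathbb N$ grow polynomially, i.e. $n(d)=\Theta(d^{c})$ for some real $c>0$ (for instance any nonconstant polynomial). Assume that for some constant $L\in\mathbb N$ there is an $L$-local pseudorandom generator with stretch $n^7$ and security $o(1/n^2)$: a polynomial-time computable $G:\{0,1\}^\kappa\to\{0,1\}^{n(\kappa)^7}$ ($\kappa\in\mathbb N$) such that every output bit depends on at most $L$ bits of the seed, and for every (non-uniform) adversary $A$, given by a family of circuits of size polynomial in $n(\kappa)^7$, $$\bigl|\Pr[A(G(U_\kappa))=1]-\Pr[A(U_{n(\kappa)^7})=1]\bigr|=o\bigl(1/n(\kappa)^2\bigr),$$ where $U_m$ is uniform on $\{0,1\}^m$. Then there is a function $k=k(n)=n^{2+o(1)}$ and a polynomial $s$ such that no randomized algorithm, which takes as input a database $D\in(\{0,1\}^d)^{n}$ with $n=n(d)$ rows and $k(n)$ counting queries $q_1,\dots,q_k$, each given by a Boolean circuit on $d$ bits with gates $\wedge,\vee,\neg$ of unbounded fan-in, of depth at most $6$ and size at most $s(d+n)$, and which outputs rational answers $a_1,\dots,a_k$, has all three of the following properties. (1) Efficiency: it runs in time polynomial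 in the length of its input (hence in time $\mathrm{poly}(d,n)$). (2) Differential privacy: there are $\varepsilon(n)=O(1)$ and $\delta(n)=o(1/n)$ such that for all databases $D,D'$ that differ in exactly one row, all queries $q_1,\dots,q_k$ and every set $T$ of answer vectors, the output $\mathcal A$ satisfies $\Pr[\mathcal A(D,q_1,\dots,q_k)\in T]\le e^{\varepsilon}\Pr[\mathcal A(D',q_1,\dots,q_k)\in T]+\delta$. (3) Accuracy: there is $\beta(n)=o(1/n^2)$ such that for every $D$ and all $q_1,\dots,q_k$, with probability at least $1-\beta$, $|a_j-q_j(D)|\le .49$ for all $j$, where $q_j(D)=\frac1n\sum_{i=1}^n q_j(D_i)$ is the fraction of the rows $D_i$ of $D$ that satisfy $q_j$. -/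

import Mathlib

open Filter Topology Asymptotics Computability

namespace CountingQueries

/-! ### Boolean circuits over {∧, ∨, ¬} with unbounded fan-in -/

/-- A wire of a circuit with `d` inputs and `m` gates: an input, or the output of a gate. -/
abbrev Wire (d m : ℕ) : Type := Fin d ⊕ Fin m

/-- A gate that reads from `d` inputs and `m` earlier gates. Conjunctions and disjunctions have
unbounded fan-in; with fan-in `0` they are the constants `1` and `0`. -/
inductive Gate (d m : ℕ) : Type
  | neg (w : Wire d m)
  | conj (ws : List (Wire d m))
  | disj (ws : List (Wire d m))

/-- The wires that a gate reads. -/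
def Gate.wires {d m : ℕ} : Gate d m → List (Wire d m)
  | .neg w => [w]
  | .conj ws => ws
  | .disj ws => ws

/-- The value of a gate, given the values of the wires. -/
def Gate.eval {d m : ℕ} (v : Wire d m → Bool) : Gate d m → Bool
  | .neg w => !(v w)
  | .conj ws => ws.all v
  | .disj ws => ws.any v

/-- `m` gates in topological order: each gate reads inputs and earlier gates only. -/
inductive GateSeq (d : ℕ) : ℕ → Type
  | nil : GateSeq d 0
  | snoc {m : ℕ} (c : GateSeq d m) (g : Gate d m) : GateSeq d (m + 1)

/-- The values of all gates on the input `x`. -/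
def GateSeq.eval {d : ℕ} (x : Fin d → Bool) : {m : ℕ} → GateSeq d m → Fin m → Bool
  | _, .nil => Fin.elim0
  | _, .snoc c g =>
      Fin.snoc (α := fun _ => Bool) (GateSeq.eval x c) (g.eval (Sum.elim x (GateSeq.eval x c)))

/-- The depth of every gate: inputs have depth `0`, and every gate, negations included, is one
deeper than the deepest wire it reads. -/
def GateSeq.depth {d : ℕ} : {m : ℕ} → GateSeq d m → Fin m → ℕ
  | _, .nil => Fin.elim0
  | _, .snoc c g =>
      Fin.snoc (α := fun _ => ℕ) (GateSeq.depth c)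
        (1 + (g.wires.map (Sum.elim (fun _ => 0) (GateSeq.depth c))).foldr max 0)

/-- The number of gates plus the total fan-in. -/
def GateSeq.size {d : ℕ} : {m : ℕ} → GateSeq d m → ℕ
  | _, .nil => 0
  | _, .snoc c g => GateSeq.size c + (1 + g.wires.length)

/-- A circuit with `d` inputs and one output. -/
structure Circuit (d : ℕ) : Type where
  {m : ℕ}
  gates : GateSeq d m
  out : Wire d m

/-- The bit that a circuit computes. -/
def Circuit.eval {d : ℕ} (q : Circuit d) (x : Fin d → Bool) : Bool :=
  Sum.elim x (q.gates.eval x) q.out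

/-- The number of gates on a longest path from an input to the output. -/
def Circuit.depth {d : ℕ} (q : Circuit d) : ℕ :=
  Sum.elim (fun _ => 0) q.gates.depth q.out

/-- The size of a circuit: gates plus connections between them. -/
def Circuit.size {d : ℕ} (q : Circuit d) : ℕ := q.gates.size

/-! ### Encodings as strings over the alphabet `Γ'` of bits, brackets and commas -/

/-- A natural number in binary, followed by a comma. -/
def encNat (a : ℕ) : List Γ' := encodingNatΓ'.encode a ++ [Γ'.comma]

/-- A wire: its kind and its index. -/
def encWire {d m : ℕ} : Wire d m → List Γ'
  | .inl i => Γ'.bit false :: encNat i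
  | .inr j => Γ'.bit true :: encNat j

/-- The two-bit tag of a gate. -/
def Gate.tag {d m : ℕ} : Gate d m → List Γ'
  | .neg _ => [Γ'.bit false, Γ'.bit false]
  | .conj _ => [Γ'.bit true, Γ'.bit false]
  | .disj _ => [Γ'.bit true, Γ'.bit true]

/-- A gate: its tag and the list of the wires it reads, in brackets. -/
def Gate.enc {d m : ℕ} (g : Gate d m) : List Γ' :=
  Γ'.bra :: (g.tag ++ g.wires.flatMap encWire ++ [Γ'.ket])

/-- A sequence of gates. -/
def GateSeq.enc {d : ℕ} : {m : ℕ} → GateSeq d m → List Γ'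
  | _, .nil => []
  | _, .snoc c g => GateSeq.enc c ++ g.enc

/-- A circuit: its gates and its output wire, in brackets. -/
def Circuit.enc {d : ℕ} (q : Circuit d) : List Γ' :=
  Γ'.bra :: (q.gates.enc ++ encWire q.out ++ [Γ'.ket])

/-- A bit string. -/
def encBits {a : ℕ} (x : Fin a → Bool) : List Γ' := (List.ofFn x).map Γ'.bit

/-- A rational number: its sign, followed by the binary digits (least significant first) of the
numerator and of the denominator in lowest terms, written on two parallel tracks. -/
def encRat (a : ℚ) : List (Bool ⊕ (Bool × Bool)) :=
  Sum.inl (decide (a < 0)) ::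
    (List.range (max a.num.natAbs.size a.den.size)).map fun i =>
      Sum.inr (a.num.natAbs.testBit i, a.den.testBit i)

/-- A finite sequence of rational numbers. -/
def encRats (l : List ℚ) : List (Bool ⊕ (Bool × Bool)) := l.flatMap encRat

/-! ### Probability -/

open Classical in
/-- The probability of the event `p` under the uniform distribution on a finite type. -/
noncomputable def prob {α : Type} [Fintype α] (p : α → Prop) : ℝ :=
  ((Finset.univ.filter p).card : ℝ) / (Fintype.card α : ℝ)

/-! ### Local pseudorandom generators -/

/-- `G`, which expands seeds of length `κ` to `ℓ κ` bits, is a local pseudorandom generator with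
locality `L` and security `o(γ)`, against non-uniform adversaries: families of circuits of
size polynomial in `ℓ κ`. -/
structure IsLocalPRG (ℓ : ℕ → ℕ) (γ : ℕ → ℝ) (L : ℕ)
    (G : (κ : ℕ) → (Fin κ → Bool) → Fin (ℓ κ) → Bool) : Prop where
  /-- `G` is computable in polynomial time. -/
  efficient : Nonempty (Turing.TM2ComputableInPolyTime
    (α := Σ κ : ℕ, (Fin κ → Bool)) (β := Σ a : ℕ, (Fin a → Bool))
    (fun x => encBits x.2) (fun y => encBits y.2) (fun x => ⟨ℓ x.1, G x.1 x.2⟩))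
  /-- No adversary of polynomial size has an advantage that is not `o(γ)`. -/
  pseudorandom : ∀ A : (κ : ℕ) → Circuit (ℓ κ),
    (∃ P : Polynomial ℕ, ∀ κ, (A κ).size ≤ P.eval (ℓ κ)) →
    (fun κ => |prob (fun x : Fin κ → Bool => (A κ).eval (G κ x) = true) -
      prob (fun y : Fin (ℓ κ) → Bool => (A κ).eval y = true)|) =o[atTop] γ
  /-- Each bit of the output depends on some set of at most `L` bits of the seed. -/
  isLocal : ∀ (κ : ℕ) (j : Fin (ℓ κ)), ∃ I : Finset (Fin κ), I.card ≤ L ∧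
    ∀ x y : Fin κ → Bool, (∀ i ∈ I, x i = y i) → G κ x j = G κ y j

/-! ### Databases, counting queries and sanitizers -/

/-- A database with `n` rows of `d` bits. -/
abbrev Database (d n : ℕ) : Type := Fin n → Fin d → Bool

/-- Two databases are adjacent if they differ on exactly one row. -/
def Adjacent {d n : ℕ} (D D' : Database d n) : Prop := ∃! i, D i ≠ D' i

/-- The value of a counting query: the fraction of the rows that satisfy it. -/
noncomputable def queryValue {d n : ℕ} (q : Circuit d) (D : Database d n) : ℝ :=
  (∑ i, if q.eval (D i) = true then (1 : ℝ) else 0) / (n : ℝ)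

/-- The counting queries on `d` bits given by circuits of depth at most `h` and size at
most `s`. -/
def depthQueries (h s d : ℕ) : Set (Circuit d) := {q | q.depth ≤ h ∧ q.size ≤ s}

/-- The inputs of a sanitizer for `n d` rows of `d` bits and `k (n d)` queries from `Q d`. -/
structure SanInput (n k : ℕ → ℕ) (Q : (d : ℕ) → Set (Circuit d)) : Type where
  d : ℕ
  db : Database d (n d)
  query : Fin (k (n d)) → Q d

/-- An input as a string: `d`, the number of rows and the number of queries, then the rows and
the queries. -/
def SanInput.enc {n k : ℕ → ℕ} {Q : (d : ℕ) → Set (Circuit d)} (x : SanInput n k Q) : List Γ' :=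
  encNat x.d ++ encNat (n x.d) ++ encNat (k (n x.d)) ++
    (List.ofFn x.db).flatMap encBits ++
    (List.ofFn x.query).flatMap (fun q => Circuit.enc q.1)

/-- A randomized algorithm that, on a database and a sequence of queries, uses a number of random
bits that is polynomial in the length of its input and returns one answer for each query. -/
structure Sanitizer (n k : ℕ → ℕ) (Q : (d : ℕ) → Set (Circuit d)) : Type where
  coins : Polynomial ℕ
  answer : (x : SanInput n k Q) → (Fin (coins.eval x.enc.length) → Bool) →
    Fin (k (n x.d)) → ℚ

namespace Sanitizer

variable {n k : ℕ → ℕ} {Q : (d : ℕ) → Set (Circuit d)}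

/-- The answers are computed from the input and the random bits in time polynomial in the length
of the input. -/
def Efficient (S : Sanitizer n k Q) : Prop :=
  Nonempty (Turing.TM2ComputableInPolyTime
    (α := Σ x : SanInput n k Q, (Fin (S.coins.eval x.enc.length) → Bool)) (β := List ℚ)
    (fun p => p.1.enc ++ encBits p.2) encRats (fun p => List.ofFn (S.answer p.1 p.2)))

/-- For every fixed sequence of queries, the answers are `(ε, δ)`-differentially private as a
function of the database, for some `ε = O(1)` and `δ = o(1/n)`. -/
def DifferentiallyPrivate (S : Sanitizer n k Q) : Prop :=
  ∃ ε δ : ℕ → ℝ, ε =O[atTop] (fun _ => (1 : ℝ)) ∧ δ =o[atTop] (fun a => 1 / (a : ℝ)) ∧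
    ∀ (d : ℕ) (D D' : Database d (n d)) (q : Fin (k (n d)) → Q d), Adjacent D D' →
      ∀ T : Set (Fin (k (n d)) → ℚ),
        prob (fun r => S.answer ⟨d, D, q⟩ r ∈ T) ≤
          Real.exp (ε (n d)) * prob (fun r => S.answer ⟨d, D', q⟩ r ∈ T) + δ (n d)

/-- On every database and every sequence of queries, all answers are within `α` of the truth,
except with probability at most `β`, for some `β = o(1/n²)`. -/
def Accurate (S : Sanitizer n k Q) (α : ℝ) : Prop :=
  ∃ β : ℕ → ℝ, β =o[atTop] (fun a => 1 / (a : ℝ) ^ 2) ∧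
    ∀ (d : ℕ) (D : Database d (n d)) (q : Fin (k (n d)) → Q d),
      1 - β (n d) ≤ prob (fun r => ∀ j,
        |queryValue (q j).1 D - ((S.answer ⟨d, D, q⟩ r j : ℚ) : ℝ)| ≤ α)

end Sanitizer

/-- `k(a) = a ^ (2 + o(1))`. -/
def IsSquarePlusLittleO (k : ℕ → ℕ) : Prop :=
  ∃ e : ℕ → ℝ, Tendsto e atTop (𝓝 0) ∧ ∀ᶠ a : ℕ in atTop, (k a : ℝ) = (a : ℝ) ^ (2 + e a)

end CountingQueries

/-! Accurate answers to a fingerprinting code betray some row of the database, while private answers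
cannot; a local generator makes the code available through small queries.

Let N = n(2κ). Row i consists of the index and a secret key of user i. For a random code X with k
columns, the j-th query has the bits of column j hard-wired, the bit of each user masked with bit j
of the generator on the key of that user; on row i it recovers the bit of user i. Each output bit of
the generator depends on at most L key bits, so depth 4 is enough (`exists_decryption_query`), and
the value of the query is the fraction of ones in the column.

A column has uniform weight w in {0, …, N} and is uniform given w. In a column whose answer exceeds
1/2 in absolute value, a user scores (N+1)/w for a one and -(N+1)/(N-w) for a zero. These scores sum
to zero over the users in a mixed column and to N+1 in a full one. Accurate answers select all full
and no empty columns, so some user scores at least the number of full columns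
(`exists_large_score`), which is rarely small (`fullColumns_tail`). If the answers do not depend on
the bits of user i, however, the score of i has mean zero and second moment O(log N) per column, and
an exponential moment bound shows that it is rarely large (`soundness`).

Privacy allows row i to be replaced (`dropUser`). The key of i then enters only through the output
of the generator, which may be replaced by uniform bits that hide the bits of i perfectly. Hence
each user is accused with probability at most e^ε(η+γ)+δ, where η is the soundness error and γ the
advantage against the generator (`tracing_bound`, `attack_bound`). The sum over N users tends to 0,
although somebody is accused with probability at least 1/4. With g = log₂ N + 1, rounded down, k =
16N²g³ columns suffice.

The distinguisher has to be a circuit. Its coins, the other keys and the code are hard-wired; the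
machine of the sanitizer is unrolled in time (`exists_jointlyComputed_output`), and an automaton
adds up integer scores (`exists_test_circuit`). For this the input string must have a fixed length,
and each of its symbols must depend on at most one challenge bit: this is `BitLocal`. -/

namespace CountingQueries

/-! ### Sets of Boolean functions that are computed jointly by one circuit -/

/-- The value of a wire. -/
def GateSeq.val {d m : ℕ} (c : GateSeq d m) (x : Fin d → Bool) : Wire d m → Bool :=
  Sum.elim x (c.eval x)

/-- A wire, seen after one more gate has been added. -/
def liftWire {d m : ℕ} : Wire d m → Wire d (m + 1) := Sum.map id Fin.castSucc

lemma GateSeq.val_snoc_lift {d m : ℕ} (c : GateSeq d m) (g : Gate d m) (x : Fin d → Bool)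
    (w : Wire d m) : (GateSeq.snoc c g).val x (liftWire w) = c.val x w := by
  cases w <;> simp [GateSeq.val, GateSeq.eval, liftWire]

lemma GateSeq.val_snoc_last {d m : ℕ} (c : GateSeq d m) (g : Gate d m) (x : Fin d → Bool) :
    (GateSeq.snoc c g).val x (.inr (Fin.last m)) = g.eval (c.val x) := by
  simp only [GateSeq.val, GateSeq.eval, Sum.elim_inr, Fin.snoc_last]

/-- All functions in `F` are computed by wires of one gate sequence of size at most `s`. -/
def JointlyComputed {d : ℕ} (F : Set ((Fin d → Bool) → Bool)) (s : ℕ) : Prop :=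
  ∃ (m : ℕ) (c : GateSeq d m), c.size ≤ s ∧ ∀ f ∈ F, ∃ w : Wire d m, ∀ x, c.val x w = f x

/-- Any gate sequence computing `F` can be extended by size `t` to compute `f` as well. -/
def AddCost {d : ℕ} (F : Set ((Fin d → Bool) → Bool)) (f : (Fin d → Bool) → Bool) (t : ℕ) : Prop :=
  ∀ F' s, F ⊆ F' → JointlyComputed F' s → JointlyComputed (insert f F') (s + t)

section JointlyComputed

variable {d : ℕ} {F F' : Set ((Fin d → Bool) → Bool)} {s t : ℕ}

lemma JointlyComputed.mono (h : JointlyComputed F s) (hF : F' ⊆ F) (hs : s ≤ t) :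
    JointlyComputed F' t := by
  obtain ⟨m, c, hc, hf⟩ := h
  exact ⟨m, c, hc.trans hs, fun f h => hf f (hF h)⟩

lemma AddCost.mono {f : (Fin d → Bool) → Bool} (h : AddCost F f s) (hF : F ⊆ F') (hs : s ≤ t) :
    AddCost F' f t := fun F₁ z h₁ h₂ => (h F₁ z (hF.trans h₁) h₂).mono subset_rfl (by omega)

lemma jointlyComputed_inputs : JointlyComputed (Set.range fun (i : Fin d) x => x i) 0 := by
  refine ⟨0, .nil, le_rfl, ?_⟩
  rintro _ ⟨i, rfl⟩
  exact ⟨.inl i, fun x => rfl⟩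

lemma JointlyComputed.addGate {m : ℕ} {c : GateSeq d m} (hc : c.size ≤ s)
    (hF : ∀ f ∈ F, ∃ w : Wire d m, ∀ x, c.val x w = f x) (g : Gate d m)
    (f : (Fin d → Bool) → Bool) (hf : ∀ x, g.eval (c.val x) = f x) :
    JointlyComputed (insert f F) (s + (1 + g.wires.length)) := by
  refine ⟨m + 1, .snoc c g, by simp only [GateSeq.size]; omega, ?_⟩
  rintro f' (rfl | h)
  · exact ⟨.inr (Fin.last m), fun x => by rw [GateSeq.val_snoc_last, hf]⟩
  · obtain ⟨w, hw⟩ := hF f' h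
    exact ⟨liftWire w, fun x => by rw [GateSeq.val_snoc_lift, hw]⟩

lemma addCost_not {f : (Fin d → Bool) → Bool} (h : f ∈ F) : AddCost F (fun x => !f x) 2 := by
  rintro F' z hF ⟨m, c, hc, hf⟩
  obtain ⟨w, hw⟩ := hf f (hF h)
  exact JointlyComputed.addGate hc hf (.neg w) _ fun x => by simp [Gate.eval, hw]

lemma exists_wires {m : ℕ} {c : GateSeq d m}
    (hF : ∀ f ∈ F, ∃ w : Wire d m, ∀ x, c.val x w = f x) :
    ∀ l : List ((Fin d → Bool) → Bool), (∀ f ∈ l, f ∈ F) →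
      ∃ ws : List (Wire d m), ws.length = l.length ∧
        ∀ x, ws.map (c.val x) = l.map (· x) := by
  intro l
  induction l with
  | nil => exact fun _ => ⟨[], rfl, fun x => rfl⟩
  | cons f l ih =>
    intro h
    obtain ⟨ws, h1, h2⟩ := ih fun g hg => h g (List.mem_cons_of_mem _ hg)
    obtain ⟨w, hw⟩ := hF f (h f List.mem_cons_self)
    exact ⟨w :: ws, by simp [h1], fun x => by simp [h2, hw]⟩

lemma addCost_all (l : List ((Fin d → Bool) → Bool)) (hl : ∀ f ∈ l, f ∈ F) :
    AddCost F (fun x => l.all (· x)) (1 + l.length) := by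
  rintro F' z hF ⟨m, c, hc, hf⟩
  obtain ⟨ws, h1, h2⟩ := exists_wires hf l fun f h => hF (hl f h)
  have := JointlyComputed.addGate hc hf (.conj ws) (fun x => l.all (· x)) fun x => by
    have := congrArg (fun l => l.all id) (h2 x)
    simpa [Gate.eval, List.all_map, Function.comp_def] using this
  simpa [Gate.wires, h1] using this

lemma addCost_any (l : List ((Fin d → Bool) → Bool)) (hl : ∀ f ∈ l, f ∈ F) :
    AddCost F (fun x => l.any (· x)) (1 + l.length) := by
  rintro F' z hF ⟨m, c, hc, hf⟩
  obtain ⟨ws, h1, h2⟩ := exists_wires hf l fun f h => hF (hl f h)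
  have := JointlyComputed.addGate hc hf (.disj ws) (fun x => l.any (· x)) fun x => by
    have := congrArg (fun l => l.any id) (h2 x)
    simpa [Gate.eval, List.any_map, Function.comp_def] using this
  simpa [Gate.wires, h1] using this

lemma JointlyComputed.union {ι : Type*} (S : Finset ι) (h : ι → (Fin d → Bool) → Bool)
    (hc : ∀ i ∈ S, AddCost F (h i) t) (hF : F ⊆ F') (hs : JointlyComputed F' s) :
    JointlyComputed (F' ∪ h '' S) (s + S.card * t) := by
  classical
  induction S using Finset.induction_on with
  | empty => simpa using hs
  | insert i S hi ih =>
    have h1 := ih fun j hj => hc j (Finset.mem_insert_of_mem hj)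
    have h2 := hc i (Finset.mem_insert_self _ _) _ _ (hF.trans Set.subset_union_left) h1
    refine h2.mono ?_ ?_
    · rw [Finset.coe_insert, Set.image_insert_eq, Set.union_insert]
    · rw [Finset.card_insert_of_notMem hi]; ring_nf; omega

/-- Since `AddCost` quantifies over all larger families, auxiliary functions may be computed first
and then forgotten; only their gates remain. -/
lemma AddCost.trans {ι : Type*} (S : Finset ι) (h : ι → (Fin d → Bool) → Bool) {u : ℕ}
    (hc : ∀ i ∈ S, AddCost F (h i) t) {f : (Fin d → Bool) → Bool}
    (hf : AddCost (F ∪ h '' S) f u) : AddCost F f (S.card * t + u) := by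
  intro F' z hF hz
  have := hf _ _ (Set.union_subset_union_left _ hF) (hz.union S h hc hF)
  exact this.mono (Set.insert_subset_insert Set.subset_union_left) (by omega)

lemma addCost_exists {ι : Type*} (S : Finset ι) (h : ι → (Fin d → Bool) → Bool)
    (hS : ∀ i ∈ S, h i ∈ F) {f : (Fin d → Bool) → Bool}
    (hf : ∀ x, f x = true ↔ ∃ i ∈ S, h i x = true) : AddCost F f (1 + S.card) := by
  have := addCost_any (F := F) (S.toList.map h) (by simpa using hS)
  rw [List.length_map, Finset.length_toList] at this
  convert this using 1
  funext x
  rw [Bool.eq_iff_iff, hf]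
  simp

lemma addCost_forall {ι : Type*} (S : Finset ι) (h : ι → (Fin d → Bool) → Bool)
    (hS : ∀ i ∈ S, h i ∈ F) {f : (Fin d → Bool) → Bool}
    (hf : ∀ x, f x = true ↔ ∀ i ∈ S, h i x = true) : AddCost F f (1 + S.card) := by
  have := addCost_all (F := F) (S.toList.map h) (by simpa using hS)
  rw [List.length_map, Finset.length_toList] at this
  convert this using 1
  funext x
  rw [Bool.eq_iff_iff, hf]
  simp

/-- The cost of a function of `B` given functions. -/
def juntaCost (B : ℕ) : ℕ := B * 2 + (2 ^ B * (1 + B) + (1 + 2 ^ B))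

lemma juntaCost_mono : Monotone juntaCost := by
  intro a b h
  have : 2 ^ a ≤ 2 ^ b := Nat.pow_le_pow_right (by norm_num) h
  unfold juntaCost
  gcongr

/-- A function of finitely many given functions costs a constant. -/
lemma addCost_junta {ι : Type*} (S : Finset ι) (g : ι → (Fin d → Bool) → Bool)
    (hS : ∀ i ∈ S, g i ∈ F) {f : (Fin d → Bool) → Bool}
    (hf : ∀ x y, (∀ i ∈ S, g i x = g i y) → f x = f y) : AddCost F f (juntaCost S.card) := by
  classical
  unfold juntaCost
  refine AddCost.trans S (fun i x => !g i x) (fun i hi => addCost_not (hS i hi)) ?_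
  -- Disjunctive normal form: an assignment is the set of indices whose functions are true, and only
  -- assignments realised by an accepted input enter the disjunction.
  let A : Finset (Finset ι) := S.powerset
  let A' : Finset (Finset ι) := A.filter fun a =>
    ∃ x, (∀ i ∈ S, g i x = decide (i ∈ a)) ∧ f x = true
  let T : Finset ι → (Fin d → Bool) → Bool := fun a x => decide (∀ i ∈ S, g i x = decide (i ∈ a))
  have hA : A.card = 2 ^ S.card := Finset.card_powerset S
  rw [← hA]
  refine AddCost.trans A T (fun a _ => ?_) ?_
  · refine addCost_forall S (fun i x => if i ∈ a then g i x else !g i x) ?_ ?_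
    · intro i hi
      by_cases h : i ∈ a
      · simp only [h, if_true]; exact Or.inl (hS i hi)
      · simp only [h, if_false]; exact Or.inr ⟨i, hi, rfl⟩
    · intro x
      simp only [T, decide_eq_true_eq]
      refine forall₂_congr fun i _ => ?_
      by_cases h : i ∈ a <;> simp [h]
  · refine AddCost.mono (addCost_exists (F := (F ∪ (fun i x => !g i x) '' S) ∪ T '' A) A' T
      (fun a ha => Or.inr ⟨a, (Finset.mem_filter.1 ha).1, rfl⟩) ?_) subset_rfl
      (Nat.add_le_add_left (Finset.card_filter_le _ _) _)
    intro x
    constructor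
    · intro hx
      refine ⟨S.filter (fun i => g i x = true), Finset.mem_filter.2
        ⟨Finset.mem_powerset.2 (Finset.filter_subset _ _), x, ?_, hx⟩, ?_⟩
      · intro i hi; simp [hi]
      · simp only [T, decide_eq_true_eq]; intro i hi; simp [hi]
    · rintro ⟨a, ha, hT⟩
      obtain ⟨y, hy, hy'⟩ := (Finset.mem_filter.1 ha).2
      simp only [T, decide_eq_true_eq] at hT
      rw [← hy']
      exact hf _ _ fun i hi => by rw [hT i hi, hy i hi]

lemma addCost_const (b : Bool) : AddCost F (fun _ => b) 4 := by
  have := addCost_junta (F := F) (∅ : Finset Unit) (fun _ _ => true) (by simp)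
    (f := fun _ => b) (by simp)
  exact this.mono subset_rfl (by simp [juntaCost])

/-! ### One-hot encodings of functions with values in a type -/

open Classical in
/-- The indicator functions of the values of `g`. -/
noncomputable def oneHot {V : Type*} (g : (Fin d → Bool) → V) (v : V) (x : Fin d → Bool) : Bool :=
  decide (g x = v)

lemma oneHot_eq_true {V : Type*} {g : (Fin d → Bool) → V} {v : V} {x : Fin d → Bool} :
    oneHot g v x = true ↔ g x = v := by simp [oneHot]

/-- The indicator functions of all cells of a family of functions. -/
def cellFns {ι V : Type*} (g : (Fin d → Bool) → ι → V) : Set ((Fin d → Bool) → Bool) :=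
  {f | ∃ i v, f = oneHot (fun x => g x i) v}

lemma mem_cellFns {ι V : Type*} (g : (Fin d → Bool) → ι → V) (i : ι) (v : V) :
    oneHot (fun x => g x i) v ∈ cellFns g := ⟨i, v, rfl⟩

/-- A cell is determined by its indicator bits for the values in `VF`, so a function of `B` cells is
a junta of `B * VF.card` bits. -/
lemma addCost_of_cells {ι V : Type*} (g : (Fin d → Bool) → ι → V) (VF : Finset V)
    (hV : ∀ x i, g x i ∈ VF) (I : Finset ι) {B : ℕ} (hI : I.card ≤ B)
    {f : (Fin d → Bool) → Bool} (hf : ∀ x y, (∀ i ∈ I, g x i = g y i) → f x = f y) :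
    AddCost (cellFns g) f (juntaCost (B * VF.card)) := by
  refine (addCost_junta (F := cellFns g) (I ×ˢ VF) (fun p => oneHot (fun x => g x p.1) p.2)
    (fun p _ => mem_cellFns g _ _) ?_).mono subset_rfl (juntaCost_mono ?_)
  · intro x y h
    refine hf x y fun i hi => ?_
    have := h (i, g x i) (Finset.mem_product.2 ⟨hi, hV x i⟩)
    exact (oneHot_eq_true.1 (this ▸ oneHot_eq_true.2 rfl)).symm
  · rw [Finset.card_product]; exact Nat.mul_le_mul_right _ hI

/-- All cells outside a finite set `Act` are constant, and the others are cheap. -/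
lemma JointlyComputed.cellFns {ι V : Type*} {g : (Fin d → Bool) → ι → V} (VF : Finset V)
    (hV : ∀ x i, g x i ∈ VF) (Act : Finset ι) {W c : ℕ} (hW : Act.card ≤ W)
    (hAct : ∀ i ∉ Act, ∀ x y, g x i = g y i)
    (hc : ∀ i ∈ Act, ∀ v, AddCost F (oneHot (fun x => g x i) v) c)
    (hF : JointlyComputed F s) :
    JointlyComputed (cellFns g) (s + W * VF.card * c + 8) := by
  classical
  have h1 := hF.union (Act ×ˢ VF) (fun p => oneHot (fun x => g x p.1) p.2)
    (fun p hp => hc p.1 (Finset.mem_product.1 hp).1 p.2) subset_rfl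
  -- The two constants, of cost 4 each, serve the constant cells and the values outside `VF`.
  have h2 := addCost_const true _ _ subset_rfl h1
  have h3 := addCost_const false _ _ subset_rfl h2
  refine h3.mono ?_ ?_
  · rintro _ ⟨i, v, rfl⟩
    by_cases hi : i ∈ Act
    · by_cases hv : v ∈ VF
      · exact Or.inr (Or.inr (Or.inr ⟨(i, v), by simp [hi, hv], rfl⟩))
      · left
        funext x
        have : g x i ≠ v := fun h => hv (h ▸ hV x i)
        simp [oneHot, this]
    · by_cases h : g (fun _ => false) i = v
      · right; left
        funext x
        simp [oneHot, hAct i hi x (fun _ => false), h]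
      · left
        funext x
        simp [oneHot, hAct i hi x (fun _ => false), h]
  · have := Nat.mul_le_mul_right c (Nat.mul_le_mul_right VF.card hW)
    rw [Finset.card_product]
    omega

/-- Simulation of a cellular process: every cell depends on boundedly many cells at the
previous time. -/
lemma JointlyComputed.cellular {ι V : Type*} (g : ℕ → (Fin d → Bool) → ι → V) (VF : Finset V)
    (hV : ∀ τ x i, g τ x i ∈ VF) (Act : Finset ι) {W B T : ℕ} (hW : Act.card ≤ W)
    (hAct : ∀ τ ≤ T, ∀ i ∉ Act, ∀ x y, g τ x i = g τ y i)
    (hloc : ∀ i, ∃ I : Finset ι, I.card ≤ B ∧ ∀ τ x y,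
      (∀ i' ∈ I, g τ x i' = g τ y i') → g (τ + 1) x i = g (τ + 1) y i)
    (h0 : JointlyComputed (CountingQueries.cellFns (g 0)) s) :
    JointlyComputed (CountingQueries.cellFns (g T))
      (s + T * (W * VF.card * juntaCost (B * VF.card) + 8)) := by
  suffices H : ∀ τ ≤ T, JointlyComputed (CountingQueries.cellFns (g τ))
      (s + τ * (W * VF.card * juntaCost (B * VF.card) + 8)) from H T le_rfl
  intro τ
  induction τ with
  | zero => intro _; simpa using h0
  | succ τ ih =>
    intro hτ
    refine (JointlyComputed.cellFns VF (hV (τ + 1)) Act (c := juntaCost (B * VF.card)) hW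
      (hAct _ hτ) ?_ (ih (by omega))).mono subset_rfl (by rw [add_mul]; omega)
    intro i _ v
    obtain ⟨I, hI, h⟩ := hloc i
    refine addCost_of_cells (g τ) VF (hV τ) I hI fun x y hxy => ?_
    unfold oneHot
    beta_reduce
    rw [h τ x y hxy]

/-- Simulation of an automaton that reads `ℓ` cells one after the other. -/
lemma JointlyComputed.automaton {V Q : Type*} (g : (Fin d → Bool) → ℕ → V) (VF : Finset V)
    (hV : ∀ x i, g x i ∈ VF) (δ : Q → V → Q) (q₀ : Q) (Qs : Finset Q) (ℓ : ℕ)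
    (run : ℕ → (Fin d → Bool) → Q) (h0 : ∀ x, run 0 x = q₀)
    (hrun : ∀ t x, run (t + 1) x = δ (run t x) (g x t))
    (hQ : ∀ t ≤ ℓ, ∀ x, run t x ∈ Qs) (acc : Q → Prop)
    (f : (Fin d → Bool) → Bool) (hf : ∀ x, f x = true ↔ acc (run ℓ x))
    (hF : JointlyComputed (CountingQueries.cellFns g) s) :
    JointlyComputed {f} (s + 8 + ℓ * (Qs.card * (4 * (Qs.card * VF.card) + 1)) +
      (1 + Qs.card)) := by
  classical
  let G : ℕ → Set ((Fin d → Bool) → Bool) := fun t =>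
    CountingQueries.cellFns g ∪ {h | ∃ q, h = oneHot (run t) q} ∪ {fun _ => false}
  have key : ∀ t ≤ ℓ, JointlyComputed (G t)
      (s + 8 + t * (Qs.card * (4 * (Qs.card * VF.card) + 1))) := by
    intro t
    induction t with
    | zero =>
      intro _
      refine (addCost_const true _ _ subset_rfl (addCost_const false _ _ subset_rfl hF)).mono
        ?_ (by omega)
      rintro h ((h1 | ⟨q, rfl⟩) | rfl)
      · exact Or.inr (Or.inr h1)
      · by_cases hq : q₀ = q
        · left; funext x; simp [oneHot, h0, hq]
        · right; left; funext x; simp [oneHot, h0, hq]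
      · exact Or.inr (Or.inl rfl)
    | succ t ih =>
      intro ht
      have ih := ih (by omega)
      have hcost : ∀ q' ∈ Qs, AddCost (G t) (oneHot (run (t + 1)) q')
          (4 * (Qs.card * VF.card) + 1) := by
        intro q' _
        -- The next state is `q'` iff the current pair of state and symbol is one that `δ` sends to
        -- `q'`: a disjunction of conjunctions of size 3.
        let P := (Qs ×ˢ VF).filter fun p => δ p.1 p.2 = q'
        have hP : P.card ≤ Qs.card * VF.card :=
          (Finset.card_filter_le _ _).trans (Finset.card_product _ _).le
        let h : Q × V → (Fin d → Bool) → Bool := fun p x =>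
          [oneHot (run t) p.1, oneHot (fun x => g x t) p.2].all (· x)
        have h1 : ∀ p ∈ P, AddCost (G t) (h p) 3 := fun p _ => by
          refine addCost_all [oneHot (run t) p.1, oneHot (fun x => g x t) p.2] ?_
          simp only [List.mem_cons, List.not_mem_nil, or_false]
          rintro f (rfl | rfl)
          · exact Or.inl (Or.inr ⟨_, rfl⟩)
          · exact Or.inl (Or.inl (mem_cellFns g _ _))
        refine AddCost.mono (AddCost.trans P h h1 (addCost_exists (F := G t ∪ h '' P) P h
          (fun p hp => Or.inr ⟨p, hp, rfl⟩) ?_)) subset_rfl (by omega)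
        intro x
        rw [oneHot_eq_true, hrun]
        constructor
        · intro hx
          refine ⟨(run t x, g x t), ?_, ?_⟩
          · simp [P, hx, hQ t (by omega) x, hV]
          · simp [h, oneHot_eq_true]
        · rintro ⟨p, hp, hx⟩
          simp only [h, List.all_cons, List.all_nil, Bool.and_true, Bool.and_eq_true,
            oneHot_eq_true] at hx
          rw [hx.1, hx.2]
          exact (Finset.mem_filter.1 hp).2
      refine (ih.union Qs _ hcost subset_rfl).mono ?_ (by rw [add_mul]; omega)
      rintro h ((h1 | ⟨q, rfl⟩) | rfl)
      · exact Or.inl (Or.inl (Or.inl h1))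
      · by_cases hq : q ∈ Qs
        · exact Or.inr ⟨q, hq, rfl⟩
        · left; right
          funext x
          have : run (t + 1) x ≠ q := fun h => hq (h ▸ hQ _ ht x)
          simp [oneHot, this]
      · exact Or.inl (Or.inr rfl)
  have hlast : AddCost (G ℓ) f (1 + Qs.card) := by
    refine AddCost.mono (addCost_exists (F := G ℓ) (Qs.filter acc) (fun q => oneHot (run ℓ) q)
      (fun q _ => Or.inl (Or.inr ⟨q, rfl⟩)) ?_) subset_rfl
      (Nat.add_le_add_left (Finset.card_filter_le _ _) _)
    intro x
    rw [hf]
    constructor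
    · intro hx
      exact ⟨run ℓ x, by simp [hx, hQ ℓ le_rfl x], oneHot_eq_true.2 rfl⟩
    · rintro ⟨q, hq, hx⟩
      rw [oneHot_eq_true.1 hx]
      exact (Finset.mem_filter.1 hq).2
  exact (hlast _ _ subset_rfl (key ℓ le_rfl)).mono (by simp) le_rfl

lemma JointlyComputed.exists_circuit {f : (Fin d → Bool) → Bool} (h : JointlyComputed {f} s) :
    ∃ A : Circuit d, A.size ≤ s ∧ ∀ x, A.eval x = f x := by
  obtain ⟨m, c, hc, hf⟩ := h
  obtain ⟨w, hw⟩ := hf f rfl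
  exact ⟨⟨c, w⟩, hc, hw⟩

end JointlyComputed

/-! ### Multi-stack machines as cellular processes -/

section StackMachine

open Turing Turing.TM2

variable {K : Type} {Γ : K → Type} {Λ σ : Type}

/-- How far a statement looks down the stacks. -/
def radius : Stmt Γ Λ σ → ℕ
  | .push _ _ q => radius q + 1
  | .peek _ _ q => radius q + 1
  | .pop _ _ q => radius q + 1
  | .load _ q => radius q
  | .branch _ q₁ q₂ => max (radius q₁) (radius q₂)
  | .goto _ => 0
  | .halt => 0

/-- The symbols that a statement can push. -/
def pushed : Stmt Γ Λ σ → Set (Σ k, Γ k)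
  | .push k f q => Set.range (fun v => ⟨k, f v⟩) ∪ pushed q
  | .peek _ _ q => pushed q
  | .pop _ _ q => pushed q
  | .load _ q => pushed q
  | .branch _ q₁ q₂ => pushed q₁ ∪ pushed q₂
  | .goto _ => ∅
  | .halt => ∅

/-- Only the input stack is assumed to have a finite alphabet, but a push writes a function of the
finite internal state. -/
lemma pushed_finite [Finite σ] (q : Stmt Γ Λ σ) : (pushed q).Finite := by
  induction q with
  | push k f q ih => exact (Set.finite_range _).union ih
  | peek _ _ q ih => exact ih
  | pop _ _ q ih => exact ih
  | load _ q ih => exact ih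
  | branch _ q₁ q₂ ih₁ ih₂ => exact ih₁.union ih₂
  | goto _ => exact Set.finite_empty
  | halt => exact Set.finite_empty

/-- The cells of a configuration: the control, and the entries of the stacks. -/
def cfgCell (c : Cfg Γ Λ σ) : Option (K × ℕ) → (Option Λ × σ) ⊕ Option (Σ k, Γ k)
  | none => .inl (c.l, c.var)
  | some p => .inr (((c.stk p.1)[p.2]?).map (Sigma.mk p.1))

lemma cfgCell_none_eq {c c' : Cfg Γ Λ σ} :
    cfgCell c none = cfgCell c' none ↔ c.l = c'.l ∧ c.var = c'.var := by
  simp [cfgCell]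

lemma cfgCell_some_eq {c c' : Cfg Γ Λ σ} {k : K} {t : ℕ} :
    cfgCell c (some (k, t)) = cfgCell c' (some (k, t)) ↔ (c.stk k)[t]? = (c'.stk k)[t]? := by
  simp only [cfgCell, Sum.inr.injEq]
  exact (Option.map_injective sigma_mk_injective).eq_iff

variable [DecidableEq K]

lemma length_stepAux (q : Stmt Γ Λ σ) (v : σ) (S : ∀ k, List (Γ k)) (k : K) :
    ((stepAux q v S).stk k).length ≤ (S k).length + radius q := by
  induction q generalizing v S with
  | push k' f q ih =>
    refine (ih _ _).trans ?_
    by_cases h : k = k'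
    · subst h; simp [radius]; omega
    · simp [radius, Function.update_of_ne h]
      try omega
  | peek k' f q ih => exact (ih _ _).trans (by simp [radius])
  | pop k' f q ih =>
    refine (ih _ _).trans ?_
    by_cases h : k = k'
    · subst h; simp [radius]
      try omega
    · simp [radius, Function.update_of_ne h]
      try omega
  | load f q ih => exact (ih _ _).trans (by simp [radius])
  | branch f q₁ q₂ ih₁ ih₂ =>
    simp only [stepAux, radius]
    cases f v
    · exact (ih₂ _ _).trans (by simp)
    · exact (ih₁ _ _).trans (by simp)
  | goto f => simp [radius]
  | halt => simp [radius]

lemma mem_stepAux (q : Stmt Γ Λ σ) (v : σ) (S : ∀ k, List (Γ k)) (A : Set (Σ k, Γ k))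
    (hq : pushed q ⊆ A) (hS : ∀ k, ∀ a ∈ S k, (⟨k, a⟩ : Σ k, Γ k) ∈ A) :
    ∀ k, ∀ a ∈ (stepAux q v S).stk k, (⟨k, a⟩ : Σ k, Γ k) ∈ A := by
  induction q generalizing v S with
  | push k' f q ih =>
    refine ih _ _ (Set.subset_union_right.trans hq) fun k a ha => ?_
    by_cases h : k = k'
    · subst h
      rw [Function.update_self, List.mem_cons] at ha
      rcases ha with rfl | ha
      · exact hq (Or.inl ⟨v, rfl⟩)
      · exact hS k a ha
    · rw [Function.update_of_ne h] at ha
      exact hS k a ha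
  | peek k' f q ih => exact ih _ _ hq hS
  | pop k' f q ih =>
    refine ih _ _ hq fun k a ha => ?_
    by_cases h : k = k'
    · subst h
      rw [Function.update_self] at ha
      exact hS k a (List.mem_of_mem_tail ha)
    · rw [Function.update_of_ne h] at ha
      exact hS k a ha
  | load f q ih => exact ih _ _ hq hS
  | branch f q₁ q₂ ih₁ ih₂ =>
    simp only [stepAux]
    cases f v
    · exact ih₂ _ _ (Set.subset_union_right.trans hq) hS
    · exact ih₁ _ _ (Set.subset_union_left.trans hq) hS
  | goto f => exact hS
  | halt => exact hS

/-- Each push, peek or pop uses up one unit of radius and shifts indices by at most one, so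
agreement of the tops survives for the remaining statement. -/
lemma stepAux_control (q : Stmt Γ Λ σ) (v : σ) (S S' : ∀ k, List (Γ k))
    (h : ∀ k, ∀ t < radius q, (S k)[t]? = (S' k)[t]?) :
    (stepAux q v S).l = (stepAux q v S').l ∧ (stepAux q v S).var = (stepAux q v S').var := by
  induction q generalizing v S S' with
  | push k' f q ih =>
    refine ih _ _ _ fun k t ht => ?_
    by_cases hk : k = k'
    · subst hk
      rw [Function.update_self, Function.update_self]
      cases t with
      | zero => rfl
      | succ t => simpa using h k t (by simp [radius]; omega)
    · rw [Function.update_of_ne hk, Function.update_of_ne hk]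
      exact h k t (by simp [radius]; omega)
  | peek k' f q ih =>
    have h0 : (S k').head? = (S' k').head? := by
      simpa [List.head?_eq_getElem?] using h k' 0 (by simp [radius])
    simp only [stepAux, h0]
    exact ih _ _ _ fun k t ht => h k t (by simp [radius]; omega)
  | pop k' f q ih =>
    have h0 : (S k').head? = (S' k').head? := by
      simpa [List.head?_eq_getElem?] using h k' 0 (by simp [radius])
    simp only [stepAux, h0]
    refine ih _ _ _ fun k t ht => ?_
    by_cases hk : k = k'
    · subst hk
      simpa using h k (t + 1) (by simp [radius]; omega)
    · rw [Function.update_of_ne hk, Function.update_of_ne hk]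
      exact h k t (by simp [radius]; omega)
  | load f q ih => exact ih _ _ _ h
  | branch f q₁ q₂ ih₁ ih₂ =>
    simp only [stepAux]
    cases f v
    · exact ih₂ _ _ _ fun k t ht => h k t (by simp [radius, ht])
    · exact ih₁ _ _ _ fun k t ht => h k t (by simp [radius, ht])
  | goto f => simp
  | halt => simp

/-- Entries are counted from the top. A new entry is either pushed, hence determined by the control
and the tops, or an old entry displaced by at most the radius. -/
lemma stepAux_cell (q : Stmt Γ Λ σ) (v : σ) (S S' : ∀ k, List (Γ k))
    (h : ∀ k, ∀ t < radius q, (S k)[t]? = (S' k)[t]?) (k₁ : K) (t₁ : ℕ)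
    (h₁ : ∀ t, t ≤ t₁ + radius q → t₁ ≤ t + radius q → (S k₁)[t]? = (S' k₁)[t]?) :
    ((stepAux q v S).stk k₁)[t₁]? = ((stepAux q v S').stk k₁)[t₁]? := by
  induction q generalizing v S S' with
  | push k' f q ih =>
    refine ih _ _ _ (fun k t ht => ?_) fun t ht ht' => ?_
    · by_cases hk : k = k'
      · subst hk
        rw [Function.update_self, Function.update_self]
        cases t with
        | zero => rfl
        | succ t => simpa using h k t (by simp [radius]; omega)
      · rw [Function.update_of_ne hk, Function.update_of_ne hk]
        exact h k t (by simp [radius]; omega)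
    · by_cases hk : k₁ = k'
      · subst hk
        rw [Function.update_self, Function.update_self]
        cases t with
        | zero => rfl
        | succ t => simpa using h₁ t (by simp [radius]; omega) (by simp [radius]; omega)
      · rw [Function.update_of_ne hk, Function.update_of_ne hk]
        exact h₁ t (by simp [radius]; omega) (by simp [radius]; omega)
  | peek k' f q ih =>
    have h0 : (S k').head? = (S' k').head? := by
      simpa [List.head?_eq_getElem?] using h k' 0 (by simp [radius])
    simp only [stepAux, h0]
    exact ih _ _ _ (fun k t ht => h k t (by simp [radius]; omega))
      fun t ht ht' => h₁ t (by simp [radius]; omega) (by simp [radius]; omega)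
  | pop k' f q ih =>
    have h0 : (S k').head? = (S' k').head? := by
      simpa [List.head?_eq_getElem?] using h k' 0 (by simp [radius])
    simp only [stepAux, h0]
    refine ih _ _ _ (fun k t ht => ?_) fun t ht ht' => ?_
    · by_cases hk : k = k'
      · subst hk
        simpa using h k (t + 1) (by simp [radius]; omega)
      · rw [Function.update_of_ne hk, Function.update_of_ne hk]
        exact h k t (by simp [radius]; omega)
    · by_cases hk : k₁ = k'
      · subst hk
        simpa using h₁ (t + 1) (by simp [radius]; omega) (by simp [radius]; omega)
      · rw [Function.update_of_ne hk, Function.update_of_ne hk]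
        exact h₁ t (by simp [radius]; omega) (by simp [radius]; omega)
  | load f q ih => exact ih _ _ _ h h₁
  | branch f q₁ q₂ ih₁ ih₂ =>
    simp only [stepAux]
    cases f v
    · exact ih₂ _ _ _ (fun k t ht => h k t (by simp [radius, ht]))
        fun t ht ht' => h₁ t (by simp [radius]; omega) (by simp [radius]; omega)
    · exact ih₁ _ _ _ (fun k t ht => h k t (by simp [radius, ht]))
        fun t ht ht' => h₁ t (by simp [radius]; omega) (by simp [radius]; omega)
  | goto f => exact h₁ t₁ (by simp) (by simp)
  | halt => exact h₁ t₁ (by simp) (by simp)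

/-- One step; halting configurations stay as they are. -/
def nextCfg (M : Λ → Stmt Γ Λ σ) (c : Cfg Γ Λ σ) : Cfg Γ Λ σ := (step M c).getD c

/-- The control and the top `R` entries of all stacks determine the action, and a stack cell depends
besides on a window of `2 * R + 1` cells. The set `I` depends on the cell only, as
`JointlyComputed.cellular` requires. -/
lemma nextCfg_local [Fintype K] (M : Λ → Stmt Γ Λ σ) {R : ℕ} (hR : ∀ l, radius (M l) ≤ R)
    (i : Option (K × ℕ)) : ∃ I : Finset (Option (K × ℕ)),
      I.card ≤ 1 + Fintype.card K * R + (2 * R + 1) ∧ ∀ c c' : Cfg Γ Λ σ,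
        (∀ j ∈ I, cfgCell c j = cfgCell c' j) →
          cfgCell (nextCfg M c) i = cfgCell (nextCfg M c') i := by
  classical
  let I₀ : Finset (Option (K × ℕ)) :=
    {none} ∪ ((Finset.univ : Finset K) ×ˢ Finset.range R).image some
  have hI₀ : I₀.card ≤ 1 + Fintype.card K * R := by
    refine (Finset.card_union_le _ _).trans ?_
    refine Nat.add_le_add (by simp) (Finset.card_image_le.trans ?_)
    simp
  let I₁ : Finset (Option (K × ℕ)) := i.elim ∅ fun p =>
    (Finset.Icc (p.2 - R) (p.2 + R)).image fun t' => some (p.1, t')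
  have hI₁ : I₁.card ≤ 2 * R + 1 := by
    cases i with
    | none => simp [I₁]
    | some p =>
      refine Finset.card_image_le.trans ?_
      simp; omega
  refine ⟨I₀ ∪ I₁, (Finset.card_union_le _ _).trans (by omega), ?_⟩
  rintro ⟨l, v, S⟩ ⟨l', v', S'⟩ h
  have h0 := cfgCell_none_eq.1 (h none (by simp [I₀]))
  simp only at h0
  obtain ⟨rfl, rfl⟩ := h0
  have htop : ∀ k, ∀ t < R, (S k)[t]? = (S' k)[t]? := fun k t ht =>
    cfgCell_some_eq.1 (h (some (k, t)) (by simp [I₀, ht]))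
  have hcell : ∀ k t, i = some (k, t) → ∀ t', t' ≤ t + R → t ≤ t' + R →
      (S k)[t']? = (S' k)[t']? := by
    rintro k t rfl t' h1 h2
    exact cfgCell_some_eq.1 (h (some (k, t')) (by simp [I₁]; right; omega))
  match l, i with
  | none, none => simp [nextCfg, cfgCell]
  | none, some (k, t) =>
    refine cfgCell_some_eq.2 ?_
    exact hcell k t rfl t (by omega) (by omega)
  | some l, none =>
    exact cfgCell_none_eq.2 (stepAux_control (M l) v S S' fun k t ht =>
      htop k t (ht.trans_le (hR l)))
  | some l, some (k, t) =>
    have := hR l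
    exact cfgCell_some_eq.2 (stepAux_cell (M l) v S S' (fun k t ht =>
      htop k t (ht.trans_le (hR l))) k t fun t' h1 h2 => hcell k t rfl t' (by omega) (by omega))

lemma length_nextCfg (M : Λ → Stmt Γ Λ σ) {R : ℕ} (hR : ∀ l, radius (M l) ≤ R)
    (c : Cfg Γ Λ σ) (k : K) : ((nextCfg M c).stk k).length ≤ (c.stk k).length + R := by
  obtain ⟨l, v, S⟩ := c
  cases l with
  | none => simp [nextCfg]
  | some l => exact (length_stepAux (M l) v S k).trans (Nat.add_le_add_left (hR l) _)

lemma mem_nextCfg (M : Λ → Stmt Γ Λ σ) (A : Set (Σ k, Γ k)) (hA : ∀ l, pushed (M l) ⊆ A)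
    (c : Cfg Γ Λ σ) (hc : ∀ k, ∀ a ∈ c.stk k, (⟨k, a⟩ : Σ k, Γ k) ∈ A) :
    ∀ k, ∀ a ∈ (nextCfg M c).stk k, (⟨k, a⟩ : Σ k, Γ k) ∈ A := by
  obtain ⟨l, v, S⟩ := c
  cases l with
  | none => exact hc
  | some l => exact mem_stepAux (M l) v S A (hA l) hc

lemma iterate_getD_of_evalsTo {C : Type*} (f : C → Option C) (n : ℕ) (a b : C)
    (h : (flip Bind.bind f)^[n] (some a) = some b) : (fun c => (f c).getD c)^[n] a = b := by
  induction n generalizing a with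
  | zero => simpa using h
  | succ n ih =>
    rw [Function.iterate_succ_apply] at h ⊢
    have hnone : ∀ n, (flip Bind.bind f)^[n] none = none := fun n => by
      induction n with
      | zero => rfl
      | succ n ih => rw [Function.iterate_succ_apply]; exact ih
    have h' : flip Bind.bind f (some a) = f a := rfl
    rw [h'] at h
    cases hfa : f a with
    | none => rw [hfa, hnone] at h; exact absurd h (by simp)
    | some a' => rw [hfa] at h; exact ih a' h

/-- Halting times vary with the input, whereas a circuit has a fixed number of layers. Halting
configurations are fixed points of the totalised step, so all runs are final at time `T`. -/
lemma iterate_getD_eq {C : Type*} (f : C → Option C) {n T : ℕ} (hn : n ≤ T) (a b : C)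
    (h : (flip Bind.bind f)^[n] (some a) = some b) (hb : f b = none) :
    (fun c => (f c).getD c)^[T] a = b := by
  obtain ⟨r, rfl⟩ := Nat.exists_eq_add_of_le' hn
  rw [Function.iterate_add_apply, iterate_getD_of_evalsTo f n a b h]
  exact Function.iterate_fixed (by simp [hb]) r

end StackMachine

/-! ### Unrolling polynomial-time machines into circuits -/

section Simulation

open Turing

/-- A list-valued function of bits of constant length, each of whose symbols depends on at most one
bit. -/
def BitLocal {ι A : Type*} (g : (ι → Bool) → List A) (ℓ : ℕ) : Prop :=
  (∀ y, (g y).length = ℓ) ∧ ∀ t : ℕ, ∃ I : Finset ι, I.card ≤ 1 ∧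
    ∀ y y' : ι → Bool, (∀ i ∈ I, y i = y' i) → (g y)[t]? = (g y')[t]?

lemma initList_stk_self (tm : FinTM2) (s : List (tm.Γ tm.k₀)) :
    (initList tm s).stk tm.k₀ = s := by
  simp [initList]

lemma initList_stk_of_ne (tm : FinTM2) (s : List (tm.Γ tm.k₀)) {k : tm.K} (h : k ≠ tm.k₀) :
    (initList tm s).stk k = [] := by
  simp [initList, h]

lemma haltList_stk_self (tm : FinTM2) (s : List (tm.Γ tm.k₁)) :
    (haltList tm s).stk tm.k₁ = s := by
  simp [haltList]

/-- Polynomial-time functions have small circuits. -/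
theorem exists_jointlyComputed_output {α β αΓ βΓ : Type} {ea : α → List αΓ} {eb : β → List βΓ}
    {f : α → β} (tc : TM2ComputableInPolyTime ea eb f) :
    ∃ C R : ℕ, ∀ (d ℓ : ℕ) (inp : (Fin d → Bool) → α), BitLocal (fun y => ea (inp y)) ℓ →
      JointlyComputed (cellFns fun (y : Fin d → Bool) (t : ℕ) => (eb (f (inp y)))[t]?)
        (C * (tc.time.eval ℓ + 1) * (ℓ + tc.time.eval ℓ * R + 1)) ∧
      ∀ y, (eb (f (inp y))).length ≤ ℓ + tc.time.eval ℓ * R := by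
  classical
  let tm := tc.tm
  let _ := tm.kFin
  let _ := tm.ΛFin
  let _ := tm.σFin
  let _ := tm.Γk₀Fin
  obtain ⟨R, hR⟩ : ∃ R, ∀ l, radius (tm.m l) ≤ R :=
    ⟨∑ l, radius (tm.m l), fun l =>
      Finset.single_le_sum (f := fun l => radius (tm.m l)) (fun _ _ => Nat.zero_le _)
        (Finset.mem_univ l)⟩
  -- The symbols that can ever occur: input symbols and pushed symbols. They are finitely many even
  -- if other stack alphabets are infinite.
  let A : Set (Σ k, tm.Γ k) := Set.range (Sigma.mk tm.k₀) ∪ ⋃ l, pushed (tm.m l)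
  have hAfin : A.Finite :=
    (Set.finite_range _).union (Set.finite_iUnion fun l => pushed_finite (tm.m l))
  let VF : Finset ((Option tm.Λ × tm.σ) ⊕ Option (Σ k, tm.Γ k)) :=
    (Finset.univ : Finset (Option tm.Λ × tm.σ)).image Sum.inl ∪
      (Finset.insertNone hAfin.toFinset).image Sum.inr
  let B := 1 + Fintype.card tm.K * R + (2 * R + 1)
  refine ⟨(Fintype.card tm.K + 1) * VF.card * (juntaCost 1 + juntaCost (B * VF.card)) + 8, R,
    fun d ℓ inp hinp => ?_⟩
  set T := tc.time.eval ℓ with hT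
  let st : ℕ → (Fin d → Bool) → tm.Cfg := fun τ y =>
    (nextCfg tm.m)^[τ] (initList tm ((ea (inp y)).map tc.inputAlphabet.invFun))
  have hst : ∀ τ y, st (τ + 1) y = nextCfg tm.m (st τ y) := fun τ y =>
    Function.iterate_succ_apply' _ _ _
  have hlen : ∀ τ y k, ((st τ y).stk k).length ≤ ℓ + τ * R := by
    intro τ
    induction τ with
    | zero =>
      intro y k
      by_cases hk : k = tm.k₀
      · subst hk
        change ((initList tm _).stk tm.k₀).length ≤ _
        rw [initList_stk_self, List.length_map, hinp.1]
        simp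
      · change ((initList tm _).stk k).length ≤ _
        rw [initList_stk_of_ne _ _ hk]
        simp
    | succ τ ih =>
      intro y k
      rw [hst]
      refine (length_nextCfg tm.m hR _ k).trans ?_
      have := ih y k
      rw [add_mul]
      omega
  have hmem : ∀ τ y k, ∀ a ∈ (st τ y).stk k, (⟨k, a⟩ : Σ k, tm.Γ k) ∈ A := by
    intro τ
    induction τ with
    | zero =>
      intro y k a ha
      by_cases hk : k = tm.k₀
      · subst hk
        exact Or.inl ⟨a, rfl⟩
      · change a ∈ (initList tm _).stk k at ha
        rw [initList_stk_of_ne _ _ hk] at ha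
        simp at ha
    | succ τ ih =>
      intro y
      rw [hst]
      exact mem_nextCfg tm.m A (fun l => (Set.subset_iUnion (fun l => pushed (tm.m l)) l).trans
        Set.subset_union_right) _ (ih y)
  have hV : ∀ τ y i, cfgCell (st τ y) i ∈ VF := by
    intro τ y i
    match i with
    | none => exact Finset.mem_union_left _ (Finset.mem_image_of_mem _ (Finset.mem_univ _))
    | some (k, t) =>
      refine Finset.mem_union_right _ (Finset.mem_image_of_mem _ ?_)
      rw [Finset.mem_insertNone]
      intro p hp
      rw [Option.mem_def, Option.map_eq_some_iff] at hp
      obtain ⟨a, ha, rfl⟩ := hp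
      exact hAfin.mem_toFinset.2 (hmem τ y k a (List.mem_of_getElem? ha))
  -- Up to time `T` no stack exceeds `ℓ + T * R` entries, so all deeper cells are blank for every
  -- input.
  let Act : Finset (Option (tm.K × ℕ)) :=
    {none} ∪ ((Finset.univ : Finset tm.K) ×ˢ Finset.range (ℓ + T * R)).image some
  have hActcard : Act.card ≤ (Fintype.card tm.K + 1) * (ℓ + T * R + 1) := by
    refine (Finset.card_union_le _ _).trans ?_
    have h1 : (((Finset.univ : Finset tm.K) ×ˢ Finset.range (ℓ + T * R)).image some).card ≤
        Fintype.card tm.K * (ℓ + T * R) := Finset.card_image_le.trans (by simp)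
    rw [Finset.card_singleton]
    nlinarith
  have hAct : ∀ τ ≤ T, ∀ i ∉ Act, ∀ x y, cfgCell (st τ x) i = cfgCell (st τ y) i := by
    intro τ hτ i hi x y
    match i with
    | none => exact absurd hi (by simp [Act])
    | some (k, t) =>
      have ht : ℓ + T * R ≤ t := by
        by_contra h
        exact hi (by simp [Act]; omega)
      refine cfgCell_some_eq.2 ?_
      have h1 := hlen τ x k
      have h2 := hlen τ y k
      have h3 : τ * R ≤ T * R := Nat.mul_le_mul_right _ hτ
      rw [List.getElem?_eq_none (by omega), List.getElem?_eq_none (by omega)]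
  -- At time 0 every cell is a junta of at most one input bit, by `BitLocal`; the other stacks are
  -- empty.
  have hinit : JointlyComputed (cellFns fun y => cfgCell (st 0 y))
      (0 + (Fintype.card tm.K + 1) * (ℓ + T * R + 1) * VF.card * juntaCost 1 + 8) := by
    refine JointlyComputed.cellFns VF (hV 0) Act hActcard (hAct 0 (Nat.zero_le _)) ?_
      jointlyComputed_inputs
    intro i _ v
    obtain ⟨I, hI, h⟩ : ∃ I : Finset (Fin d), I.card ≤ 1 ∧ ∀ x y, (∀ j ∈ I, x j = y j) →
        cfgCell (st 0 x) i = cfgCell (st 0 y) i := by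
      match i with
      | none => exact ⟨∅, by simp, fun x y _ => rfl⟩
      | some (k, t) =>
        by_cases hk : k = tm.k₀
        · subst hk
          obtain ⟨I, hI, h⟩ := hinp.2 t
          refine ⟨I, hI, fun x y hxy => cfgCell_some_eq.2 ?_⟩
          change ((initList tm _).stk tm.k₀)[t]? = ((initList tm _).stk tm.k₀)[t]?
          rw [initList_stk_self, initList_stk_self, List.getElem?_map, List.getElem?_map]
          exact congrArg _ (h x y hxy)
        · refine ⟨∅, by simp, fun x y _ => cfgCell_some_eq.2 ?_⟩
          change ((initList tm _).stk k)[t]? = ((initList tm _).stk k)[t]?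
          rw [initList_stk_of_ne _ _ hk, initList_stk_of_ne _ _ hk]
    refine (addCost_junta (F := Set.range fun (j : Fin d) (x : Fin d → Bool) => x j) I
      (fun j x => x j) (fun j _ => ⟨j, rfl⟩) ?_).mono subset_rfl
      (juntaCost_mono hI)
    intro x y hxy
    unfold oneHot
    beta_reduce
    rw [h x y hxy]
  have hfinal := JointlyComputed.cellular (fun τ y => cfgCell (st τ y)) VF hV Act (B := B)
    hActcard hAct (fun i => by
      obtain ⟨I, hI, h⟩ := nextCfg_local tm.m hR i
      exact ⟨I, hI, fun τ x y hxy => by rw [hst, hst]; exact h _ _ hxy⟩) hinit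
  have hhalt : ∀ y, (st T y).stk tm.k₁ = (eb (f (inp y))).map tc.outputAlphabet.invFun := by
    intro y
    obtain ⟨⟨n, hn⟩, hle⟩ := tc.outputsFun (inp y)
    have h2 : n ≤ T := by
      rw [hinp.1 y] at hle
      exact hle
    have h3 : st T y = haltList tm ((eb (f (inp y))).map tc.outputAlphabet.invFun) :=
      iterate_getD_eq tc.tm.step h2 _ _ hn rfl
    rw [h3]
    exact haltList_stk_self _ _
  constructor
  · refine hfinal.mono ?_ ?_
    · rintro _ ⟨t, v, rfl⟩
      -- Identification of alphabets is injective, so the indicator of an output symbol is the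
      -- indicator of a cell of the output stack.
      refine ⟨some (tm.k₁, t), .inr (v.map fun b => ⟨tm.k₁, tc.outputAlphabet.invFun b⟩), ?_⟩
      funext y
      rw [Bool.eq_iff_iff, oneHot_eq_true, oneHot_eq_true]
      simp only [cfgCell, hhalt, List.getElem?_map, Sum.inr.injEq, Option.map_map]
      refine (Function.Injective.eq_iff (Option.map_injective ?_)).symm
      exact sigma_mk_injective.comp tc.outputAlphabet.symm.injective
    · set n := ℓ + T * R + 1
      set a := (Fintype.card tm.K + 1) * VF.card
      have e1 : (Fintype.card tm.K + 1) * n * VF.card = a * n := by ring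
      have hn : 1 ≤ n := by omega
      rw [e1]
      set j1 := juntaCost 1
      set j2 := juntaCost (B * VF.card)
      have e2 : (a * (j1 + j2) + 8) * (T + 1) * n =
        (a * n * j1 + T * (a * n * j2 + 8)) + a * n * j1 * T + a * n * j2 + 8 * T * (n - 1) +
          8 * n := by
        obtain ⟨n', hn'⟩ := Nat.exists_eq_add_of_le' hn
        rw [hn']; simp only [Nat.add_sub_cancel]; ring
      rw [e2]
      omega
  · intro y
    have := hlen T y tm.k₁
    rwa [hhalt, List.length_map] at this

end Simulation

/-! ### Weighted counting of large answers by an automaton -/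

/-- The states of the automaton: the number of answers seen, the sum of weights so far, and the
result of comparing the last denominator with twice the numerator: whether the digits so far are
less, and the pending digit. -/
abbrev ScanState : Type := ℕ × ℤ × Bool × Bool

/-- The sum of weights after the last answer has ended. -/
def scanValue (wt : ℕ → ℤ) (q : ScanState) : ℤ :=
  q.2.1 + if q.2.2.1 || q.2.2.2 then wt q.1 else 0

/-- The automaton reads one symbol of the encoding of a sequence of rationals. -/
def scanStep (wt : ℕ → ℤ) (q : ScanState) : Bool ⊕ (Bool × Bool) → ScanState
  | .inl _ => (q.1 + 1, scanValue wt q, false, false)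
  | .inr (a, b) => (q.1, q.2.1, if q.2.2.2 = b then q.2.2.1 else q.2.2.2, a)

lemma mod_two_pow_add_one (x i : ℕ) :
    x % 2 ^ (i + 1) = x % 2 ^ i + 2 ^ i * (x.testBit i).toNat := by
  rw [Nat.mod_pow_succ, Nat.toNat_testBit]

/-- With least significant digits first, a later unequal digit overrides the comparison and an equal
one preserves it. Digit `i + 1` of `2 * x` is digit `i` of `x`, which is why one digit is kept
pending. -/
lemma foldl_scanStep_digits (wt : ℕ → ℤ) (c : ℕ) (s : ℤ) (x y L : ℕ) :
    ((List.range L).map fun i => (Sum.inr (x.testBit i, y.testBit i) : Bool ⊕ (Bool × Bool))).foldl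
      (scanStep wt) (c, s, false, false) =
      (c, s, decide (y % 2 ^ L < (2 * x) % 2 ^ L), (2 * x).testBit L) := by
  induction L with
  | zero => simp [Nat.mod_one]
  | succ L ih =>
    rw [List.range_succ, List.map_append, List.foldl_append, ih]
    have h1 : (2 * x).testBit (L + 1) = x.testBit L := by
      rw [Nat.testBit_succ, Nat.mul_div_cancel_left _ (by norm_num)]
    have hy := mod_two_pow_add_one y L
    have hx := mod_two_pow_add_one (2 * x) L
    have hy' : y % 2 ^ L < 2 ^ L := Nat.mod_lt _ (by positivity)
    have hx' : 2 * x % 2 ^ L < 2 ^ L := Nat.mod_lt _ (by positivity)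
    simp only [List.map_cons, List.map_nil, List.foldl_cons, List.foldl_nil, scanStep, h1, hx, hy,
      Prod.mk.injEq, true_and, and_true]
    rw [Bool.eq_iff_iff]
    cases (2 * x).testBit L <;> cases y.testBit L <;>
      simp only [Bool.toNat, cond_true, cond_false, if_true, mul_one, mul_zero, add_zero,
        decide_eq_true_eq, Bool.false_eq_true, Bool.true_eq_false, if_false, false_iff,
        true_iff] <;> omega

/-- The condition is that the denominator is less than twice the numerator. The doubled numerator
may need one digit more than `L`, and this is the pending one: if it is set, the denominator is
smaller; otherwise the comparison modulo `2 ^ L` is exact. -/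
lemma foldl_scanStep_encRat (wt : ℕ → ℤ) (q : ScanState) (a : ℚ) :
    ∃ g p : Bool, (encRat a).foldl (scanStep wt) q = (q.1 + 1, scanValue wt q, g, p) ∧
      ((g || p) = true ↔ 1 / 2 < |a|) := by
  refine ⟨_, _, by rw [encRat, List.foldl_cons]; exact foldl_scanStep_digits wt _ _ _ _ _, ?_⟩
  set x := a.num.natAbs with hx
  set y := a.den with hy
  set L := max x.size y.size
  have hyL : y < 2 ^ L := Nat.size_le.1 (le_max_right _ _)
  have hxL : x < 2 ^ L := Nat.size_le.1 (le_max_left _ _)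
  have h1 := mod_two_pow_add_one (2 * x) L
  rw [Nat.mod_eq_of_lt (by rw [pow_succ]; omega)] at h1
  have h2 : 1 / 2 < |a| ↔ y < 2 * x := by
    have hden : (0 : ℚ) < a.den := by exact_mod_cast a.den_pos
    have habs : |a| = (x : ℚ) / y := by
      conv_lhs => rw [← Rat.num_div_den a]
      rw [abs_div, abs_of_pos hden, hx, Nat.cast_natAbs, Int.cast_abs]
    rw [habs, div_lt_div_iff₀ (by norm_num) (by rw [hy]; exact hden), one_mul]
    constructor
    · intro h; have : (y : ℚ) < (2 * x : ℕ) := by push_cast; linarith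
      exact_mod_cast this
    · intro h; have : (y : ℚ) < (2 * x : ℕ) := by exact_mod_cast h
      push_cast at this; linarith
  rw [h2, Nat.mod_eq_of_lt hyL, Bool.or_eq_true, decide_eq_true_eq]
  cases hb : (2 * x).testBit L <;> rw [hb] at h1 <;> simp at h1 ⊢ <;> omega

/-- The sign that opens an answer also settles the previous one, so the last weight is still
outstanding and is added by `scanValue`. The counter increases at the sign, which explains the
offset 1. -/
lemma scanValue_foldl (wt : ℕ → ℤ) {k : ℕ} (v : Fin k → ℚ) (q : ScanState) :
    scanValue wt ((encRats (List.ofFn v)).foldl (scanStep wt) q) =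
      scanValue wt q + ∑ j : Fin k, if 1 / 2 < |v j| then wt (q.1 + 1 + j) else 0 := by
  induction k generalizing q with
  | zero => simp [encRats]
  | succ k ih =>
    obtain ⟨g, p, h, h'⟩ := foldl_scanStep_encRat wt q (v 0)
    rw [List.ofFn_succ, encRats, List.flatMap_cons, List.foldl_append, h, ← encRats, ih,
      Fin.sum_univ_succ, ← add_assoc]
    congr 1
    · simp only [scanValue, h', Fin.val_zero, add_zero]
    · refine Finset.sum_congr rfl fun j _ => ?_
      simp only [Fin.val_succ]
      congr 2
      omega

/-- The automaton on cells: a blank cell changes nothing. -/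
def scanCell (wt : ℕ → ℤ) (q : ScanState) : Option (Bool ⊕ (Bool × Bool)) → ScanState
  | none => q
  | some a => scanStep wt q a

/-- The state after `t` cells. -/
def scanRun (wt : ℕ → ℤ) (l : List (Bool ⊕ (Bool × Bool))) : ℕ → ScanState
  | 0 => (0, 0, false, false)
  | t + 1 => scanCell wt (scanRun wt l t) l[t]?

lemma scanRun_eq_foldl (wt : ℕ → ℤ) (l : List (Bool ⊕ (Bool × Bool))) (t : ℕ) :
    scanRun wt l t = (l.take t).foldl (scanStep wt) (0, 0, false, false) := by
  induction t with
  | zero => simp [scanRun]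
  | succ t ih =>
    rw [scanRun, ih, List.take_add_one, List.foldl_append]
    cases l[t]? <;> rfl

lemma scanRun_bound (wt : ℕ → ℤ) {B : ℕ} (hB : ∀ c, |wt c| ≤ B)
    (l : List (Bool ⊕ (Bool × Bool))) (t : ℕ) :
    (scanRun wt l t).1 ≤ t ∧ |(scanRun wt l t).2.1| ≤ t * B := by
  induction t with
  | zero => simp [scanRun]
  | succ t ih =>
    rw [scanRun]
    rcases l[t]? with _ | b | ⟨a, b⟩
    · refine ⟨ih.1.trans (Nat.le_succ _), ih.2.trans ?_⟩
      push_cast; nlinarith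
    · refine ⟨Nat.succ_le_succ ih.1, ?_⟩
      simp only [scanCell, scanStep, scanValue]
      refine (abs_add_le _ _).trans ?_
      have h1 : |if (scanRun wt l t).2.2.1 || (scanRun wt l t).2.2.2 then
          wt (scanRun wt l t).1 else 0| ≤ B := by
        split_ifs
        · exact hB _
        · simp
      push_cast
      linarith [ih.2]
    · refine ⟨ih.1.trans (Nat.le_succ _), ih.2.trans ?_⟩
      push_cast; nlinarith

/-- The number of states of the automaton on strings of length `ℓ` with weights at most `B`. -/
def scanStates (ℓ B : ℕ) : ℕ := (ℓ + 1) * ((2 * (ℓ * B) + 1) * 4)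

/-- The size of a circuit that tests the answers of a polynomial-time algorithm with running
time `T` on inputs of length `ℓ`. -/
def testSize (C R T ℓ B : ℕ) : ℕ :=
  C * (T + 1) * (ℓ + T * R + 1) + 8 +
    (ℓ + T * R) * (scanStates (ℓ + T * R) B * (4 * (scanStates (ℓ + T * R) B * 7) + 1)) +
    (1 + scanStates (ℓ + T * R) B)

open Turing in
/-- A linear threshold test on the rounded answers of a polynomial-time algorithm is computed by a
small circuit. -/
theorem exists_test_circuit {α αΓ : Type} {ea : α → List αΓ} {f : α → List ℚ}
    (tc : TM2ComputableInPolyTime ea encRats f) :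
    ∃ C R : ℕ, ∀ (d ℓ : ℕ) (inp : (Fin d → Bool) → α), BitLocal (fun y => ea (inp y)) ℓ →
      ∀ (k : ℕ) (v : (Fin d → Bool) → Fin k → ℚ), (∀ y, f (inp y) = List.ofFn (v y)) →
      ∀ (wt : Fin k → ℤ) (B : ℕ), (∀ j, |wt j| ≤ B) → ∀ Z : ℤ,
        ∃ A : Circuit d, A.size ≤ testSize C R (tc.time.eval ℓ) ℓ B ∧
          ∀ y, A.eval y = true ↔ Z ≤ ∑ j, if 1 / 2 < |v y j| then wt j else 0 := by
  classical
  obtain ⟨C, R, h⟩ := exists_jointlyComputed_output tc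
  refine ⟨C, R, fun d ℓ inp hinp k v hv wt B hB Z => ?_⟩
  obtain ⟨hjc, hlen⟩ := h d ℓ inp hinp
  set T := tc.time.eval ℓ
  set ℓ' := ℓ + T * R
  -- The automaton numbers the answers from 1.
  let wt' : ℕ → ℤ := fun c => if h : c - 1 < k ∧ 0 < c then wt ⟨c - 1, h.1⟩ else 0
  have hB' : ∀ c, |wt' c| ≤ B := by
    intro c
    by_cases h : c - 1 < k ∧ 0 < c
    · simp only [wt', h, and_self, dite_true]; exact hB _
    · simp only [wt', h, dite_false]; simp
  let Qs : Finset ScanState :=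
    Finset.range (ℓ' + 1) ×ˢ (Finset.Icc (-((ℓ' * B : ℕ) : ℤ)) ((ℓ' * B : ℕ) : ℤ) ×ˢ
      (Finset.univ : Finset (Bool × Bool)))
  have hQs : Qs.card = scanStates ℓ' B := by
    simp only [Qs, Finset.card_product, Finset.card_range, Int.card_Icc, Finset.card_univ,
      Fintype.card_prod, Fintype.card_bool, scanStates]
    congr 2
    omega
  have hacc : ∀ y, scanValue wt' (scanRun wt' (encRats (f (inp y))) ℓ') =
      ∑ j, if 1 / 2 < |v y j| then wt j else 0 := by
    intro y
    rw [scanRun_eq_foldl, List.take_of_length_le (hlen y), hv, scanValue_foldl]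
    simp only [scanValue, Bool.or_self, Bool.false_eq_true, if_false, add_zero, zero_add]
    refine Finset.sum_congr rfl fun j _ => ?_
    have : wt' (1 + j) = wt j := by
      have h1 : (1 + (j : ℕ)) - 1 = j := by omega
      simp only [wt', h1, j.2, true_and]
      rw [dif_pos (by omega)]
    rw [this]
  obtain ⟨A, hA, hA'⟩ := (JointlyComputed.automaton
    (fun y t => (encRats (f (inp y)))[t]?) Finset.univ (fun _ _ => Finset.mem_univ _)
    (scanCell wt') (0, 0, false, false) Qs ℓ' (fun t y => scanRun wt' (encRats (f (inp y))) t)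
    (fun _ => rfl) (fun _ _ => rfl) (fun t ht y => by
      obtain ⟨h1, h2⟩ := scanRun_bound wt' hB' (encRats (f (inp y))) t
      have h3 : ((t * B : ℕ) : ℤ) ≤ ((ℓ' * B : ℕ) : ℤ) := by
        exact_mod_cast Nat.mul_le_mul_right B ht
      have h4 := abs_le.1 h2
      push_cast at h3
      simp only [Qs, Finset.mem_product, Finset.mem_range, Finset.mem_Icc, Finset.mem_univ,
        and_true]
      push_cast
      exact ⟨by omega, by linarith, by linarith⟩)
    (fun q => Z ≤ scanValue wt' q) (fun y => decide (Z ≤ ∑ j, if 1 / 2 < |v y j| then wt j else 0))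
    (fun y => by rw [decide_eq_true_eq, hacc]) hjc).exists_circuit
  refine ⟨A, hA.trans (le_of_eq ?_), fun y => by rw [hA', decide_eq_true_eq]⟩
  -- The factor 7 counts the contents of an output cell: blank, two signs, four pairs of digits.
  rw [hQs, testSize]
  rfl

/-! ### Encodings that depend locally on hard-wired bits -/

section BitLocal

variable {ι A : Type*}

lemma bitLocal_const (l : List A) : BitLocal (fun _ : ι → Bool => l) l.length :=
  ⟨fun _ => rfl, fun _ => ⟨∅, by simp, fun _ _ _ => rfl⟩⟩

lemma BitLocal.append {g₁ g₂ : (ι → Bool) → List A} {ℓ₁ ℓ₂ : ℕ} (h₁ : BitLocal g₁ ℓ₁)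
    (h₂ : BitLocal g₂ ℓ₂) : BitLocal (fun y => g₁ y ++ g₂ y) (ℓ₁ + ℓ₂) := by
  refine ⟨fun y => by rw [List.length_append, h₁.1, h₂.1], fun t => ?_⟩
  by_cases ht : t < ℓ₁
  · obtain ⟨I, hI, h⟩ := h₁.2 t
    refine ⟨I, hI, fun y y' hy => ?_⟩
    rw [List.getElem?_append_left (by rwa [h₁.1]), List.getElem?_append_left (by rwa [h₁.1]),
      h y y' hy]
  · obtain ⟨I, hI, h⟩ := h₂.2 (t - ℓ₁)
    refine ⟨I, hI, fun y y' hy => ?_⟩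
    rw [List.getElem?_append_right (by rw [h₁.1]; omega),
      List.getElem?_append_right (by rw [h₁.1]; omega), h₁.1, h₁.1, h y y' hy]

lemma BitLocal.flatMap_ofFn {k : ℕ} {g : Fin k → (ι → Bool) → List A} {ℓ : Fin k → ℕ}
    (h : ∀ j, BitLocal (g j) (ℓ j)) :
    BitLocal (fun y => (List.ofFn fun j => g j y).flatten) (∑ j, ℓ j) := by
  induction k with
  | zero => simpa using bitLocal_const ([] : List A)
  | succ k ih =>
    rw [Fin.sum_univ_succ]
    simp only [List.ofFn_succ, List.flatten_cons]
    exact (h 0).append (ih fun j => h j.succ)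

/-- Substitution of bits, each of which depends on at most one new bit. -/
lemma BitLocal.comp {κ : Type*} {g : (ι → Bool) → List A} {ℓ : ℕ} (h : BitLocal g ℓ)
    {u : (κ → Bool) → ι → Bool} (hu : ∀ i, ∃ J : Finset κ, J.card ≤ 1 ∧
      ∀ y y' : κ → Bool, (∀ j ∈ J, y j = y' j) → u y i = u y' i) :
    BitLocal (fun y => g (u y)) ℓ := by
  refine ⟨fun y => h.1 _, fun t => ?_⟩
  obtain ⟨I, hI, hI'⟩ := h.2 t
  rcases I.eq_empty_or_nonempty with rfl | ⟨i, hi⟩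
  · exact ⟨∅, by simp, fun y y' _ => hI' _ _ (by simp)⟩
  · obtain ⟨J, hJ, hJ'⟩ := hu i
    refine ⟨J, hJ, fun y y' hy => hI' _ _ fun i' hi' => ?_⟩
    rw [Finset.card_le_one.1 hI i' hi' i hi]
    exact hJ' y y' hy

end BitLocal

/-! ### Lengths of encodings -/

lemma length_encodePosNum_le (p : PosNum) : (encodePosNum p).length ≤ (p : ℕ) := by
  induction p with
  | one => simp [encodePosNum]
  | bit0 p ih =>
    have := PosNum.cast_pos (α := ℕ) p
    simp only [encodePosNum, List.length_cons, PosNum.cast_bit0]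
    omega
  | bit1 p ih =>
    have := PosNum.cast_pos (α := ℕ) p
    simp only [encodePosNum, List.length_cons, PosNum.cast_bit1]
    omega

lemma length_encNat_le (a : ℕ) : (encNat a).length ≤ a + 1 := by
  have h : (encodeNat a).length ≤ a := by
    have h1 : ∀ m : Num, (encodeNum m).length ≤ (m : ℕ) := by
      rintro (_ | p)
      · simp [encodeNum]
      · simpa [encodeNum] using length_encodePosNum_le p
    simpa [encodeNat] using h1 (a : Num)
  simpa [encNat, encodingNatΓ'] using h

lemma length_encWire_le {d m : ℕ} (w : Wire d m) : (encWire w).length ≤ d + m + 2 := by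
  rcases w with i | j
  · have := length_encNat_le i
    simp only [encWire, List.length_cons]
    omega
  · have := length_encNat_le j
    simp only [encWire, List.length_cons]
    omega

lemma length_flatMap_encWire_le {d m : ℕ} (ws : List (Wire d m)) :
    (ws.flatMap encWire).length ≤ ws.length * (d + m + 2) := by
  induction ws with
  | nil => simp
  | cons w ws ih =>
    have := length_encWire_le w
    rw [List.flatMap_cons, List.length_append, List.length_cons, add_mul]
    omega

lemma Gate.length_enc_le {d m : ℕ} (g : Gate d m) :
    g.enc.length ≤ 4 + g.wires.length * (d + m + 2) := by
  have h1 := length_flatMap_encWire_le g.wires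
  have h2 : g.tag.length = 2 := by cases g <;> rfl
  simp only [Gate.enc, List.length_cons, List.length_append, List.length_nil, h2]
  omega

/-! ### Families of circuits with hard-wired bits -/

/-- The depth of a wire. -/
def GateSeq.wireDepth {d m : ℕ} (c : GateSeq d m) : Wire d m → ℕ := Sum.elim (fun _ => 0) c.depth

lemma GateSeq.wireDepth_snoc_lift {d m : ℕ} (c : GateSeq d m) (g : Gate d m)
    (w : Wire d m) : (GateSeq.snoc c g).wireDepth (liftWire w) = c.wireDepth w := by
  cases w <;> simp [GateSeq.wireDepth, GateSeq.depth, liftWire]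

lemma GateSeq.wireDepth_snoc_last_le {d m : ℕ} (c : GateSeq d m) (g : Gate d m) {h : ℕ}
    (hw : ∀ w ∈ g.wires, c.wireDepth w ≤ h) :
    (GateSeq.snoc c g).wireDepth (.inr (Fin.last m)) ≤ h + 1 := by
  have key : ∀ l : List (Wire d m), (∀ w ∈ l, c.wireDepth w ≤ h) →
      (l.map (Sum.elim (fun _ => 0) c.depth)).foldr max 0 ≤ h := by
    intro l
    induction l with
    | nil => simp
    | cons w l ih =>
      intro hl
      rw [List.map_cons, List.foldr_cons]
      exact max_le (hl w List.mem_cons_self) (ih fun w' hw' => hl w' (List.mem_cons_of_mem _ hw'))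
  have := key _ hw
  simp only [GateSeq.wireDepth, GateSeq.depth, Sum.elim_inr, Fin.snoc_last]
  omega

/-- A function of hard-wired bits and of input bits, with a bound on the depth. -/
abbrev DepthFn (ι : Type) (d : ℕ) : Type := ((ι → Bool) → (Fin d → Bool) → Bool) × ℕ

/-- All functions in `F` are computed, in the given depth, by gate sequences of size at most `s`
which have the same wiring for all values of the hard-wired bits. -/
def FamilyComputed {ι : Type} {d : ℕ} (F : Set (DepthFn ι d)) (s : ℕ) : Prop :=
  ∃ (m ℓ : ℕ) (c : (ι → Bool) → GateSeq d m), m ≤ s ∧ ℓ ≤ s * (d + s + 5) ∧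
    (∀ y, (c y).size ≤ s) ∧ BitLocal (fun y => (c y).enc) ℓ ∧
    ∀ f ∈ F, ∃ w : Wire d m, ∀ y, (c y).wireDepth w ≤ f.2 ∧ ∀ x, (c y).val x w = f.1 y x

/-- The function `f` can be added to any family computing `F` with size `t`. -/
def FamilyCost {ι : Type} {d : ℕ} (F : Set (DepthFn ι d)) (f : DepthFn ι d) (t : ℕ) : Prop :=
  ∀ F' s, F ⊆ F' → FamilyComputed F' s → FamilyComputed (insert f F') (s + t)

section FamilyComputed

variable {ι : Type} {d : ℕ} {F F' : Set (DepthFn ι d)} {s t : ℕ}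

lemma familyComputed_inputs :
    FamilyComputed (Set.range fun i : Fin d => ((fun _ x => x i, 0) : DepthFn ι d)) 0 := by
  refine ⟨0, 0, fun _ => .nil, le_rfl, Nat.zero_le _, fun _ => le_rfl, bitLocal_const [], ?_⟩
  rintro _ ⟨i, rfl⟩
  exact ⟨.inl i, fun y => ⟨le_rfl, fun x => rfl⟩⟩

lemma FamilyComputed.mono (h : FamilyComputed F s) (hF : F' ⊆ F) : FamilyComputed F' s := by
  obtain ⟨m, ℓ, c, h1, h2, h3, h4, h5⟩ := h
  exact ⟨m, ℓ, c, h1, h2, h3, h4, fun f h => h5 f (hF h)⟩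

lemma FamilyComputed.addGate {m ℓ : ℕ} {c : (ι → Bool) → GateSeq d m} (hm : m ≤ s)
    (hℓ : ℓ ≤ s * (d + s + 5)) (hs : ∀ y, (c y).size ≤ s)
    (hloc : BitLocal (fun y => (c y).enc) ℓ)
    (hF : ∀ f ∈ F, ∃ w : Wire d m, ∀ y, (c y).wireDepth w ≤ f.2 ∧ ∀ x, (c y).val x w = f.1 y x)
    (g : (ι → Bool) → Gate d m) {r ℓ' : ℕ} (hr : ∀ y, (g y).wires.length = r)
    (hg : BitLocal (fun y => (g y).enc) ℓ') (f : DepthFn ι d) {h : ℕ} (hh : f.2 = h + 1)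
    (hd : ∀ y, ∀ w ∈ (g y).wires, (c y).wireDepth w ≤ h)
    (hf : ∀ y x, (g y).eval ((c y).val x) = f.1 y x) :
    FamilyComputed (insert f F) (s + (1 + r)) := by
  refine ⟨m + 1, ℓ + ℓ', fun y => .snoc (c y) (g y), by omega, ?_, fun y => ?_, hloc.append hg, ?_⟩
  · have h1 : ℓ' ≤ 4 + r * (d + m + 2) := by
      have := (g fun _ => false).length_enc_le
      rwa [hg.1, hr] at this
    have h2 : r * (d + m + 2) ≤ r * (d + s + 5) := Nat.mul_le_mul_left _ (by omega)
    have h3 : (s + (1 + r)) * (d + s + 5) ≤ (s + (1 + r)) * (d + (s + (1 + r)) + 5) :=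
      Nat.mul_le_mul_left _ (by omega)
    have h4 : (s + (1 + r)) * (d + s + 5) = s * (d + s + 5) + (d + s + 5) + r * (d + s + 5) := by
      ring
    omega
  · have := hs y
    simp only [GateSeq.size, hr]
    omega
  · rintro f' (rfl | h')
    · exact ⟨.inr (Fin.last m), fun y => ⟨hh ▸ (c y).wireDepth_snoc_last_le (g y) (hd y),
        fun x => by rw [GateSeq.val_snoc_last, hf]⟩⟩
    · obtain ⟨w, hw⟩ := hF f' h'
      exact ⟨liftWire w, fun y => ⟨by rw [GateSeq.wireDepth_snoc_lift]; exact (hw y).1,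
        fun x => by rw [GateSeq.val_snoc_lift, (hw y).2]⟩⟩

/-- A constant is a gate of fan-in 0. The encodings of both constants have four symbols and differ
only in the tag, so the hard-wired bits affect neither the wiring nor the length. -/
lemma familyCost_hardwired (i : ι) : FamilyCost F (fun y _ => y i, 1) 1 := by
  rintro F' s hF ⟨m, ℓ, c, h1, h2, h3, h4, h5⟩
  refine FamilyComputed.addGate (r := 0) (ℓ' := 4) h1 h2 h3 h4 h5
    (fun y => if y i then .conj [] else .disj []) ?_ ?_ _ (h := 0) rfl ?_ ?_
  · intro y; cases y i <;> rfl
  · refine ⟨fun y => by beta_reduce; cases y i <;> rfl, fun t => ⟨{i}, by simp, fun y y' hy => ?_⟩⟩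
    beta_reduce
    rw [hy i (by simp)]
  · intro y w; cases y i <;> simp [Gate.wires]
  · intro y x; cases h : y i <;> simp [Gate.eval, h]

lemma familyCost_not {f : (ι → Bool) → (Fin d → Bool) → Bool} {h : ℕ} (hf : (f, h) ∈ F) :
    FamilyCost F (fun y x => !f y x, h + 1) 2 := by
  rintro F' s hF ⟨m, ℓ, c, h1, h2, h3, h4, h5⟩
  obtain ⟨w, hw⟩ := h5 _ (hF hf)
  refine FamilyComputed.addGate (r := 1) h1 h2 h3 h4 h5 (fun _ => .neg w) (fun _ => rfl)
    (bitLocal_const _) _ (h := h) rfl ?_ ?_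
  · intro y w' hw'
    rw [Gate.wires, List.mem_singleton] at hw'
    exact hw' ▸ (hw y).1
  · intro y x
    simp [Gate.eval, (hw y).2]

lemma exists_family_wires {m : ℕ} {c : (ι → Bool) → GateSeq d m}
    (hF : ∀ f ∈ F, ∃ w : Wire d m, ∀ y, (c y).wireDepth w ≤ f.2 ∧ ∀ x, (c y).val x w = f.1 y x)
    {h : ℕ} : ∀ l : List ((ι → Bool) → (Fin d → Bool) → Bool),
      (∀ f ∈ l, ∃ h' ≤ h, (f, h') ∈ F) →
      ∃ ws : List (Wire d m), ws.length = l.length ∧ (∀ y, ∀ w ∈ ws, (c y).wireDepth w ≤ h) ∧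
        ∀ y x, ws.map ((c y).val x) = l.map fun f => f y x := by
  intro l
  induction l with
  | nil => exact fun _ => ⟨[], rfl, by simp, fun _ _ => rfl⟩
  | cons f l ih =>
    intro hl
    obtain ⟨ws, h1, h2, h3⟩ := ih fun g hg => hl g (List.mem_cons_of_mem _ hg)
    obtain ⟨h', hh', hf⟩ := hl f List.mem_cons_self
    obtain ⟨w, hw⟩ := hF _ hf
    refine ⟨w :: ws, by simp [h1], fun y w' hw' => ?_, fun y x => by simp [h3, (hw y).2]⟩
    rcases List.mem_cons.1 hw' with rfl | hw'
    · exact (hw y).1.trans hh'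
    · exact h2 y w' hw'

lemma familyCost_all {h : ℕ} (l : List ((ι → Bool) → (Fin d → Bool) → Bool))
    (hl : ∀ f ∈ l, ∃ h' ≤ h, (f, h') ∈ F) :
    FamilyCost F (fun y x => l.all fun f => f y x, h + 1) (1 + l.length) := by
  rintro F' s hF ⟨m, ℓ, c, h1, h2, h3, h4, h5⟩
  obtain ⟨ws, e1, e2, e3⟩ := exists_family_wires h5 l
    fun f hf => let ⟨h', a, b⟩ := hl f hf; ⟨h', a, hF b⟩
  refine FamilyComputed.addGate h1 h2 h3 h4 h5 (fun _ => .conj ws) (fun _ => e1)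
    (bitLocal_const _) _ (h := h) rfl e2 ?_
  intro y x
  have := congrArg (fun l => l.all id) (e3 y x)
  simpa [Gate.eval, List.all_map, Function.comp_def] using this

lemma familyCost_any {h : ℕ} (l : List ((ι → Bool) → (Fin d → Bool) → Bool))
    (hl : ∀ f ∈ l, ∃ h' ≤ h, (f, h') ∈ F) :
    FamilyCost F (fun y x => l.any fun f => f y x, h + 1) (1 + l.length) := by
  rintro F' s hF ⟨m, ℓ, c, h1, h2, h3, h4, h5⟩
  obtain ⟨ws, e1, e2, e3⟩ := exists_family_wires h5 l
    fun f hf => let ⟨h', a, b⟩ := hl f hf; ⟨h', a, hF b⟩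
  refine FamilyComputed.addGate h1 h2 h3 h4 h5 (fun _ => .disj ws) (fun _ => e1)
    (bitLocal_const _) _ (h := h) rfl e2 ?_
  intro y x
  have := congrArg (fun l => l.any id) (e3 y x)
  simpa [Gate.eval, List.any_map, Function.comp_def] using this

lemma FamilyComputed.union {α : Type*} (S : Finset α) (h : α → DepthFn ι d)
    (hc : ∀ i ∈ S, FamilyCost F (h i) t) (hs : FamilyComputed F s) :
    FamilyComputed (F ∪ h '' S) (s + S.card * t) := by
  classical
  induction S using Finset.induction_on with
  | empty => simpa using hs
  | insert i S hi ih =>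
    have h1 := ih fun j hj => hc j (Finset.mem_insert_of_mem hj)
    have h2 := hc i (Finset.mem_insert_self _ _) _ _ Set.subset_union_left h1
    rw [Finset.card_insert_of_notMem hi, Finset.coe_insert, Set.image_insert_eq, Set.union_insert,
      add_mul, one_mul, ← add_assoc]
    exact h2

lemma FamilyComputed.exists_circuits {f : (ι → Bool) → (Fin d → Bool) → Bool} {h : ℕ}
    (hf : FamilyComputed {(f, h)} s) :
    ∃ q : (ι → Bool) → Circuit d, (∃ ℓ ≤ (s + 1) * (d + s + 5), BitLocal (fun y => (q y).enc) ℓ) ∧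
      ∀ y, (q y).depth ≤ h ∧ (q y).size ≤ s ∧ ∀ x, (q y).eval x = f y x := by
  obtain ⟨m, ℓ, c, h1, h2, h3, h4, h5⟩ := hf
  obtain ⟨w, hw⟩ := h5 _ rfl
  refine ⟨fun y => ⟨c y, w⟩, ⟨1 + (ℓ + ((encWire w).length + 1)), ?_, ?_⟩,
    fun y => ⟨(hw y).1, h3 y, (hw y).2⟩⟩
  · have := length_encWire_le w
    rw [add_mul]
    omega
  · have h := (bitLocal_const (ι := ι) [Γ'.bra]).append
      (h4.append (bitLocal_const (encWire w ++ [Γ'.ket])))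
    simpa [Circuit.enc] using h

end FamilyComputed

/-- A bound on the size of the decryption queries. -/
def decryptSize (κ N L : ℕ) : ℕ :=
  (κ + κ) * 2 + N * 1 + N * 2 + N * 2 ^ L * (κ + L + 2) + (1 + N * 2 ^ L)

/-- The query that finds the hard-wired bit for the index of a row and masks it with a local
function of the key in the row. -/
theorem exists_decryption_query {κ N L : ℕ} (idx : Fin N → Fin κ → Bool)
    (g : (Fin κ → Bool) → Bool) (I : Finset (Fin κ)) (hI : I.card ≤ L)
    (hg : ∀ x y : Fin κ → Bool, (∀ i ∈ I, x i = y i) → g x = g y) :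
    ∃ q : (Fin N → Bool) → Circuit (κ + κ),
      (∃ ℓ ≤ (decryptSize κ N L + 1) * (κ + κ + decryptSize κ N L + 5),
        BitLocal (fun y => (q y).enc) ℓ) ∧
      ∀ y, (q y).depth ≤ 4 ∧ (q y).size ≤ decryptSize κ N L ∧
        ∀ id key : Fin κ → Bool, (q y).eval (Fin.append id key) = true ↔
          ∃ i, id = idx i ∧ (y i ^^ g key) = true := by
  classical
  set s := decryptSize κ N L with hs
  let D := DepthFn (Fin N) (κ + κ)
  let lit : Fin (κ + κ) → D := fun i => (fun _ x => x i, 0)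
  let nlit : Fin (κ + κ) → D := fun i => (fun _ x => !x i, 1)
  let cst : Fin N → D := fun i => (fun y _ => y i, 1)
  let ncst : Fin N → D := fun i => (fun y _ => !y i, 2)
  let sel : Fin (κ + κ) → Bool → D := fun i b => if b then lit i else nlit i
  let csel : Fin N → Bool → D := fun i b => if b then ncst i else cst i
  -- A term fixes a user and the values of the key on `I`. Then `g` is known, and the unmasked bit
  -- is a hard-wired literal, negated if `g` is true. Literals have depth at most 2, so conjunctions
  -- have depth 3 and their disjunction depth 4.
  let terms : Fin N × Finset (Fin κ) → List D := fun p =>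
    (List.ofFn fun t => sel (Fin.castAdd κ t) (idx p.1 t)) ++
      (I.toList.map fun t => sel (Fin.natAdd κ t) (decide (t ∈ p.2))) ++
      [csel p.1 (g fun t => decide (t ∈ p.2))]
  let conj : Fin N × Finset (Fin κ) → D := fun p =>
    (fun y x => ((terms p).map Prod.fst).all fun f => f y x, 2 + 1)
  let P : Finset (Fin N × Finset (Fin κ)) := Finset.univ ×ˢ I.powerset
  have hP : P.card ≤ N * 2 ^ L := by
    rw [Finset.card_product, Finset.card_powerset, Finset.card_univ, Fintype.card_fin]
    exact Nat.mul_le_mul_left _ (Nat.pow_le_pow_right (by norm_num) hI)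
  have c0 : FamilyComputed (Set.range lit) 0 := familyComputed_inputs
  have c1 := c0.union Finset.univ nlit (t := 2) fun i _ =>
    familyCost_not (F := Set.range lit) (h := 0) ⟨i, rfl⟩
  have c2 := c1.union Finset.univ cst (t := 1) fun i _ => familyCost_hardwired i
  have c3 := c2.union Finset.univ ncst (t := 2) fun i _ =>
    familyCost_not (h := 1) (Or.inr ⟨i, by simp, rfl⟩)
  set F₃ := Set.range lit ∪ nlit '' (Finset.univ : Finset (Fin (κ + κ))) ∪
    cst '' (Finset.univ : Finset (Fin N)) ∪ ncst '' (Finset.univ : Finset (Fin N)) with hF₃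
  have hsel : ∀ i b, sel i b ∈ F₃ ∧ (sel i b).2 ≤ 2 := by
    intro i b
    cases b
    · exact ⟨Or.inl (Or.inl (Or.inr ⟨i, by simp, rfl⟩)), by simp [sel, nlit]⟩
    · exact ⟨Or.inl (Or.inl (Or.inl ⟨i, rfl⟩)), by simp [sel, lit]⟩
  have hcsel : ∀ i b, csel i b ∈ F₃ ∧ (csel i b).2 ≤ 2 := by
    intro i b
    cases b
    · exact ⟨Or.inl (Or.inr ⟨i, by simp, rfl⟩), by simp [csel, cst]⟩
    · exact ⟨Or.inr ⟨i, by simp, rfl⟩, by simp [csel, ncst]⟩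
  have hterms : ∀ p, ∀ f ∈ terms p, f ∈ F₃ ∧ f.2 ≤ 2 := by
    intro p f hf
    simp only [terms, List.mem_append, List.mem_ofFn, List.mem_map, List.mem_singleton] at hf
    rcases hf with (⟨t, rfl⟩ | ⟨t, _, rfl⟩) | rfl
    · exact hsel _ _
    · exact hsel _ _
    · exact hcsel _ _
  have c4 := c3.union P conj (t := κ + L + 2) fun p _ => by
    have h := familyCost_all (F := F₃) (h := 2) ((terms p).map Prod.fst) (by
      intro f hf
      obtain ⟨f', hf', rfl⟩ := List.mem_map.1 hf
      exact ⟨f'.2, (hterms p f' hf').2, (hterms p f' hf').1⟩)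
    intro F' z hF' hz
    obtain ⟨m, ℓ, c, h1, h2, h3, h4, h5⟩ := h F' z hF' hz
    have hlen : 1 + ((terms p).map Prod.fst).length ≤ κ + L + 2 := by
      simp [terms]; omega
    refine ⟨m, ℓ, c, by omega, h2.trans ?_, fun y => (h3 y).trans (by omega), h4, h5⟩
    gcongr
  have c5 := familyCost_any (F := F₃ ∪ conj '' P) (h := 3) ((P.toList.map conj).map Prod.fst) (by
      intro f hf
      simp only [List.map_map, List.mem_map, Finset.mem_toList] at hf
      obtain ⟨p, hp, rfl⟩ := hf
      exact ⟨3, le_rfl, Or.inr ⟨p, hp, rfl⟩⟩) _ _ subset_rfl c4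
  obtain ⟨m, ℓ, c, h1, h2, h3, h4, h5⟩ := c5.mono (Set.singleton_subset_iff.2
    (Set.mem_insert _ _))
  have hle : 0 + (Finset.univ : Finset (Fin (κ + κ))).card * 2 +
      (Finset.univ : Finset (Fin N)).card * 1 + (Finset.univ : Finset (Fin N)).card * 2 +
      P.card * (κ + L + 2) + (1 + ((P.toList.map conj).map Prod.fst).length) ≤ s := by
    simp only [Finset.card_univ, Fintype.card_fin, List.length_map, Finset.length_toList]
    have := Nat.mul_le_mul_right (κ + L + 2) hP
    rw [hs, decryptSize]
    omega
  have hfam : FamilyComputed (F := {((fun y x => ((P.toList.map conj).map Prod.fst).any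
      fun f => f y x, 3 + 1) : D)}) s := by
    refine ⟨m, ℓ, c, h1.trans hle, h2.trans ?_, fun y => (h3 y).trans hle, h4, h5⟩
    gcongr
  obtain ⟨q, hq, hq'⟩ := hfam.exists_circuits
  refine ⟨q, hq, fun y => ⟨(hq' y).1, (hq' y).2.1, fun id key => ?_⟩⟩
  rw [(hq' y).2.2]
  have hselv : ∀ i b x, (sel i b).1 y x = true ↔ x i = b := by
    intro i b x; cases b <;> simp [sel, lit, nlit]
  have hcselv : ∀ i b x, (csel i b).1 y x = (y i ^^ b) := by
    intro i b x; cases b <;> simp [csel, cst, ncst]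
  have hconj : ∀ p, (conj p).1 y (Fin.append id key) = true ↔
      (∀ t, id t = idx p.1 t) ∧ (∀ t ∈ I, key t = decide (t ∈ p.2)) ∧
        (y p.1 ^^ g fun t => decide (t ∈ p.2)) = true := by
    intro p
    simp only [conj, terms, List.map_append, List.all_append, List.map_cons, List.map_nil,
      List.all_cons, List.all_nil, Bool.and_true, Bool.and_eq_true, hcselv, and_assoc]
    refine and_congr ?_ (and_congr ?_ Iff.rfl)
    · simp [List.all_eq_true, hselv]
    · simp [List.all_eq_true, hselv, -Fin.natAdd_eq_addNat]
  simp only [List.map_map, List.any_map, List.any_eq_true, Finset.mem_toList, Function.comp_apply]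
  constructor
  · rintro ⟨p, hp, h⟩
    obtain ⟨e1, e2, e3⟩ := (hconj p).1 h
    refine ⟨p.1, funext e1, ?_⟩
    rwa [hg key (fun t => decide (t ∈ p.2)) e2]
  · rintro ⟨i, e1, e2⟩
    refine ⟨(i, I.filter fun t => key t = true), by simp [P], (hconj _).2
      ⟨fun t => congrFun e1 t, fun t ht => by simp [ht], ?_⟩⟩
    rwa [← hg key _ fun t ht => by simp [ht]]

/-! ### A fingerprinting code -/

section Code

variable {N k : ℕ}

/-- The probability of a column of the code: its weight is uniform in `{0, …, N}`, and it is uniform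
given its weight. -/
noncomputable def colProb (x : Finset (Fin N)) : ℝ := 1 / ((N + 1) * N.choose x.card)

/-- The score of a user for a column that is answered with `1`. -/
noncomputable def score (i : Fin N) (x : Finset (Fin N)) : ℝ :=
  if i ∈ x then (N + 1) / x.card else -((N + 1) / (N - x.card))

/-- The probability of a code with independent columns. -/
noncomputable def codeProb (X : Fin k → Finset (Fin N)) : ℝ := ∏ j, colProb (X j)

lemma colProb_nonneg (x : Finset (Fin N)) : 0 ≤ colProb x := by unfold colProb; positivity

lemma codeProb_nonneg (X : Fin k → Finset (Fin N)) : 0 ≤ codeProb X :=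
  Finset.prod_nonneg fun _ _ => colProb_nonneg _

lemma card_le_users (x : Finset (Fin N)) : x.card ≤ N := by simpa using x.card_le_univ

lemma sum_colProb_mul (f : ℕ → ℝ) :
    ∑ x : Finset (Fin N), colProb x * f x.card =
      (∑ w ∈ Finset.range (N + 1), f w) / (N + 1) := by
  have h := Finset.sum_powerset_apply_card (x := (Finset.univ : Finset (Fin N)))
    (fun w => 1 / (((N : ℝ) + 1) * N.choose w) * f w)
  rw [Finset.powerset_univ, Finset.card_univ, Fintype.card_fin] at h
  unfold colProb
  rw [h, Finset.sum_div]
  refine Finset.sum_congr rfl fun w hw => ?_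
  have hpos : (0 : ℝ) < N.choose w := by
    exact_mod_cast Nat.choose_pos (Nat.lt_succ_iff.1 (Finset.mem_range.1 hw))
  rw [nsmul_eq_mul]
  field_simp

lemma sum_colProb : ∑ x : Finset (Fin N), colProb x = 1 := by
  have h := sum_colProb_mul (N := N) fun _ => 1
  simp only [mul_one, Finset.sum_const, Finset.card_range, nsmul_eq_mul] at h
  rw [h]
  push_cast
  field_simp

lemma sum_prod_columns (f : Finset (Fin N) → ℝ) :
    ∑ X : Fin k → Finset (Fin N), ∏ j, f (X j) = (∑ x, f x) ^ k := by
  have := Finset.prod_univ_sum (fun _ : Fin k => (Finset.univ : Finset (Finset (Fin N))))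
    fun _ x => f x
  rw [Fintype.piFinset_univ] at this
  rw [← this]
  simp

lemma sum_codeProb : ∑ X : Fin k → Finset (Fin N), codeProb X = 1 := by
  unfold codeProb
  rw [sum_prod_columns, sum_colProb, one_pow]

/-- The products are left uncancelled: in an empty or full column one divisor is zero and its
product vanishes, which is the imbalance exploited in full columns. -/
lemma sum_score (x : Finset (Fin N)) : ∑ i, score i x =
    x.card * ((N + 1) / x.card) - (N - x.card) * ((N + 1) / (N - x.card)) := by
  have h : (xᶜ.card : ℝ) = N - x.card := by
    rw [Finset.card_compl, Fintype.card_fin, Nat.cast_sub (card_le_users x)]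
  unfold score
  rw [Finset.sum_ite]
  simp only [Finset.sum_const, nsmul_eq_mul, Finset.filter_mem_eq_inter, Finset.univ_inter]
  have h2 : Finset.univ.filter (fun i => i ∉ x) = xᶜ := by ext; simp
  rw [h2, h]
  ring

lemma sum_score_of_mixed {x : Finset (Fin N)} (h0 : x ≠ ∅) (h1 : x ≠ Finset.univ) :
    ∑ i, score i x = 0 := by
  have e0 : (x.card : ℝ) ≠ 0 := by simpa using h0
  have e1 : (N : ℝ) - x.card ≠ 0 := by
    intro h
    have : x.card = N := by exact_mod_cast (sub_eq_zero.1 h).symm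
    exact h1 (Finset.card_eq_iff_eq_univ x |>.1 (by rw [this, Fintype.card_fin]))
  rw [sum_score, mul_div_cancel₀ _ e0, mul_div_cancel₀ _ e1, sub_self]

lemma sum_score_univ (hN : 0 < N) : ∑ i, score i (Finset.univ : Finset (Fin N)) = N + 1 := by
  have : (N : ℝ) ≠ 0 := by positivity
  rw [sum_score]
  simp [mul_div_cancel₀ _ this]

lemma abs_score_le (i : Fin N) (x : Finset (Fin N)) : |score i x| ≤ N + 1 := by
  unfold score
  have hN : (0 : ℝ) ≤ N + 1 := by positivity
  split_ifs with h
  · have hx : 1 ≤ (x.card : ℝ) := by exact_mod_cast Finset.card_pos.2 ⟨i, h⟩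
    rw [abs_of_nonneg (by positivity)]
    exact div_le_self hN hx
  · have hx : 1 ≤ (N : ℝ) - x.card := by
      have : x.card + 1 ≤ N := by
        rw [← Finset.card_insert_of_notMem h]
        exact card_le_users _
      have : (x.card : ℝ) + 1 ≤ N := by exact_mod_cast this
      linarith
    rw [abs_neg, abs_of_nonneg (div_nonneg hN (by linarith))]
    exact div_le_self hN hx

/-- The bit of user `i` in a column is flipped if `b` is true. -/
def flipUser (i : Fin N) (b : Bool) (x : Finset (Fin N)) : Finset (Fin N) :=
  if b then (if i ∈ x then x.erase i else insert i x) else x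

lemma flipUser_flipUser (i : Fin N) (b : Bool) (x : Finset (Fin N)) :
    flipUser i b (flipUser i b x) = x := by
  unfold flipUser
  cases b
  · simp
  · by_cases h : i ∈ x <;> simp [h]

lemma mem_flipUser_of_ne {i i' : Fin N} (h : i' ≠ i) (b : Bool) (x : Finset (Fin N)) :
    i' ∈ flipUser i b x ↔ i' ∈ x := by
  unfold flipUser
  split_ifs <;> simp [h]

/-- With w the cardinality of `x`, this is the identity C(N, w+1)(w+1) = C(N, w)(N-w). -/
lemma mean_score_insert {i : Fin N} {x : Finset (Fin N)} (h : i ∉ x) :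
    colProb (insert i x) * score i (insert i x) + colProb x * score i x = 0 := by
  have hlt : x.card < N := by
    have := card_le_users (insert i x)
    rw [Finset.card_insert_of_notMem h] at this
    omega
  have e : ((N.choose (x.card + 1) : ℕ) : ℝ) * (x.card + 1) = N.choose x.card * (N - x.card) := by
    have := Nat.choose_succ_right_eq N x.card
    rw [← Nat.cast_sub hlt.le]
    exact_mod_cast this
  have h1 : (0 : ℝ) < N.choose (x.card + 1) := by exact_mod_cast Nat.choose_pos hlt
  have h2 : (0 : ℝ) < N.choose x.card := by exact_mod_cast Nat.choose_pos hlt.le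
  have h3 : (0 : ℝ) < N - x.card := by
    have : (x.card : ℝ) < N := by exact_mod_cast hlt
    linarith
  unfold colProb score
  rw [if_pos (Finset.mem_insert_self i x), if_neg h, Finset.card_insert_of_notMem h]
  push_cast
  rw [mul_neg, add_neg_eq_zero, div_mul_div_comm, div_mul_div_comm, mul_assoc, mul_assoc, e]

/-- Given the bits of all other users, the score of user `i` is a fair game; an answer that ignores
the bit of `i` cannot bias it. -/
lemma mean_score (i : Fin N) (x : Finset (Fin N)) :
    ∑ b, colProb (flipUser i b x) * score i (flipUser i b x) = 0 := by
  rw [Fintype.sum_bool]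
  unfold flipUser
  by_cases h : i ∈ x
  · have := mean_score_insert (Finset.notMem_erase i x)
    rw [Finset.insert_erase h] at this
    simp only [h, if_true, Bool.false_eq_true, if_false]
    linarith
  · simp only [h, if_true, if_false, Bool.false_eq_true]
    exact mean_score_insert h

lemma sum_sq_score (x : Finset (Fin N)) : ∑ i, score i x ^ 2 =
    (N + 1) ^ 2 * ((x.card : ℝ)⁻¹ + ((N : ℝ) - x.card)⁻¹) := by
  have h : (xᶜ.card : ℝ) = N - x.card := by
    rw [Finset.card_compl, Fintype.card_fin, Nat.cast_sub (card_le_users x)]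
  have h2 : Finset.univ.filter (fun i => i ∉ x) = xᶜ := by ext; simp
  have key : ∀ a : ℝ, a * ((N + 1) / a) ^ 2 = (N + 1) ^ 2 * a⁻¹ := by
    intro a
    rcases eq_or_ne a 0 with rfl | ha
    · simp
    · field_simp
  unfold score
  simp only [ite_pow, neg_sq]
  rw [Finset.sum_ite]
  simp only [Finset.sum_const, nsmul_eq_mul, Finset.filter_mem_eq_inter, Finset.univ_inter]
  rw [h2, h, key, key]
  ring

/-- Exchanging two users preserves the distribution of a column. -/
lemma variance_score_eq (i i' : Fin N) :
    ∑ x, colProb x * score i x ^ 2 = ∑ x, colProb x * score i' x ^ 2 := by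
  refine Fintype.sum_equiv (Equiv.swap i i').finsetCongr _ _ fun x => ?_
  have h : i' ∈ x.map (Equiv.swap i i').toEmbedding ↔ i ∈ x := by
    rw [Finset.mem_map_equiv]
    simp
  simp only [Equiv.finsetCongr_apply, colProb, score, Finset.card_map, h]

/-- A bound on the second moment of the scores. -/
noncomputable def scoreVar (N : ℕ) : ℝ := 4 * (1 + Real.log N)

/-- By symmetry it suffices to sum over all users. The weight being uniform, the total is 2(N+1)H
with H the N-th harmonic number, and N+1 ≤ 2N. -/
lemma variance_score_le (i : Fin N) : ∑ x, colProb x * score i x ^ 2 ≤ scoreVar N := by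
  have hN : 0 < N := i.pos
  have hN' : (0 : ℝ) < N := by exact_mod_cast hN
  have h1 : (N : ℝ) * ∑ x, colProb x * score i x ^ 2 =
      ∑ x : Finset (Fin N), colProb x *
        ((N + 1) ^ 2 * ((x.card : ℝ)⁻¹ + ((N : ℝ) - x.card)⁻¹)) := by
    calc (N : ℝ) * ∑ x, colProb x * score i x ^ 2
        = ∑ i' : Fin N, ∑ x, colProb x * score i' x ^ 2 := by
          rw [Finset.sum_congr rfl fun i' _ => variance_score_eq i' i]
          simp
      _ = _ := by
          rw [Finset.sum_comm]
          refine Finset.sum_congr rfl fun x _ => ?_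
          rw [← Finset.mul_sum, sum_sq_score]
  have hharm : ∑ w ∈ Finset.range (N + 1), (w : ℝ)⁻¹ ≤ 1 + Real.log N := by
    have := harmonic_le_one_add_log N
    rw [harmonic] at this
    push_cast at this
    rw [Finset.sum_range_succ']
    simpa using this
  have h2 : ∑ w ∈ Finset.range (N + 1), ((N : ℝ) - w)⁻¹ =
      ∑ w ∈ Finset.range (N + 1), (w : ℝ)⁻¹ := by
    rw [← Finset.sum_range_reflect]
    refine Finset.sum_congr rfl fun w hw => ?_
    have hw' : w ≤ N := Nat.lt_succ_iff.1 (Finset.mem_range.1 hw)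
    rw [show N + 1 - 1 - w = N - w by omega, Nat.cast_sub hw']
    congr 1
    ring
  rw [sum_colProb_mul fun w => ((N : ℝ) + 1) ^ 2 * ((w : ℝ)⁻¹ + ((N : ℝ) - w)⁻¹),
    ← Finset.mul_sum, Finset.sum_add_distrib, h2] at h1
  set H := ∑ w ∈ Finset.range (N + 1), (w : ℝ)⁻¹
  have h3 : (N : ℝ) * ∑ x, colProb x * score i x ^ 2 = (N + 1) * (H + H) := by
    rw [h1]; field_simp
  have hH : 0 ≤ H := Finset.sum_nonneg fun _ _ => by positivity
  have h4 : (1 : ℝ) ≤ N := by exact_mod_cast hN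
  have h5 : (N : ℝ) * ∑ x, colProb x * score i x ^ 2 ≤ N * scoreVar N := by
    rw [h3, scoreVar]
    nlinarith
  exact le_of_mul_le_mul_left h5 hN'

/-- Users whose bits are hidden are not accused: if the answers do not depend on the bits of user
`i`, then the score of `i` is large only with small probability. -/
theorem soundness (i : Fin N) (b : (Fin k → Finset (Fin N)) → Fin k → Bool)
    (hb : ∀ X (t : Fin k → Bool), b (fun j => flipUser i (t j) (X j)) = b X) {l : ℝ} (hl : 0 < l)
    (hlN : l * (N + 1) ≤ 1) (Z : ℝ) :
    ∑ X : Fin k → Finset (Fin N), (codeProb X *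
      if Z ≤ ∑ j, (if b X j = true then score i (X j) else 0) then 1 else 0) ≤
        Real.exp (-(l * Z) + k * (l ^ 2 * scoreVar N)) := by
  -- Exponential moments: `e` is the tilted column weight, and `v` comes from exp t ≤ 1 + t + t² for
  -- |t| ≤ 1, the linear term being removed by `mean_score`. The condition `hlN` keeps the exponent
  -- in this range.
  set e : Bool → Finset (Fin N) → ℝ := fun c x =>
    colProb x * Real.exp (l * if c = true then score i x else 0) with he
  set v : Finset (Fin N) → ℝ := fun x => colProb x * (1 + l ^ 2 * score i x ^ 2) with hv
  have hcol : ∀ c x, ∑ t, e c (flipUser i t x) ≤ ∑ t, v (flipUser i t x) := by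
    intro c x
    have hpt : ∀ y, e c y ≤ v y + (if c = true then l else 0) * (colProb y * score i y) := by
      intro y
      have hμ := colProb_nonneg y
      cases c
      · simp only [he, hv, Bool.false_eq_true, if_false, mul_zero, Real.exp_zero, mul_one, zero_mul,
          add_zero]
        have : 0 ≤ l ^ 2 * score i y ^ 2 := by positivity
        nlinarith
      · have h1 : |l * score i y| ≤ 1 := by
          rw [abs_mul, abs_of_pos hl]
          exact (mul_le_mul_of_nonneg_left (abs_score_le i y) hl.le).trans hlN
        have h2 := (abs_le.1 (Real.abs_exp_sub_one_sub_id_le h1)).2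
        simp only [he, hv, if_true]
        have h3 : Real.exp (l * score i y) ≤ 1 + l ^ 2 * score i y ^ 2 + l * score i y := by
          nlinarith
        nlinarith [mul_le_mul_of_nonneg_left h3 hμ]
    refine (Finset.sum_le_sum fun t _ => hpt _).trans ?_
    rw [Finset.sum_add_distrib, ← Finset.mul_sum, mean_score, mul_zero, add_zero]
  -- Every pattern of flips of the bits of `i` permutes the codes, so averaging over patterns
  -- changes no sum over codes. Along the flips the answers stay fixed, and the average factors over
  -- the columns.
  have hflip : ∀ F : (Fin k → Finset (Fin N)) → ℝ,
      ∑ t : Fin k → Bool, ∑ X : Fin k → Finset (Fin N), F (fun j => flipUser i (t j) (X j)) = 2 ^ k * ∑ X, F X := by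
    intro F
    have h1 : ∀ t : Fin k → Bool,
        ∑ X : Fin k → Finset (Fin N), F (fun j => flipUser i (t j) (X j)) = ∑ X, F X := by
      intro t
      let φ : (Fin k → Finset (Fin N)) ≃ (Fin k → Finset (Fin N)) :=
        ⟨fun X j => flipUser i (t j) (X j), fun X j => flipUser i (t j) (X j),
          fun X => funext fun j => flipUser_flipUser _ _ _,
          fun X => funext fun j => flipUser_flipUser _ _ _⟩
      exact Equiv.sum_comp φ F
    rw [Finset.sum_congr rfl fun t _ => h1 t]
    simp
  have hprod : ∀ (f : Fin k → Finset (Fin N) → ℝ) (X : Fin k → Finset (Fin N)),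
      ∑ t : Fin k → Bool, ∏ j, f j (flipUser i (t j) (X j)) =
        ∏ j, ∑ c, f j (flipUser i c (X j)) := by
    intro f X
    have := Finset.prod_univ_sum (fun _ : Fin k => (Finset.univ : Finset Bool))
      fun j c => f j (flipUser i c (X j))
    rw [Fintype.piFinset_univ] at this
    exact this.symm
  have hmain : ∑ X : Fin k → Finset (Fin N), ∏ j, e (b X j) (X j) ≤ (∑ x, v x) ^ k := by
    have h2 : (2 : ℝ) ^ k * ∑ X : Fin k → Finset (Fin N), ∏ j, e (b X j) (X j) ≤
        2 ^ k * ∑ X : Fin k → Finset (Fin N), ∏ j, v (X j) := by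
      rw [← hflip fun X => ∏ j, e (b X j) (X j), ← hflip fun X => ∏ j, v (X j), Finset.sum_comm,
        Finset.sum_comm (γ := Fin k → Bool)]
      refine Finset.sum_le_sum fun X _ => ?_
      simp only [hb]
      rw [hprod fun j => e (b X j), hprod fun _ => v]
      refine Finset.prod_le_prod (fun j _ => Finset.sum_nonneg fun c _ => ?_) fun j _ => hcol _ _
      exact mul_nonneg (colProb_nonneg _) (Real.exp_pos _).le
    rw [← sum_prod_columns]
    exact le_of_mul_le_mul_left h2 (by positivity)
  have hvsum : ∑ x, v x ≤ Real.exp (l ^ 2 * scoreVar N) := by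
    have h3 : ∑ x, v x = 1 + l ^ 2 * ∑ x, colProb x * score i x ^ 2 := by
      rw [← sum_colProb (N := N), Finset.mul_sum, ← Finset.sum_add_distrib]
      refine Finset.sum_congr rfl fun x _ => ?_
      simp only [hv]; ring
    rw [h3]
    have h4 := Real.add_one_le_exp (l ^ 2 * scoreVar N)
    have h5 := mul_le_mul_of_nonneg_left (variance_score_le i) (sq_nonneg l)
    linarith
  have hv0 : 0 ≤ ∑ x, v x := Finset.sum_nonneg fun x _ =>
    mul_nonneg (colProb_nonneg x) (by positivity)
  calc _ ≤ ∑ X : Fin k → Finset (Fin N), Real.exp (-(l * Z)) * ∏ j, e (b X j) (X j) := by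
        refine Finset.sum_le_sum fun X _ => ?_
        have h6 : ∏ j, e (b X j) (X j) = codeProb X *
            Real.exp (l * ∑ j, if b X j = true then score i (X j) else 0) := by
          simp only [he, Finset.prod_mul_distrib, ← Real.exp_sum, ← Finset.mul_sum]
          rfl
        rw [h6, mul_left_comm, ← Real.exp_add]
        refine mul_le_mul_of_nonneg_left ?_ (codeProb_nonneg X)
        split_ifs with h
        · refine Real.one_le_exp ?_
          nlinarith [mul_le_mul_of_nonneg_left h hl.le]
        · exact (Real.exp_pos _).le
    _ ≤ Real.exp (-(l * Z)) * Real.exp (l ^ 2 * scoreVar N) ^ k := by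
        rw [← Finset.mul_sum]
        refine mul_le_mul_of_nonneg_left (hmain.trans ?_) (Real.exp_pos _).le
        exact pow_le_pow_left₀ hv0 hvsum k
    _ = _ := by rw [← Real.exp_nat_mul, ← Real.exp_add]

/-- The number of columns in which all users have the bit `1`. -/
def fullColumns (X : Fin k → Finset (Fin N)) : ℕ :=
  (Finset.univ.filter fun j => X j = Finset.univ).card

/-- Few columns are full only with small probability. -/
lemma fullColumns_tail (m : ℕ) :
    ∑ X : Fin k → Finset (Fin N), (codeProb X * if fullColumns X < m then 1 else 0) ≤
      2 ^ m * Real.exp (-(k / (2 * (N + 1)))) := by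
  -- The lower tail is at most 2^m times the mean of 2^(-number of full columns); a column is full
  -- with probability 1/(N+1).
  set u : Finset (Fin N) → ℝ := fun x =>
    colProb x * if x = Finset.univ then 1 / 2 else 1 with hu
  have hsum : ∑ x, u x = 1 - 1 / (2 * (N + 1)) := by
    have h1 : ∀ x : Finset (Fin N), u x = colProb x - if x = Finset.univ then
        colProb (Finset.univ : Finset (Fin N)) / 2 else 0 := by
      intro x
      simp only [hu]
      split_ifs with h
      · rw [h]; ring
      · ring
    rw [Finset.sum_congr rfl fun x _ => h1 x, Finset.sum_sub_distrib, sum_colProb,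
      Finset.sum_ite_eq' Finset.univ Finset.univ]
    simp [colProb]
    ring
  have h0 : 0 ≤ ∑ x, u x := Finset.sum_nonneg fun x _ => by
    simp only [hu]
    have := colProb_nonneg x
    split_ifs <;> linarith
  have hle : ∑ x, u x ≤ Real.exp (-(1 / (2 * (N + 1)))) := by
    rw [hsum]
    linarith [Real.add_one_le_exp (-(1 / (2 * ((N : ℝ) + 1))))]
  calc _ ≤ ∑ X : Fin k → Finset (Fin N), 2 ^ m * ∏ j, u (X j) := by
        refine Finset.sum_le_sum fun X _ => ?_
        have h2 : ∏ j, u (X j) = codeProb X * (1 / 2) ^ fullColumns X := by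
          simp only [hu, Finset.prod_mul_distrib, Finset.prod_ite, Finset.prod_const, one_pow,
            mul_one]
          rfl
        rw [h2, mul_left_comm]
        refine mul_le_mul_of_nonneg_left ?_ (codeProb_nonneg X)
        split_ifs with h
        · rw [one_div, inv_pow, ← div_eq_mul_inv, one_le_div (by positivity)]
          exact pow_le_pow_right₀ (by norm_num) h.le
        · positivity
    _ ≤ 2 ^ m * Real.exp (-(1 / (2 * (N + 1)))) ^ k := by
        rw [← Finset.mul_sum, sum_prod_columns]
        exact mul_le_mul_of_nonneg_left (pow_le_pow_left₀ h0 hle k) (by positivity)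
    _ = _ := by
        rw [← Real.exp_nat_mul]
        congr 2
        ring

/-- If the answers are consistent with the code, then some user has a large score. -/
lemma exists_large_score (hN : 0 < N) {m : ℕ} (X : Fin k → Finset (Fin N)) (b : Fin k → Bool)
    (h0 : ∀ j, X j = ∅ → b j = false) (h1 : ∀ j, X j = Finset.univ → b j = true)
    (hm : m ≤ fullColumns X) : ∃ i, (m : ℝ) ≤ ∑ j, if b j = true then score i (X j) else 0 := by
  by_contra! hcon
  have hN' : (0 : ℝ) < N := by exact_mod_cast hN
  -- Summed over the users, mixed columns cancel, empty columns are not selected, and each full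
  -- column gives N+1.
  have h2 : ∑ i : Fin N, ∑ j, (if b j = true then score i (X j) else 0) =
      (N + 1) * fullColumns X := by
    rw [Finset.sum_comm]
    have h3 : ∀ j, ∑ i, (if b j = true then score i (X j) else 0) =
        if X j = Finset.univ then (N : ℝ) + 1 else 0 := by
      intro j
      by_cases hu : X j = Finset.univ
      · simp only [h1 j hu, hu, if_true]
        exact sum_score_univ hN
      · rw [if_neg hu]
        by_cases he : X j = ∅
        · simp [h0 j he]
        · cases b j
          · simp
          · simpa using sum_score_of_mixed he hu
    rw [Finset.sum_congr rfl fun j _ => h3 j, Finset.sum_ite]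
    simp [fullColumns]
    ring
  have h4 : ∑ i : Fin N, ∑ j, (if b j = true then score i (X j) else 0) <
      ∑ _i : Fin N, (m : ℝ) :=
    Finset.sum_lt_sum_of_nonempty ⟨⟨0, hN⟩, Finset.mem_univ _⟩ fun i _ => hcon i
  rw [h2, Finset.sum_const, Finset.card_univ, Fintype.card_fin, nsmul_eq_mul] at h4
  have h5 : (m : ℝ) ≤ fullColumns X := by exact_mod_cast hm
  have h6 : (0 : ℝ) ≤ fullColumns X := by positivity
  nlinarith

-- Exchanging the fresh value with the old coordinate is an involution. This isolates the key of one
-- user as a uniform seed independent of the other keys.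
open scoped BigOperators in
lemma expect_update {K : Type*} [Fintype K] [Nonempty K] (i : Fin N) (f : (Fin N → K) → ℝ) :
    𝔼 sk, 𝔼 s, f (Function.update sk i s) = 𝔼 sk, f sk := by
  let φ : (Fin N → K) × K ≃ (Fin N → K) × K :=
    ⟨fun p => (Function.update p.1 i p.2, p.1 i), fun p => (Function.update p.1 i p.2, p.1 i),
      fun p => by simp, fun p => by simp⟩
  have h1 : ∑ p : (Fin N → K) × K, f (Function.update p.1 i p.2) =
      ∑ p : (Fin N → K) × K, f p.1 :=
    Equiv.sum_comp φ fun p => f p.1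
  rw [Fintype.sum_prod_type, Fintype.sum_prod_type] at h1
  simp only [Fintype.expect_eq_sum_div_card]
  rw [← Finset.sum_div, h1]
  simp only [Finset.sum_const, Finset.card_univ, nsmul_eq_mul]
  rw [← Finset.mul_sum]
  have : (Fintype.card K : ℝ) ≠ 0 := by positivity
  field_simp

open scoped BigOperators in
/-- The probabilities `pFull` of accusing a user on the full database, `pDrop` on the database
without this user, and `pHide` when moreover the bits of this user are hidden. -/
theorem tracing_bound {K Y : Type*} [Fintype K] [Nonempty K] [Fintype Y] [Nonempty Y] {m : ℕ}
    (pFull pDrop : (Fin N → K) → (Fin k → Finset (Fin N)) → Fin N → ℝ)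
    (pHide : (Fin N → K) → (Fin k → Finset (Fin N)) → Fin N → Y → ℝ) {β E δ γ η : ℝ}
    (hβ : β ≤ 1) (hE : 0 ≤ E) (h0 : ∀ sk X i, 0 ≤ pFull sk X i)
    (hacc : ∀ sk X, m ≤ fullColumns X → 1 - β ≤ ∑ i, pFull sk X i)
    (hdp : ∀ sk X i, pFull sk X i ≤ E * pDrop sk X i + δ)
    (hprg : ∀ sk X i, 𝔼 s, pDrop (Function.update sk i s) X i ≤ 𝔼 y, pHide sk X i y + γ)
    (hsound : ∀ sk i y, ∑ X, codeProb X * pHide sk X i y ≤ η) :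
    (1 - β) * (1 - 2 ^ m * Real.exp (-(k / (2 * (N + 1))))) ≤ N * (E * (η + γ) + δ) := by
  have htail := fullColumns_tail (N := N) (k := k) m
  have hgood : ∑ X : Fin k → Finset (Fin N), (codeProb X * if m ≤ fullColumns X then 1 else 0) =
      1 - ∑ X : Fin k → Finset (Fin N), (codeProb X * if fullColumns X < m then 1 else 0) := by
    refine eq_sub_of_add_eq (Eq.trans ?_ (sum_codeProb (N := N) (k := k)))
    rw [← Finset.sum_add_distrib]
    refine Finset.sum_congr rfl fun X _ => ?_
    by_cases h : m ≤ fullColumns X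
    · simp [h, not_lt.2 h]
    · simp [h, not_le.1 h]
  have h1 : ∀ sk, (1 - β) * (1 - 2 ^ m * Real.exp (-(k / (2 * (N + 1))))) ≤
      ∑ X, codeProb X * ∑ i, pFull sk X i := by
    intro sk
    calc _ ≤ (1 - β) *
          ∑ X : Fin k → Finset (Fin N), (codeProb X * if m ≤ fullColumns X then 1 else 0) := by
          refine mul_le_mul_of_nonneg_left ?_ (by linarith)
          rw [hgood]; linarith
      _ ≤ _ := by
          rw [Finset.mul_sum]
          refine Finset.sum_le_sum fun X _ => ?_
          rw [mul_left_comm]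
          refine mul_le_mul_of_nonneg_left ?_ (codeProb_nonneg X)
          split_ifs with h
          · simpa using hacc sk X h
          · simpa using Finset.sum_nonneg fun i _ => h0 sk X i
  -- The generator is replaced for a fixed code and fixed keys of the others; soundness is then
  -- applied for a fixed string `y`, on average over the code.
  have h2 : ∀ i, 𝔼 sk, ∑ X, codeProb X * pDrop sk X i ≤ η + γ := by
    intro i
    rw [← expect_update i]
    refine Finset.expect_le Finset.univ_nonempty fun sk _ => ?_
    calc _ = ∑ X, codeProb X * 𝔼 s, pDrop (Function.update sk i s) X i := by
          rw [Finset.expect_sum_comm]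
          exact Finset.sum_congr rfl fun X _ => (Finset.mul_expect _ _ _).symm
      _ ≤ ∑ X, codeProb X * (𝔼 y, pHide sk X i y + γ) :=
          Finset.sum_le_sum fun X _ => mul_le_mul_of_nonneg_left (hprg sk X i) (codeProb_nonneg X)
      _ = 𝔼 y, ∑ X, codeProb X * pHide sk X i y + γ := by
          rw [Finset.expect_sum_comm]
          simp only [mul_add, Finset.sum_add_distrib, Finset.mul_expect]
          rw [← Finset.sum_mul, sum_codeProb, one_mul]
      _ ≤ η + γ := by
          have := Finset.expect_le (s := Finset.univ) Finset.univ_nonempty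
            (f := fun y => ∑ X, codeProb X * pHide sk X i y) fun y _ => hsound sk i y
          linarith
  calc _ ≤ 𝔼 sk, ∑ X, codeProb X * ∑ i, pFull sk X i :=
        Finset.le_expect Finset.univ_nonempty fun sk _ => h1 sk
    _ ≤ 𝔼 sk, ∑ i, (E * ∑ X, codeProb X * pDrop sk X i + δ) := by
        refine Finset.expect_le_expect fun sk _ => ?_
        simp only [Finset.mul_sum (s := Finset.univ) (f := fun i => pFull sk _ i)]
        rw [Finset.sum_comm]
        refine Finset.sum_le_sum fun i _ => ?_
        calc _ ≤ ∑ X, codeProb X * (E * pDrop sk X i + δ) :=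
              Finset.sum_le_sum fun X _ =>
                mul_le_mul_of_nonneg_left (hdp sk X i) (codeProb_nonneg X)
          _ = _ := by
              simp only [mul_add, Finset.sum_add_distrib]
              rw [← Finset.sum_mul, sum_codeProb, one_mul, Finset.mul_sum]
              simp only [mul_left_comm]
    _ = ∑ i, (E * 𝔼 sk, ∑ X, codeProb X * pDrop sk X i + δ) := by
        rw [Finset.expect_sum_comm]
        refine Finset.sum_congr rfl fun i _ => ?_
        rw [Finset.expect_add_distrib, Finset.mul_expect, Finset.expect_const Finset.univ_nonempty]
    _ ≤ ∑ _i : Fin N, (E * (η + γ) + δ) := Finset.sum_le_sum fun i _ => by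
        have := mul_le_mul_of_nonneg_left (h2 i) hE
        linarith
    _ = _ := by
        simp only [Finset.sum_const, Finset.card_univ, Fintype.card_fin, nsmul_eq_mul]

end Code

/-! ### Probabilities as expectations -/

section Prob

open scoped BigOperators Classical

lemma prob_eq_expect {α : Type} [Fintype α] (p : α → Prop) :
    prob p = 𝔼 a, if p a then (1 : ℝ) else 0 := by
  rw [prob, Fintype.expect_eq_sum_div_card, Finset.sum_ite]
  simp

lemma prob_nonneg {α : Type} [Fintype α] (p : α → Prop) : 0 ≤ prob p := by
  unfold prob; positivity

lemma prob_mono {α : Type} [Fintype α] {p p' : α → Prop} (h : ∀ a, p a → p' a) :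
    prob p ≤ prob p' := by
  unfold prob
  refine div_le_div_of_nonneg_right ?_ (by positivity)
  exact_mod_cast Finset.card_le_card (Finset.monotone_filter_right _ fun a _ => h a)

lemma prob_le_one {α : Type} [Fintype α] (p : α → Prop) : prob p ≤ 1 := by
  unfold prob
  refine div_le_one_of_le₀ ?_ (by positivity)
  exact_mod_cast Finset.card_filter_le _ _

lemma prob_exists_le_sum {α : Type} [Fintype α] {N : ℕ} (p : Fin N → α → Prop) :
    prob (fun a => ∃ i, p i a) ≤ ∑ i, prob (p i) := by
  unfold prob
  rw [← Finset.sum_div]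
  gcongr
  have : (Finset.univ.filter fun a => ∃ i, p i a) ⊆
      Finset.univ.biUnion fun i => Finset.univ.filter (p i) := by
    intro a ha
    simpa using ha
  have h := (Finset.card_le_card this).trans Finset.card_biUnion_le
  rw [← Nat.cast_sum, Nat.cast_le]
  refine (le_of_eq ?_).trans (h.trans (le_of_eq ?_)) <;> congr!

/-- The type of the coins depends on the length of the input string. This length is common to all
ciphertexts, and the cast puts all runs on one space of coins. -/
lemma prob_comp_cast {a b : ℕ} (h : a = b) (p : (Fin a → Bool) → Prop) :
    prob p = prob fun r : Fin b → Bool => p (r ∘ Fin.cast h) := by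
  subst h
  rfl

lemma encBits_comp_cast {a b : ℕ} (h : a = b) (r : Fin b → Bool) :
    encBits (r ∘ Fin.cast h) = encBits r := by
  subst h
  rfl

end Prob

/-! ### The attack on a sanitizer -/

lemma BitLocal.of_eq {ι A : Type*} {g g' : (ι → Bool) → List A} {ℓ : ℕ} (h : BitLocal g ℓ)
    (hg : ∀ y, g' y = g y) : BitLocal g' ℓ := by
  have : g' = g := funext hg
  rwa [this]

lemma length_encBits {a : ℕ} (x : Fin a → Bool) : (encBits x).length = a := by
  simp [encBits]

section Attack

variable {n kf : ℕ → ℕ} {Q : (d : ℕ) → Set (Circuit d)} {d : ℕ}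

/-- The input of a sanitizer with queries that depend on hard-wired bits. -/
def hardwiredInput (q : Fin (kf (n d)) → (Fin (n d) → Bool) → Q d) (db : Database d (n d))
    (c : Fin (kf (n d)) → Fin (n d) → Bool) : SanInput n kf Q :=
  ⟨d, db, fun j => q j (c j)⟩

/-- The length of the encodings of such inputs, given the lengths of the queries. -/
def inputLength (n kf : ℕ → ℕ) (d : ℕ) (ℓ : Fin (kf (n d)) → ℕ) : ℕ :=
  (encNat d).length + (encNat (n d)).length + (encNat (kf (n d))).length + n d * d + ∑ j, ℓ j

lemma bitLocal_hardwiredInput {q : Fin (kf (n d)) → (Fin (n d) → Bool) → Q d}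
    {ℓ : Fin (kf (n d)) → ℕ} (hq : ∀ j, BitLocal (fun y => (q j y).1.enc) (ℓ j))
    (db : Database d (n d)) :
    BitLocal (fun c : Fin (kf (n d)) × Fin (n d) → Bool =>
      (hardwiredInput q db fun j i => c (j, i)).enc) (inputLength n kf d ℓ) := by
  have h1 := bitLocal_const (ι := Fin (kf (n d)) × Fin (n d))
    (encNat d ++ encNat (n d) ++ encNat (kf (n d)) ++ (List.ofFn db).flatMap encBits)
  have h2 : ∀ j, BitLocal (fun c : Fin (kf (n d)) × Fin (n d) → Bool =>
      (q j fun i => c (j, i)).1.enc) (ℓ j) := fun j =>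
    (hq j).comp (u := fun c i => c (j, i)) fun i =>
      ⟨{(j, i)}, by simp, fun y y' hy => hy (j, i) (by simp)⟩
  have h3 := h1.append (BitLocal.flatMap_ofFn h2)
  have h4 : ((List.ofFn db).flatMap encBits).length = n d * d := by
    have : (encBits : (Fin d → Bool) → List Γ') = fun x => encBits x := rfl
    rw [List.length_flatMap]
    simp [length_encBits, Function.comp_def, List.map_ofFn]
  have h5 : (encNat d ++ encNat (n d) ++ encNat (kf (n d)) ++
      (List.ofFn db).flatMap encBits).length + ∑ j, ℓ j = inputLength n kf d ℓ := by
    rw [List.length_append, List.length_append, List.length_append, h4, inputLength]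
  rw [h5] at h3
  refine h3.of_eq fun y => ?_
  simp only [hardwiredInput, SanInput.enc, List.append_assoc]
  congr 4
  rw [List.flatMap_def, List.map_ofFn]
  rfl

/-- The integer weights with which user `i` is accused. -/
noncomputable def accuseWeight {N k : ℕ} (i : Fin N) (X : Fin k → Finset (Fin N)) (j : Fin k) : ℤ :=
  ⌈32 * N * score i (X j)⌉

lemma abs_accuseWeight_le {N k : ℕ} (i : Fin N) (X : Fin k → Finset (Fin N)) (j : Fin k) :
    |accuseWeight i X j| ≤ ((32 * N * (N + 1) : ℕ) : ℤ) := by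
  have h := abs_le.1 (abs_score_le i (X j))
  have hN : (0 : ℝ) ≤ 32 * N := by positivity
  unfold accuseWeight
  refine abs_le.2 ⟨?_, ?_⟩
  · have : ((-((32 * N * (N + 1) : ℕ) : ℤ) : ℤ) : ℝ) ≤ 32 * N * score i (X j) := by
      push_cast
      nlinarith [mul_le_mul_of_nonneg_left h.1 hN]
    exact_mod_cast this.trans (Int.le_ceil _)
  · refine Int.ceil_le.2 ?_
    push_cast
    nlinarith [mul_le_mul_of_nonneg_left h.2 hN]

/-- The answers that accuse user `i`. -/
def accusing {N k : ℕ} (m : ℕ) (i : Fin N) (X : Fin k → Finset (Fin N)) : Set (Fin k → ℚ) :=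
  {v | ((32 * N * m : ℕ) : ℤ) ≤ ∑ j, if 1 / 2 < |v j| then accuseWeight i X j else 0}

/-- Weights are rounded up, so no user with a large score is missed. -/
lemma mem_accusing_of_score {N k m : ℕ} {i : Fin N} {X : Fin k → Finset (Fin N)} {v : Fin k → ℚ}
    (h : (m : ℝ) ≤ ∑ j, if decide (1 / 2 < |v j|) = true then score i (X j) else 0) :
    v ∈ accusing m i X := by
  have h1 : (32 * N : ℝ) * m ≤
      ∑ j, ((if 1 / 2 < |v j| then accuseWeight i X j else 0 : ℤ) : ℝ) := by
    refine (mul_le_mul_of_nonneg_left h (by positivity)).trans ?_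
    rw [Finset.mul_sum]
    refine Finset.sum_le_sum fun j _ => ?_
    simp only [decide_eq_true_eq]
    split_ifs
    · exact Int.le_ceil _
    · simp
  unfold accusing
  rw [Set.mem_ofPred_eq]
  have h2 : ((32 * N * m : ℕ) : ℝ) ≤
      ((∑ j, if 1 / 2 < |v j| then accuseWeight i X j else 0 : ℤ) : ℝ) := by
    push_cast at h1 ⊢
    exact h1
  exact_mod_cast h2

/-- Rounding adds at most 1 per column on the scale 32N, altogether k/(32N); for the parameters
chosen later this is half of the threshold. -/
lemma score_of_mem_accusing {N k m : ℕ} {i : Fin N} {X : Fin k → Finset (Fin N)} {v : Fin k → ℚ}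
    (h : v ∈ accusing m i X) :
    (m : ℝ) - k / (32 * N) ≤ ∑ j, if decide (1 / 2 < |v j|) = true then score i (X j) else 0 := by
  have hN : (0 : ℝ) < 32 * N := by
    have : (0 : ℝ) < N := by exact_mod_cast i.pos
    positivity
  have h1 : ((32 * N * m : ℕ) : ℝ) ≤
      ((∑ j, if 1 / 2 < |v j| then accuseWeight i X j else 0 : ℤ) : ℝ) := by
    exact_mod_cast h
  have h2 : ((∑ j, if 1 / 2 < |v j| then accuseWeight i X j else 0 : ℤ) : ℝ) ≤
      ∑ j, (32 * N * (if decide (1 / 2 < |v j|) = true then score i (X j) else 0) + 1) := by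
    push_cast
    refine Finset.sum_le_sum fun j _ => ?_
    simp only [decide_eq_true_eq]
    split_ifs
    · exact (Int.ceil_lt_add_one _).le
    · simp
  rw [Finset.sum_add_distrib, ← Finset.mul_sum] at h2
  simp only [Finset.sum_const, Finset.card_univ, Fintype.card_fin, nsmul_eq_mul, mul_one] at h2
  have h3 := h1.trans h2
  rw [Nat.cast_mul, Nat.cast_mul, Nat.cast_ofNat] at h3
  rw [sub_le_iff_le_add, ← mul_le_mul_iff_right₀ hN, mul_add, mul_div_cancel₀ _ hN.ne']
  exact h3

end Attack

/-! ### Keys, ciphertexts and the hybrid argument -/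

section AttackBound

open scoped BigOperators Classical

/-- The index of a row, in binary. -/
def rowIndex {N κ : ℕ} (i : Fin N) (t : Fin κ) : Bool := (i : ℕ).testBit t

lemma rowIndex_injective {N κ : ℕ} (h : N ≤ 2 ^ κ) :
    Function.Injective (rowIndex : Fin N → Fin κ → Bool) := by
  intro i i' hi
  refine Fin.ext (Nat.eq_of_testBit_eq fun t => ?_)
  by_cases ht : t < κ
  · exact congrFun hi ⟨t, ht⟩
  · have h2 : 2 ^ κ ≤ 2 ^ t := Nat.pow_le_pow_right (by norm_num) (not_lt.1 ht)
    rw [Nat.testBit_eq_false_of_lt (i.2.trans_le (h.trans h2)),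
      Nat.testBit_eq_false_of_lt (i'.2.trans_le (h.trans h2))]

/-- The database of the indices and keys of all users. -/
def keyDatabase {N κ : ℕ} (sk : Fin N → Fin κ → Bool) : Database (κ + κ) N :=
  fun i => Fin.append (rowIndex i) (sk i)

/-- The row of user `i` is replaced by a row that does not depend on the key of user `i`. -/
def dropUser {N κ : ℕ} (sk : Fin N → Fin κ → Bool) (i : Fin N) : Database (κ + κ) N :=
  Function.update (keyDatabase sk) i (Fin.append (fun t => !rowIndex i t) fun _ => false)

/-- Adjacency demands that the row really changes; complementing the index guarantees this as soon
as there is an index bit. -/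
lemma adjacent_dropUser {N κ : ℕ} (hκ : 0 < κ) (sk : Fin N → Fin κ → Bool) (i : Fin N) :
    Adjacent (keyDatabase sk) (dropUser sk i) := by
  refine ⟨i, fun h => ?_, fun i' hi' => ?_⟩
  · have h1 := congrFun h (Fin.castAdd κ ⟨0, hκ⟩)
    rw [dropUser, Function.update_self, keyDatabase, Fin.append_left, Fin.append_left] at h1
    exact absurd h1 (by simp)
  · by_contra hne
    exact hi' (by rw [dropUser, Function.update_of_ne hne])

lemma dropUser_update {N κ : ℕ} (sk : Fin N → Fin κ → Bool) (i : Fin N) (s : Fin κ → Bool) :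
    dropUser (Function.update sk i s) i = dropUser sk i := by
  funext i'
  by_cases h : i' = i
  · subst h; simp [dropUser]
  · simp [dropUser, keyDatabase, Function.update_of_ne h]

/-- The encryptions of the code. -/
def cipher {N κ k : ℕ} (g : (Fin κ → Bool) → Fin k → Bool) (sk : Fin N → Fin κ → Bool)
    (X : Fin k → Finset (Fin N)) (j : Fin k) (i : Fin N) : Bool :=
  decide (i ∈ X j) ^^ g (sk i) j

/-- The encryptions of the code with other bits for user `i`. -/
def cipherWith {N κ k : ℕ} (g : (Fin κ → Bool) → Fin k → Bool) (sk : Fin N → Fin κ → Bool)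
    (X : Fin k → Finset (Fin N)) (i : Fin N) (u : Fin k → Bool) (j : Fin k) (i' : Fin N) : Bool :=
  if i' = i then u j else cipher g sk X j i'

/-- Together with `dropUser_update`: once the row of `i` is replaced, the key of `i` matters only
through the generator. -/
lemma cipher_update {N κ k : ℕ} (g : (Fin κ → Bool) → Fin k → Bool) (sk : Fin N → Fin κ → Bool)
    (X : Fin k → Finset (Fin N)) (i : Fin N) (s : Fin κ → Bool) :
    cipher g (Function.update sk i s) X =
      cipherWith g sk X i fun j => decide (i ∈ X j) ^^ g s j := by
  funext j i'
  by_cases h : i' = i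
  · subst h; simp [cipherWith, cipher]
  · simp [cipherWith, cipher, h]

/-- This is the independence from the bits of `i` that `soundness` requires. -/
lemma cipherWith_flipUser {N κ k : ℕ} (g : (Fin κ → Bool) → Fin k → Bool)
    (sk : Fin N → Fin κ → Bool) (X : Fin k → Finset (Fin N)) (i : Fin N) (u t : Fin k → Bool) :
    cipherWith g sk (fun j => flipUser i (t j) (X j)) i u = cipherWith g sk X i u := by
  funext j i'
  by_cases h : i' = i
  · simp [cipherWith, h]
  · simp [cipherWith, cipher, h, mem_flipUser_of_ne h]

set_option maxHeartbeats 2000000 in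
/-- A sanitizer that is accurate and private can be used to distinguish the generator from uniform
bits. -/
theorem attack_bound {n kf : ℕ → ℕ} {Q : (d : ℕ) → Set (Circuit d)} (S : Sanitizer n kf Q)
    (sz : ℕ → ℕ → ℕ)
    (hcirc : ∀ (d ℓ : ℕ) (inp : (Fin d → Bool) →
        Σ x : SanInput n kf Q, (Fin (S.coins.eval x.enc.length) → Bool)),
      BitLocal (fun y => (inp y).1.enc ++ encBits (inp y).2) ℓ →
      ∀ (k : ℕ) (v : (Fin d → Bool) → Fin k → ℚ),
      (∀ y, List.ofFn (S.answer (inp y).1 (inp y).2) = List.ofFn (v y)) →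
      ∀ (wt : Fin k → ℤ) (B : ℕ), (∀ j, |wt j| ≤ B) → ∀ Z : ℤ,
        ∃ A : Circuit d, A.size ≤ sz ℓ B ∧
          ∀ y, A.eval y = true ↔ Z ≤ ∑ j, if 1 / 2 < |v y j| then wt j else 0)
    {κ ℓG : ℕ} (hκ : 0 < κ) (hN : 0 < n (κ + κ)) (hN2 : n (κ + κ) ≤ 2 ^ κ)
    (hk : kf (n (κ + κ)) ≤ ℓG) (G : (Fin κ → Bool) → Fin ℓG → Bool)
    (q : Fin (kf (n (κ + κ))) → (Fin (n (κ + κ)) → Bool) → Q (κ + κ))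
    (ℓ : Fin (kf (n (κ + κ))) → ℕ) (hq : ∀ j, BitLocal (fun y => (q j y).1.enc) (ℓ j))
    (heval : ∀ j c id key, (q j c).1.eval (Fin.append id key) = true ↔
      ∃ i, id = rowIndex i ∧ (c i ^^ G key (Fin.castLE hk j)) = true)
    {ε δ β γ l : ℝ} {m : ℕ} (hβ : β ≤ 1)
    (hγ : ∀ A : Circuit ℓG, A.size ≤ sz (inputLength n kf (κ + κ) ℓ +
        S.coins.eval (inputLength n kf (κ + κ) ℓ)) (32 * n (κ + κ) * (n (κ + κ) + 1)) →
      |prob (fun x => A.eval (G x) = true) - prob (fun y => A.eval y = true)| ≤ γ)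
    (hdp : ∀ (D D' : Database (κ + κ) (n (κ + κ))) (q : Fin (kf (n (κ + κ))) → Q (κ + κ)),
      Adjacent D D' → ∀ T : Set (Fin (kf (n (κ + κ))) → ℚ),
        prob (fun r => S.answer ⟨κ + κ, D, q⟩ r ∈ T) ≤
          Real.exp ε * prob (fun r => S.answer ⟨κ + κ, D', q⟩ r ∈ T) + δ)
    (hacc : ∀ (D : Database (κ + κ) (n (κ + κ))) (q : Fin (kf (n (κ + κ))) → Q (κ + κ)),
      1 - β ≤ prob (fun r => ∀ j,
        |queryValue (q j).1 D - ((S.answer ⟨κ + κ, D, q⟩ r j : ℚ) : ℝ)| ≤ 49 / 100))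
    (hl : 0 < l) (hlN : l * (n (κ + κ) + 1) ≤ 1) :
    (1 - β) * (1 - 2 ^ m * Real.exp (-(kf (n (κ + κ)) / (2 * (n (κ + κ) + 1))))) ≤
      n (κ + κ) * (Real.exp ε * (Real.exp (-(l * (m - kf (n (κ + κ)) / (32 * n (κ + κ)))) +
        kf (n (κ + κ)) * (l ^ 2 * scoreVar (n (κ + κ)))) + γ) + δ) := by
  set ℓ₀ := inputLength n kf (κ + κ) ℓ with hℓ₀
  have hloc := bitLocal_hardwiredInput (n := n) (kf := kf) hq
  have hlen : ∀ db c, (hardwiredInput q db c).enc.length = ℓ₀ := fun db c =>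
    (hloc db).1 fun p => c p.1 p.2
  have hcoins : ∀ db c, S.coins.eval (hardwiredInput q db c).enc.length = S.coins.eval ℓ₀ :=
    fun db c => by rw [hlen]
  let ans : Database (κ + κ) (n (κ + κ)) → (Fin (kf (n (κ + κ))) → Fin (n (κ + κ)) → Bool) →
      (Fin (S.coins.eval ℓ₀) → Bool) → Fin (kf (n (κ + κ))) → ℚ :=
    fun db c r => S.answer (hardwiredInput q db c) (r ∘ Fin.cast (hcoins db c))
  have hans : ∀ db c (p : (Fin (kf (n (κ + κ))) → ℚ) → Prop),
      prob (fun r => p (S.answer ⟨κ + κ, db, fun j => q j (c j)⟩ r)) =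
        prob fun r => p (ans db c r) := fun db c p =>
    prob_comp_cast (hcoins db c) fun r => p (S.answer (hardwiredInput q db c) r)
  let g : (Fin κ → Bool) → Fin (kf (n (κ + κ))) → Bool := fun s j => G s (Fin.castLE hk j)
  let acc := fun db c (i : Fin (n (κ + κ))) (X : Fin (kf (n (κ + κ))) → Finset (Fin (n (κ + κ)))) =>
    prob fun r => ans db c r ∈ accusing m i X
  refine tracing_bound (K := Fin κ → Bool) (Y := Fin ℓG → Bool) (m := m)
    (fun sk X i => acc (keyDatabase sk) (cipher g sk X) i X)
    (fun sk X i => acc (dropUser sk i) (cipher g sk X) i X)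
    (fun sk X i y => acc (dropUser sk i)
      (cipherWith g sk X i fun j => y (Fin.castLE hk j)) i X)
    hβ (Real.exp_pos _).le (fun sk X i => prob_nonneg _) ?_ ?_ ?_ ?_
  · intro sk X hm
    refine (hacc (keyDatabase sk) fun j => q j (cipher g sk X j)).trans ?_
    rw [hans (keyDatabase sk) (cipher g sk X) fun v => ∀ j,
      |queryValue (q j (cipher g sk X j)).1 (keyDatabase sk) - ((v j : ℚ) : ℝ)| ≤ 49 / 100]
    refine (prob_mono ?_).trans
      (prob_exists_le_sum fun i r => ans (keyDatabase sk) (cipher g sk X) r ∈ accusing m i X)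
    intro r hr
    have hbit : ∀ j i, (q j (cipher g sk X j)).1.eval (keyDatabase sk i) = true ↔ i ∈ X j := by
      intro j i
      rw [keyDatabase, heval]
      constructor
      · rintro ⟨i', h1, h2⟩
        obtain rfl := rowIndex_injective hN2 h1
        simpa [cipher, g] using h2
      · intro h
        exact ⟨i, rfl, by simp [cipher, g, h]⟩
    have hN' : (n (κ + κ) : ℝ) ≠ 0 := by positivity
    -- Empty and full columns have values 0 and 1, and an error of at most .49 leaves the answers on
    -- the right side of 1/2.
    obtain ⟨i, hi⟩ := exists_large_score hN X
      (fun j => decide (1 / 2 < |ans (keyDatabase sk) (cipher g sk X) r j|)) (by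
        intro j hj
        have h := hr j
        have hv : queryValue (q j (cipher g sk X j)).1 (keyDatabase sk) = 0 := by
          simp [queryValue, hbit, hj]
        rw [hv, zero_sub, abs_neg] at h
        rw [decide_eq_false_iff_not, not_lt]
        have h' : ((|ans (keyDatabase sk) (cipher g sk X) r j| : ℚ) : ℝ) ≤ ((1 / 2 : ℚ) : ℝ) := by
          push_cast
          linarith
        exact_mod_cast h') (by
        intro j hj
        have h := hr j
        have hv : queryValue (q j (cipher g sk X j)).1 (keyDatabase sk) = 1 := by
          simp [queryValue, hbit, hj, hN']
        rw [hv] at h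
        rw [decide_eq_true_eq]
        have h2 := (abs_le.1 h).2
        have h' : ((1 / 2 : ℚ) : ℝ) < ((ans (keyDatabase sk) (cipher g sk X) r j : ℚ) : ℝ) := by
          push_cast
          linarith
        exact lt_of_lt_of_le (by exact_mod_cast h') (le_abs_self _)) hm
    exact ⟨i, mem_accusing_of_score hi⟩
  · intro sk X i
    have h := hdp (keyDatabase sk) (dropUser sk i) (fun j => q j (cipher g sk X j))
      (adjacent_dropUser hκ sk i) (accusing m i X)
    rwa [hans (keyDatabase sk) (cipher g sk X) fun v => v ∈ accusing m i X,
      hans (dropUser sk i) (cipher g sk X) fun v => v ∈ accusing m i X] at h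
  · intro sk X i
    let c : (Fin ℓG → Bool) → Fin (kf (n (κ + κ))) → Fin (n (κ + κ)) → Bool := fun y =>
      cipherWith g sk X i fun j => decide (i ∈ X j) ^^ y (Fin.castLE hk j)
    -- With the coins, the code and the other keys fixed, the accusation of `i` is a circuit in the
    -- challenge string. The average over the coins follows below.
    have hcomp : ∀ r : Fin (S.coins.eval ℓ₀) → Bool,
        prob (fun s => ans (dropUser sk i) (c (G s)) r ∈ accusing m i X) ≤
          prob (fun y => ans (dropUser sk i) (c y) r ∈ accusing m i X) + γ := by
      intro r
      have hbl : BitLocal (fun y => (hardwiredInput q (dropUser sk i) (c y)).enc ++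
          encBits (r ∘ Fin.cast (hcoins (dropUser sk i) (c y)))) (ℓ₀ + S.coins.eval ℓ₀) := by
        have h1 := ((hloc (dropUser sk i)).comp (u := fun y p => c y p.1 p.2) (by
          rintro ⟨j, i'⟩
          by_cases hi : i' = i
          · exact ⟨{Fin.castLE hk j}, by simp, fun y y' hy => by simp [c, cipherWith, hy]⟩
          · exact ⟨∅, by simp, fun y y' _ => by simp [c, cipherWith, hi]⟩)).append
          (bitLocal_const (encBits r))
        rw [length_encBits] at h1
        exact h1.of_eq fun y => by rw [encBits_comp_cast]
      obtain ⟨A, hA, hA'⟩ := hcirc ℓG (ℓ₀ + S.coins.eval ℓ₀)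
        (fun y => ⟨hardwiredInput q (dropUser sk i) (c y),
          r ∘ Fin.cast (hcoins (dropUser sk i) (c y))⟩) hbl (kf (n (κ + κ)))
        (fun y => ans (dropUser sk i) (c y) r) (fun y => rfl) (accuseWeight i X)
        (32 * n (κ + κ) * (n (κ + κ) + 1)) (abs_accuseWeight_le i X)
        ((32 * n (κ + κ) * m : ℕ) : ℤ)
      have h2 := (abs_le.1 (hγ A hA)).2
      have h3 : ∀ y, A.eval y = true ↔ ans (dropUser sk i) (c y) r ∈ accusing m i X := hA'
      simp only [h3] at h2
      linarith
    -- One-time pad: adding the bits of `i` permutes the strings, so uniform masked bits are just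
    -- uniform bits.
    let φ : (Fin ℓG → Bool) ≃ (Fin ℓG → Bool) :=
      ⟨fun y t => (if h : (t : ℕ) < kf (n (κ + κ)) then decide (i ∈ X ⟨t, h⟩) else false) ^^ y t,
        fun y t => (if h : (t : ℕ) < kf (n (κ + κ)) then decide (i ∈ X ⟨t, h⟩) else false) ^^ y t,
        fun y => by funext t; simp, fun y => by funext t; simp⟩
    have hφ : ∀ y, c y = cipherWith g sk X i fun j => φ y (Fin.castLE hk j) := by
      intro y
      simp only [c, φ, Equiv.coe_fn_mk, Fin.val_castLE, Fin.is_lt, dite_true, Fin.eta]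
    simp only [acc, dropUser_update, cipher_update]
    calc 𝔼 s, prob (fun r => ans (dropUser sk i) (c (G s)) r ∈ accusing m i X)
        = 𝔼 r, prob (fun s => ans (dropUser sk i) (c (G s)) r ∈ accusing m i X) := by
          simp only [prob_eq_expect]
          exact Finset.expect_comm _ _ _
      _ ≤ 𝔼 r, (prob (fun y => ans (dropUser sk i) (c y) r ∈ accusing m i X) + γ) :=
          Finset.expect_le_expect fun r _ => hcomp r
      _ = 𝔼 y, prob (fun r => ans (dropUser sk i) (c y) r ∈ accusing m i X) + γ := by
          rw [Finset.expect_add_distrib, Finset.expect_const Finset.univ_nonempty]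
          simp only [prob_eq_expect]
          rw [Finset.expect_comm]
      _ = _ := by
          congr 1
          refine Fintype.expect_equiv φ _ _ fun y => ?_
          rw [hφ]
  · intro sk i y
    simp only [acc, prob_eq_expect, Finset.mul_expect]
    rw [← Finset.expect_sum_comm]
    refine Finset.expect_le Finset.univ_nonempty fun r _ => ?_
    -- For fixed coins and `y` the answers are a deterministic function of the code that ignores the
    -- bits of `i`.
    refine (Finset.sum_le_sum fun X _ => mul_le_mul_of_nonneg_left ?_
      (codeProb_nonneg X)).trans (soundness i (fun X j => decide (1 / 2 <
        |ans (dropUser sk i) (cipherWith g sk X i fun j => y (Fin.castLE hk j)) r j|))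
        (fun X t => by rw [cipherWith_flipUser]) hl hlN
        (m - kf (n (κ + κ)) / (32 * n (κ + κ))))
    by_cases h : ans (dropUser sk i) (cipherWith g sk X i fun j => y (Fin.castLE hk j)) r ∈
        accusing m i X
    · rw [if_pos h, if_pos (score_of_mem_accusing h)]
    · rw [if_neg h]
      split_ifs <;> norm_num

end AttackBound

/-! ### Uniform security against all circuits of a given size -/

/-- A circuit without inputs that is constantly true. -/
def Circuit.true (d : ℕ) : Circuit d := ⟨.snoc .nil (.conj []), Sum.inr 0⟩

lemma abs_prob_sub_prob_le_one {α β : Type} [Fintype α] [Fintype β] (p : α → Prop)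
    (q : β → Prop) : |prob p - prob q| ≤ 1 := by
  have := prob_nonneg p
  have := prob_nonneg q
  have := prob_le_one p
  have := prob_le_one q
  rw [abs_le]
  constructor <;> linarith

/-- The advantages of all adversaries whose size is below a fixed polynomial are bounded by one
negligible function. -/
lemma IsLocalPRG.exists_forall_advantage_le {ℓ : ℕ → ℕ} {γ : ℕ → ℝ} {L : ℕ}
    {G : (κ : ℕ) → (Fin κ → Bool) → Fin (ℓ κ) → Bool} (hG : IsLocalPRG ℓ γ L G)
    (P : Polynomial ℕ) (hP : ∀ a, 1 ≤ P.eval a) :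
    ∃ γ' : ℕ → ℝ, γ' =o[atTop] γ ∧ (∀ κ, 0 ≤ γ' κ) ∧
      ∀ (κ : ℕ) (A : Circuit (ℓ κ)), A.size ≤ P.eval (ℓ κ) →
        |prob (fun x : Fin κ → Bool => A.eval (G κ x) = true) -
          prob (fun y : Fin (ℓ κ) → Bool => A.eval y = true)| ≤ γ' κ := by
  let adv : (κ : ℕ) → Circuit (ℓ κ) → ℝ := fun κ A =>
    |prob (fun x : Fin κ → Bool => A.eval (G κ x) = true) -
      prob (fun y : Fin (ℓ κ) → Bool => A.eval y = true)|
  -- Security concerns single families. A family that is within a factor 2 of the supremum for each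
  -- `κ` controls all circuits at once; the factor avoids having to attain the supremum.
  have hex : ∀ κ, ∃ A : Circuit (ℓ κ), A.size ≤ P.eval (ℓ κ) ∧
      ∀ A' : Circuit (ℓ κ), A'.size ≤ P.eval (ℓ κ) → adv κ A' ≤ 2 * adv κ A := by
    intro κ
    by_cases h0 : ∃ A : Circuit (ℓ κ), A.size ≤ P.eval (ℓ κ) ∧ 0 < adv κ A
    · obtain ⟨A₀, hA₀, hpos⟩ := h0
      let s : Set ℝ := adv κ '' {A | A.size ≤ P.eval (ℓ κ)}
      have hbdd : BddAbove s := ⟨1, by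
        rintro _ ⟨A, -, rfl⟩
        exact abs_prob_sub_prob_le_one _ _⟩
      have hs : 0 < sSup s := hpos.trans_le (le_csSup hbdd ⟨A₀, hA₀, rfl⟩)
      obtain ⟨_, ⟨A, hA, rfl⟩, hlt⟩ :=
        exists_lt_of_lt_csSup (⟨_, A₀, hA₀, rfl⟩ : s.Nonempty) (half_lt_self hs)
      refine ⟨A, hA, fun A' hA' => ?_⟩
      have := le_csSup hbdd ⟨A', hA', rfl⟩
      linarith
    · push Not at h0
      have hA : (Circuit.true (ℓ κ)).size ≤ P.eval (ℓ κ) := (hP (ℓ κ)).trans' (by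
        simp [Circuit.true, Circuit.size, GateSeq.size, Gate.wires])
      exact ⟨_, hA, fun A' hA' => (h0 A' hA').trans (mul_nonneg zero_le_two (abs_nonneg _))⟩
  choose A hA hmax using hex
  exact ⟨fun κ => 2 * adv κ (A κ), (hG.pseudorandom A ⟨P, hA⟩).const_mul_left 2,
    fun κ => mul_nonneg zero_le_two (abs_nonneg _), hmax⟩

/-! ### Polynomially bounded functions -/

lemma eval_le_eval (P : Polynomial ℕ) {a b : ℕ} (h : a ≤ b) : P.eval a ≤ P.eval b := by
  rw [Polynomial.eval_eq_sum_range, Polynomial.eval_eq_sum_range]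
  gcongr

/-- A function is eventually below a polynomial. -/
def PolyBounded (f : ℕ → ℕ) : Prop := ∃ P : Polynomial ℕ, ∀ᶠ a in atTop, f a ≤ P.eval a

namespace PolyBounded

variable {f g : ℕ → ℕ}

lemma mono (hg : PolyBounded g) (h : ∀ᶠ a in atTop, f a ≤ g a) : PolyBounded f := by
  obtain ⟨P, hP⟩ := hg
  exact ⟨P, by filter_upwards [hP, h] with a h1 h2 using h2.trans h1⟩

lemma const (c : ℕ) : PolyBounded fun _ => c :=
  ⟨Polynomial.C c, by simp⟩

lemma id : PolyBounded fun a => a :=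
  ⟨Polynomial.X, by simp⟩

lemma add (hf : PolyBounded f) (hg : PolyBounded g) : PolyBounded fun a => f a + g a := by
  obtain ⟨P, hP⟩ := hf
  obtain ⟨R, hR⟩ := hg
  refine ⟨P + R, ?_⟩
  filter_upwards [hP, hR] with a h1 h2
  rw [Polynomial.eval_add]
  exact add_le_add h1 h2

lemma mul (hf : PolyBounded f) (hg : PolyBounded g) : PolyBounded fun a => f a * g a := by
  obtain ⟨P, hP⟩ := hf
  obtain ⟨R, hR⟩ := hg
  refine ⟨P * R, ?_⟩
  filter_upwards [hP, hR] with a h1 h2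
  rw [Polynomial.eval_mul]
  exact Nat.mul_le_mul h1 h2

lemma pow (hf : PolyBounded f) (e : ℕ) : PolyBounded fun a => f a ^ e := by
  induction e with
  | zero => simpa using const 1
  | succ e ih => simpa [pow_succ] using ih.mul hf

lemma eval (hf : PolyBounded f) (R : Polynomial ℕ) : PolyBounded fun a => R.eval (f a) := by
  obtain ⟨P, hP⟩ := hf
  refine ⟨R.comp P, ?_⟩
  filter_upwards [hP] with a h
  rw [Polynomial.eval_comp]
  exact eval_le_eval R h

lemma scanStates (hf : PolyBounded f) (hg : PolyBounded g) :
    PolyBounded fun a => scanStates (f a) (g a) :=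
  (hf.add (const 1)).mul (((((const 2).mul (hf.mul hg))).add (const 1)).mul (const 4))

lemma testSize {t : ℕ → ℕ} (C R : ℕ) (ht : PolyBounded t) (hf : PolyBounded f)
    (hg : PolyBounded g) : PolyBounded fun a => testSize C R (t a) (f a) (g a) := by
  have h1 := hf.add (ht.mul (const R))
  have h2 := h1.scanStates hg
  exact (((((const C).mul (ht.add (const 1))).mul (h1.add (const 1))).add (const 8)).add
    (h1.mul (h2.mul (((const 4).mul (h2.mul (const 7))).add (const 1))))).add ((const 1).add h2)

end PolyBounded

lemma scanStates_mono {ℓ ℓ' : ℕ} (h : ℓ ≤ ℓ') (B : ℕ) : scanStates ℓ B ≤ scanStates ℓ' B := by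
  unfold scanStates
  gcongr

lemma testSize_mono {C R T T' ℓ ℓ' : ℕ} (hT : T ≤ T') (h : ℓ ≤ ℓ') (B : ℕ) :
    testSize C R T ℓ B ≤ testSize C R T' ℓ' B := by
  have h1 : ℓ + T * R ≤ ℓ' + T' * R := by gcongr
  have h2 := scanStates_mono h1 B
  unfold testSize
  gcongr

/-! ### The rate of growth of the number of rows -/

section Growth

variable {n : ℕ → ℕ} {c : ℝ}

lemma tendsto_rows (hc : 0 < c)
    (hn : (fun d : ℕ => (n d : ℝ)) =Θ[atTop] (fun d : ℕ => (d : ℝ) ^ c)) :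
    Tendsto n atTop atTop := by
  have h1 : Tendsto (fun d : ℕ => (d : ℝ) ^ c) atTop atTop :=
    (tendsto_rpow_atTop hc).comp tendsto_natCast_atTop_atTop
  have h3 : Tendsto (fun d : ℕ => ‖(n d : ℝ)‖) atTop atTop :=
    hn.tendsto_norm_atTop_iff.2 (tendsto_norm_atTop_atTop.comp h1)
  simp only [Real.norm_natCast] at h3
  exact tendsto_natCast_atTop_iff.1 h3

lemma exists_rows_le (hn : (fun d : ℕ => (n d : ℝ)) =Θ[atTop] (fun d : ℕ => (d : ℝ) ^ c)) :
    ∃ C e : ℕ, ∀ᶠ d in atTop, n d ≤ C * d ^ e := by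
  obtain ⟨C, hC⟩ := hn.1.bound
  refine ⟨⌈C⌉₊, ⌈c⌉₊, ?_⟩
  filter_upwards [hC, eventually_ge_atTop 1] with d h hd
  have hd' : (1 : ℝ) ≤ d := by exact_mod_cast hd
  rw [Real.norm_natCast, Real.norm_of_nonneg (by positivity)] at h
  have h2 : (d : ℝ) ^ c ≤ (d : ℝ) ^ ⌈c⌉₊ := by
    rw [← Real.rpow_natCast]
    exact Real.rpow_le_rpow_of_exponent_le hd' (Nat.le_ceil c)
  have h3 : (n d : ℝ) ≤ (⌈C⌉₊ : ℝ) * (d : ℝ) ^ ⌈c⌉₊ :=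
    h.trans (mul_le_mul (Nat.le_ceil C) h2 (by positivity) (by positivity))
  exact_mod_cast h3

/-- Adversaries are measured in powers of `n κ`, so polynomials in `κ` must be bounded by
polynomials in `n κ`. The exponent ⌈1/c⌉ serves. -/
lemma exists_le_rows_pow (hc : 0 < c)
    (hn : (fun d : ℕ => (n d : ℝ)) =Θ[atTop] (fun d : ℕ => (d : ℝ) ^ c)) :
    ∃ C e : ℕ, ∀ᶠ d in atTop, d ≤ C * n d ^ e := by
  obtain ⟨C, hC⟩ := hn.2.bound
  set e := ⌈1 / c⌉₊ with he
  have hce : 1 ≤ c * e := by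
    have := Nat.le_ceil (1 / c)
    rwa [div_le_iff₀ hc, mul_comm] at this
  refine ⟨⌈|C| ^ e⌉₊, e, ?_⟩
  filter_upwards [hC, eventually_ge_atTop 1] with d h hd
  have hd' : (1 : ℝ) ≤ d := by exact_mod_cast hd
  rw [Real.norm_natCast, Real.norm_of_nonneg (by positivity)] at h
  have h1 : (d : ℝ) ^ c ≤ |C| * n d := h.trans (by gcongr; exact le_abs_self C)
  have h2 : (d : ℝ) ≤ (⌈|C| ^ e⌉₊ : ℝ) * (n d : ℝ) ^ e := by
    calc (d : ℝ) = (d : ℝ) ^ (1 : ℝ) := (Real.rpow_one _).symm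
      _ ≤ (d : ℝ) ^ (c * e) := Real.rpow_le_rpow_of_exponent_le hd' hce
      _ = ((d : ℝ) ^ c) ^ e := by rw [Real.rpow_mul (by positivity), Real.rpow_natCast]
      _ ≤ (|C| * n d) ^ e := by gcongr
      _ = |C| ^ e * (n d : ℝ) ^ e := mul_pow _ _ _
      _ ≤ _ := by gcongr; exact Nat.le_ceil _
  exact_mod_cast h2

/-- Rows contain an index and a key of `κ` bits each, whereas the generator is governed by `n κ`;
the two row numbers must be comparable. -/
lemma exists_rows_double_le
    (hn : (fun d : ℕ => (n d : ℝ)) =Θ[atTop] (fun d : ℕ => (d : ℝ) ^ c)) :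
    ∃ C : ℕ, ∀ᶠ d in atTop, n (d + d) ≤ C * n d := by
  obtain ⟨C, hC⟩ := hn.1.bound
  obtain ⟨C', hC'⟩ := hn.2.bound
  have hdouble : Tendsto (fun d : ℕ => d + d) atTop atTop :=
    tendsto_atTop_mono (fun d => Nat.le_add_left d d) tendsto_id
  refine ⟨⌈|C| * 2 ^ c * |C'|⌉₊, ?_⟩
  filter_upwards [hdouble.eventually hC, hC'] with d h h'
  rw [Real.norm_natCast, Real.norm_of_nonneg (by positivity)] at h h'
  have h2 : (n (d + d) : ℝ) ≤ (⌈|C| * 2 ^ c * |C'|⌉₊ : ℝ) * n d := by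
    calc (n (d + d) : ℝ) ≤ |C| * ((d + d : ℕ) : ℝ) ^ c :=
          h.trans (by gcongr; exact le_abs_self C)
      _ = |C| * 2 ^ c * (d : ℝ) ^ c := by
          rw [show ((d + d : ℕ) : ℝ) = 2 * d by push_cast; ring,
            Real.mul_rpow zero_le_two (by positivity), mul_assoc]
      _ ≤ |C| * 2 ^ c * (|C'| * n d) := by
          gcongr
          exact h'.trans (by gcongr; exact le_abs_self C')
      _ = |C| * 2 ^ c * |C'| * n d := by ring
      _ ≤ _ := by gcongr; exact Nat.le_ceil _
  exact_mod_cast h2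

/-- This makes the row indices fit into `κ` bits. -/
lemma eventually_rows_double_le_two_pow
    (hn : (fun d : ℕ => (n d : ℝ)) =Θ[atTop] (fun d : ℕ => (d : ℝ) ^ c)) :
    ∀ᶠ d in atTop, n (d + d) ≤ 2 ^ d := by
  obtain ⟨C, e, h⟩ := exists_rows_le hn
  have hdouble : Tendsto (fun d : ℕ => d + d) atTop atTop :=
    tendsto_atTop_mono (fun d => Nat.le_add_left d d) tendsto_id
  have h1 := ((isLittleO_pow_const_const_pow_of_one_lt (R := ℝ) e
    (one_lt_two)).const_mul_left ((C : ℝ) * 2 ^ e)).bound one_pos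
  filter_upwards [hdouble.eventually h, h1] with d h2 h3
  rw [Real.norm_of_nonneg (by positivity), Real.norm_of_nonneg (by positivity), one_mul] at h3
  have h4 : (n (d + d) : ℝ) ≤ 2 ^ d := by
    refine le_trans ?_ h3
    calc (n (d + d) : ℝ) ≤ C * ((d + d : ℕ) : ℝ) ^ e := by exact_mod_cast h2
      _ = C * 2 ^ e * (d : ℝ) ^ e := by
        rw [show ((d + d : ℕ) : ℝ) = 2 * d by push_cast; ring, mul_pow, mul_assoc]
  exact_mod_cast h4

end Growth

/-! ### The number of queries -/

/-- The length of the tracing code for `a` users. -/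
def codeLength (a : ℕ) : ℕ := 16 * a ^ 2 * (Nat.log 2 a + 1) ^ 3

lemma codeLength_pos {a : ℕ} (ha : 0 < a) : 0 < codeLength a := by
  unfold codeLength
  positivity

lemma codeLength_le {a : ℕ} (ha : 0 < a) : codeLength a ≤ 16 * a ^ 5 := by
  have h : Nat.log 2 a + 1 ≤ a := Nat.log_lt_self 2 ha.ne'
  calc codeLength a ≤ 16 * a ^ 2 * a ^ 3 := by unfold codeLength; gcongr
    _ = 16 * a ^ 5 := by ring

lemma log_le_natLog_add_one {a : ℕ} (ha : 0 < a) : Real.log a ≤ (Nat.log 2 a + 1 : ℕ) := by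
  have h : (a : ℝ) ≤ 2 ^ (Nat.log 2 a + 1) := by
    exact_mod_cast (Nat.lt_pow_succ_log_self one_lt_two a).le
  have h2 : Real.log a ≤ (Nat.log 2 a + 1 : ℕ) * Real.log 2 := by
    rw [← Real.log_pow]
    exact Real.log_le_log (by exact_mod_cast ha) h
  refine h2.trans (mul_le_of_le_one_right (by positivity) ?_)
  have := Real.log_two_lt_d9
  linarith

lemma tendsto_natLog : Tendsto (fun a => Nat.log 2 a) atTop atTop :=
  tendsto_atTop.2 fun b => by
    filter_upwards [eventually_ge_atTop (2 ^ b)] with a ha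
    exact Nat.le_log_of_pow_le one_lt_two ha

lemma tendsto_natLog_add_one :
    Tendsto (fun a : ℕ => ((Nat.log 2 a + 1 : ℕ) : ℝ)) atTop atTop :=
  tendsto_natCast_atTop_atTop.comp
    (tendsto_atTop_mono (fun _ => Nat.le_add_right _ 1) tendsto_natLog)

lemma isSquarePlusLittleO_codeLength : IsSquarePlusLittleO codeLength := by
  have hlog : Tendsto (fun a : ℕ => Real.log a) atTop atTop :=
    Real.tendsto_log_atTop.comp tendsto_natCast_atTop_atTop
  -- The exponent is found by solving for it; the excess over 2 is (log 16 + 3 log(log₂ a + 1)) /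
  -- log a, with log₂ rounded down.
  refine ⟨fun a => Real.log (codeLength a) / Real.log a - 2, ?_, ?_⟩
  · have h1 : (fun a : ℕ => Real.log ((Nat.log 2 a + 1 : ℕ) : ℝ)) =o[atTop]
        fun a : ℕ => Real.log a := by
      have h2 := Real.isLittleO_log_id_atTop.comp_tendsto tendsto_natLog_add_one
      refine h2.trans_isBigO ?_
      refine IsBigO.of_bound 3 ?_
      filter_upwards [hlog.eventually_ge_atTop 1, eventually_ge_atTop 1] with a ha ha1
      have ha0 : (0 : ℝ) < a := by exact_mod_cast ha1
      have h3 : (2 : ℝ) ^ Nat.log 2 a ≤ a := by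
        exact_mod_cast Nat.pow_log_le_self 2 (by omega)
      have h4 := Real.log_le_log (by positivity) h3
      rw [Real.log_pow] at h4
      have h5 := Real.log_two_gt_d9
      simp only [Function.comp_apply, id_eq, Real.norm_eq_abs]
      rw [abs_of_nonneg (by positivity), abs_of_nonneg (by linarith)]
      push_cast
      nlinarith [(Nat.cast_nonneg (Nat.log 2 a) : (0 : ℝ) ≤ _)]
    have h6 : Tendsto (fun a : ℕ => Real.log 16 / Real.log a +
        3 * (Real.log ((Nat.log 2 a + 1 : ℕ) : ℝ) / Real.log a)) atTop (𝓝 (0 + 3 * 0)) :=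
      (hlog.const_div_atTop _).add (h1.tendsto_div_nhds_zero.const_mul 3)
    rw [mul_zero, add_zero] at h6
    refine h6.congr' ?_
    filter_upwards [hlog.eventually_ge_atTop 1, eventually_ge_atTop 1] with a ha ha1
    have ha0 : (0 : ℝ) < a := by exact_mod_cast ha1
    have : Real.log (codeLength a) =
        Real.log 16 + 2 * Real.log a + 3 * Real.log ((Nat.log 2 a + 1 : ℕ) : ℝ) := by
      unfold codeLength
      rw [Nat.cast_mul, Nat.cast_mul, Nat.cast_pow, Nat.cast_pow,
        Real.log_mul (by positivity) (by positivity), Real.log_mul (by positivity) (by positivity),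
        Real.log_pow, Real.log_pow]
      norm_num
    rw [this]
    field_simp
    ring
  · filter_upwards [hlog.eventually_ge_atTop 1, eventually_ge_atTop 1] with a ha ha1
    have ha0 : (0 : ℝ) < a := by exact_mod_cast ha1
    have hk : (0 : ℝ) < codeLength a := by exact_mod_cast codeLength_pos ha1
    rw [Real.rpow_def_of_pos ha0, add_sub_cancel, mul_div_cancel₀ _ (by positivity),
      Real.exp_log hk]

/-! ### The choice of the parameters -/

section Parameters

variable {N : ℕ}

lemma four_le_scoreVar (hN : 0 < N) : 4 ≤ scoreVar N := by
  have := Real.log_nonneg (show (1 : ℝ) ≤ N by exact_mod_cast hN)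
  unfold scoreVar
  linarith

/-- The rate at which the accusation scores are tilted. -/
noncomputable def tiltRate (N : ℕ) : ℝ := 1 / (64 * N * scoreVar N)

lemma tiltRate_pos (hN : 0 < N) : 0 < tiltRate N := by
  have := four_le_scoreVar hN
  have : (0 : ℝ) < N := by exact_mod_cast hN
  unfold tiltRate
  positivity

lemma tiltRate_mul_le_one (hN : 0 < N) : tiltRate N * (N + 1) ≤ 1 := by
  have h1 := four_le_scoreVar hN
  have h2 : (1 : ℝ) ≤ N := by exact_mod_cast hN
  unfold tiltRate
  rw [one_div, inv_mul_le_iff₀ (by positivity)]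
  nlinarith

/-- Let g be the rounded logarithm plus 1 and V = `scoreVar N`. The threshold left after rounding is
Ng³/2, so the linear term is -g³/(128V), and the quadratic term is g³/(256V). Finally V ≤ 8g. -/
lemma tilted_exponent_le (hN : 0 < N) :
    -(tiltRate N * ((N * (Nat.log 2 N + 1) ^ 3 : ℕ) - codeLength N / (32 * N))) +
        codeLength N * (tiltRate N ^ 2 * scoreVar N) ≤
      -(((Nat.log 2 N + 1 : ℕ) : ℝ) ^ 2 / 2048) := by
  have h1 := four_le_scoreVar hN
  have h2 : (0 : ℝ) < N := by exact_mod_cast hN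
  have h3 : scoreVar N ≤ 8 * ((Nat.log 2 N + 1 : ℕ) : ℝ) := by
    have := log_le_natLog_add_one hN
    have h : (1 : ℝ) ≤ (Nat.log 2 N + 1 : ℕ) := by exact_mod_cast Nat.le_add_left 1 _
    unfold scoreVar
    linarith
  unfold codeLength tiltRate
  push_cast at h3 ⊢
  set g : ℝ := (Nat.log 2 N : ℝ) + 1
  set V := scoreVar N
  have hV : 0 < V := by linarith
  have hg : 0 < g := by linarith
  have h4 : -(1 / (64 * N * V) * (N * g ^ 3 - 16 * (N : ℝ) ^ 2 * g ^ 3 / (32 * N))) +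
      16 * (N : ℝ) ^ 2 * g ^ 3 * ((1 / (64 * N * V)) ^ 2 * V) = -(g ^ 3 / (256 * V)) := by
    field_simp
    ring
  rw [h4, neg_le_neg_iff, div_le_div_iff₀ (by norm_num) (by positivity)]
  nlinarith [mul_le_mul_of_nonneg_left h3 (sq_nonneg g)]

/-- For m = Ng³ the code length is 16Nm, so the exponent is at least 4m and outweighs 2^m. -/
lemma two_pow_mul_exp_le (hN : 0 < N) :
    2 ^ (N * (Nat.log 2 N + 1) ^ 3) * Real.exp (-(codeLength N / (2 * (N + 1)))) ≤ 1 / 2 := by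
  have h2 : (1 : ℝ) ≤ N := by exact_mod_cast hN
  set m := N * (Nat.log 2 N + 1) ^ 3 with hm
  have hm1 : (1 : ℝ) ≤ m := by
    have : 0 < m := by positivity
    exact_mod_cast this
  have h3 : (codeLength N : ℝ) = 16 * N * m := by
    rw [hm, codeLength]
    push_cast
    ring
  have h4 : 4 * (m : ℝ) ≤ codeLength N / (2 * (N + 1)) := by
    rw [h3, le_div_iff₀ (by positivity)]
    nlinarith
  have h5 : (2 : ℝ) ^ m ≤ Real.exp m := by
    rw [← Real.exp_one_pow]
    have := Real.exp_one_gt_d9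
    gcongr
    linarith
  calc 2 ^ m * Real.exp (-(codeLength N / (2 * (N + 1)))) ≤
        Real.exp m * Real.exp (-(4 * m)) := by gcongr
    _ = Real.exp (-(3 * m)) := by rw [← Real.exp_add]; ring_nf
    _ ≤ Real.exp (-1) := by
        rw [Real.exp_le_exp]
        linarith
    _ ≤ 1 / 2 := by
        rw [Real.exp_neg, one_div]
        have := Real.exp_one_gt_d9
        gcongr
        linarith

/-- The error survives the union bound over all users because its exponent is quadratic in the
logarithm: for g ≥ 4096, g²/2048 ≥ 2g ≥ g + log a. -/
lemma tendsto_mul_exp_natLog : Tendsto (fun a : ℕ =>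
    (a : ℝ) * Real.exp (-(((Nat.log 2 a + 1 : ℕ) : ℝ) ^ 2 / 2048))) atTop (𝓝 0) := by
  have h1 : Tendsto (fun x : ℝ => Real.exp (-x)) atTop (𝓝 0) :=
    Real.tendsto_exp_neg_atTop_nhds_zero
  refine squeeze_zero' (Eventually.of_forall fun a => by positivity) ?_
    (h1.comp tendsto_natLog_add_one)
  filter_upwards [tendsto_natLog_add_one.eventually_ge_atTop 4096, eventually_ge_atTop 1]
    with a ha ha1
  have ha0 : (0 : ℝ) < a := by exact_mod_cast ha1
  have h2 := log_le_natLog_add_one ha1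
  set g := ((Nat.log 2 a + 1 : ℕ) : ℝ)
  calc (a : ℝ) * Real.exp (-(g ^ 2 / 2048)) = Real.exp (Real.log a - g ^ 2 / 2048) := by
        rw [sub_eq_add_neg, Real.exp_add, Real.exp_log ha0]
    _ ≤ Real.exp (-g) := by
        rw [Real.exp_le_exp]
        nlinarith

end Parameters

lemma inputLength_le {n kf : ℕ → ℕ} {d m : ℕ} {ℓ : Fin (kf (n d)) → ℕ} (h : ∀ j, ℓ j ≤ m) :
    inputLength n kf d ℓ ≤
      (d + 1) + (n d + 1) + (kf (n d) + 1) + n d * d + kf (n d) * m := by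
  have := length_encNat_le d
  have := length_encNat_le (n d)
  have := length_encNat_le (kf (n d))
  have : ∑ j, ℓ j ≤ kf (n d) * m := by
    simpa using Finset.sum_le_sum fun j (_ : j ∈ Finset.univ) => h j
  unfold inputLength
  omega

/-! ### Polynomial bounds for the attack -/

section Growth

variable {n : ℕ → ℕ} {c : ℝ}

lemma tendsto_add_self : Tendsto (fun d : ℕ => d + d) atTop atTop :=
  tendsto_atTop_mono (fun d => Nat.le_add_left d d) tendsto_id

lemma polyBounded_rows_double
    (hn : (fun d : ℕ => (n d : ℝ)) =Θ[atTop] (fun d : ℕ => (d : ℝ) ^ c)) :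
    PolyBounded fun κ => n (κ + κ) := by
  obtain ⟨C, e, h⟩ := exists_rows_le hn
  exact ((PolyBounded.const C).mul ((PolyBounded.id.add PolyBounded.id).pow e)).mono
    (tendsto_add_self.eventually h)

lemma PolyBounded.exists_le_eval_rows_pow {f : ℕ → ℕ} (hf : PolyBounded f) (hc : 0 < c)
    (hn : (fun d : ℕ => (n d : ℝ)) =Θ[atTop] (fun d : ℕ => (d : ℝ) ^ c)) :
    ∃ P : Polynomial ℕ, (∀ a, 1 ≤ P.eval a) ∧ ∀ᶠ κ in atTop, f κ ≤ P.eval (n κ ^ 7) := by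
  obtain ⟨P, hP⟩ := hf
  obtain ⟨C, e, h⟩ := exists_le_rows_pow hc hn
  refine ⟨1 + P.comp (Polynomial.C C * Polynomial.X ^ e), fun a => by simp, ?_⟩
  filter_upwards [hP, h] with κ h1 h2
  simp only [Polynomial.eval_add, Polynomial.eval_one, Polynomial.eval_comp, Polynomial.eval_mul,
    Polynomial.eval_C, Polynomial.eval_pow, Polynomial.eval_X]
  refine (h1.trans (eval_le_eval P (h2.trans ?_))).trans (Nat.le_add_left _ _)
  gcongr
  exact Nat.le_self_pow (by norm_num) _

/-- The stretch has to provide one output bit per query. Bounding the logarithm by `a` gives 16 a^5,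
and one further factor `n κ` absorbs the constants. -/
lemma eventually_codeLength_le (hc : 0 < c)
    (hn : (fun d : ℕ => (n d : ℝ)) =Θ[atTop] (fun d : ℕ => (d : ℝ) ^ c)) :
    ∀ᶠ κ in atTop, codeLength (n (κ + κ)) ≤ n κ ^ 7 := by
  obtain ⟨C, hC⟩ := exists_rows_double_le hn
  have hlim := tendsto_rows hc hn
  filter_upwards [hC, hlim.eventually_ge_atTop (16 * C ^ 5 + 1),
    (hlim.comp tendsto_add_self).eventually_ge_atTop 1] with κ h1 h2 h3
  calc codeLength (n (κ + κ)) ≤ 16 * n (κ + κ) ^ 5 := codeLength_le h3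
    _ ≤ 16 * (C * n κ) ^ 5 := by gcongr
    _ = 16 * C ^ 5 * n κ ^ 5 := by ring
    _ ≤ n κ * n κ ^ 5 := Nat.mul_le_mul_right _ (by omega)
    _ = n κ ^ 6 := by ring
    _ ≤ n κ ^ 7 := Nat.pow_le_pow_right (by omega) (by norm_num)

end Growth

/-- A polynomial bound on the size of the decryption queries. -/
noncomputable def queryPoly (L : ℕ) : Polynomial ℕ :=
  5 * Polynomial.X + Polynomial.C (2 ^ L) * Polynomial.X * (Polynomial.X + Polynomial.C (L + 2)) +
    (1 + Polynomial.C (2 ^ L) * Polynomial.X)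

lemma decryptSize_le_eval (κ N L : ℕ) :
    decryptSize κ N L ≤ (queryPoly L).eval (κ + κ + N) := by
  have h1 : N * 2 ^ L * (κ + L + 2) ≤ 2 ^ L * (κ + κ + N) * (κ + κ + N + (L + 2)) := by
    rw [mul_comm N]
    exact Nat.mul_le_mul (Nat.mul_le_mul_left _ (by omega)) (by omega)
  have h2 : N * 2 ^ L ≤ 2 ^ L * (κ + κ + N) := by
    rw [mul_comm N]
    gcongr
    omega
  simp only [queryPoly, decryptSize, Polynomial.eval_add, Polynomial.eval_mul,
    Polynomial.eval_ofNat, Polynomial.eval_X, Polynomial.eval_C, Polynomial.eval_one]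
  omega

/-- A bound on the length of the decryption queries and the database as a string. -/
def attackInputLength (n : ℕ → ℕ) (L κ : ℕ) : ℕ :=
  (κ + κ + 1) + (n (κ + κ) + 1) + (codeLength (n (κ + κ)) + 1) + n (κ + κ) * (κ + κ) +
    codeLength (n (κ + κ)) * ((decryptSize κ (n (κ + κ)) L + 1) *
      (κ + κ + decryptSize κ (n (κ + κ)) L + 5))

lemma PolyBounded.attackInputLength {n : ℕ → ℕ} (hn : PolyBounded fun κ => n (κ + κ)) (L : ℕ) :
    PolyBounded (attackInputLength n L) := by
  have hκ := PolyBounded.id.add PolyBounded.id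
  have hlog : PolyBounded fun κ => Nat.log 2 (n (κ + κ)) :=
    hn.mono (Eventually.of_forall fun κ => Nat.log_le_self 2 _)
  have hk : PolyBounded fun κ => codeLength (n (κ + κ)) :=
    ((const 16).mul (hn.pow 2)).mul ((hlog.add (const 1)).pow 3)
  have hs : PolyBounded fun κ => decryptSize κ (n (κ + κ)) L :=
    ((hκ.add hn).eval (queryPoly L)).mono
      (Eventually.of_forall fun κ => decryptSize_le_eval κ _ L)
  exact (((((hκ.add (const 1)).add (hn.add (const 1))).add (hk.add (const 1))).add
    (hn.mul hκ)).add (hk.mul ((hs.add (const 1)).mul ((hκ.add hs).add (const 5)))))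

/-- No parameters that satisfy the bound on the success of the tracing attack are such that the
sanitizer is accurate and private and the generator is secure. -/
lemma not_eventually_tracing_bound {n : ℕ → ℕ} {ε δ β γ : ℕ → ℝ} {C : ℕ}
    (hlim : Tendsto n atTop atTop) (hC : ∀ᶠ κ in atTop, n (κ + κ) ≤ C * n κ)
    (hε : ε =O[atTop] (fun _ => (1 : ℝ))) (hδ : δ =o[atTop] (fun a => 1 / (a : ℝ)))
    (hβ : Tendsto β atTop (𝓝 0)) (hγ : γ =o[atTop] (fun κ => 1 / (n κ : ℝ) ^ 2))
    (hγ0 : ∀ κ, 0 ≤ γ κ) (hbound : ∀ᶠ κ in atTop, ∀ N, N = n (κ + κ) →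
      (1 - β N) * (1 - 2 ^ (N * (Nat.log 2 N + 1) ^ 3) *
        Real.exp (-(codeLength N / (2 * (N + 1))))) ≤
      N * (Real.exp (ε N) * (Real.exp (-(tiltRate N * ((N * (Nat.log 2 N + 1) ^ 3 : ℕ) -
        codeLength N / (32 * N))) + codeLength N * (tiltRate N ^ 2 * scoreVar N)) + γ κ) +
          δ N)) : False := by
  have hN : Tendsto (fun κ => n (κ + κ)) atTop atTop := hlim.comp tendsto_add_self
  obtain ⟨E, hE⟩ := hε.bound
  have hδ' : Tendsto (fun a : ℕ => (a : ℝ) * δ a) atTop (𝓝 0) := by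
    refine hδ.tendsto_div_nhds_zero.congr fun a => ?_
    rw [div_div_eq_mul_div, div_one, mul_comm]
  have hγ' : Tendsto (fun κ => (n (κ + κ) : ℝ) * γ κ) atTop (𝓝 0) := by
    have h1 : Tendsto (fun κ => (C : ℝ) * (γ κ / (1 / (n κ : ℝ) ^ 2))) atTop (𝓝 ((C : ℝ) * 0)) :=
      hγ.tendsto_div_nhds_zero.const_mul _
    rw [mul_zero] at h1
    refine squeeze_zero' (Eventually.of_forall fun κ => mul_nonneg (by positivity) (hγ0 κ)) ?_ h1
    filter_upwards [hC] with κ h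
    have h2 : n (κ + κ) ≤ C * n κ ^ 2 :=
      h.trans (Nat.mul_le_mul_left _ (Nat.le_self_pow (by norm_num) _))
    have h3 : (n (κ + κ) : ℝ) ≤ C * (n κ : ℝ) ^ 2 := by exact_mod_cast h2
    rw [div_div_eq_mul_div, div_one]
    nlinarith [hγ0 κ]
  have hrhs : Tendsto (fun κ => Real.exp E * ((n (κ + κ) : ℝ) *
      Real.exp (-(((Nat.log 2 (n (κ + κ)) + 1 : ℕ) : ℝ) ^ 2 / 2048)) + (n (κ + κ) : ℝ) * γ κ) +
        (n (κ + κ) : ℝ) * δ (n (κ + κ))) atTop (𝓝 (Real.exp E * (0 + 0) + 0)) :=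
    (((tendsto_mul_exp_natLog.comp hN).add hγ').const_mul _).add (hδ'.comp hN)
  rw [add_zero, add_zero, mul_zero] at hrhs
  obtain ⟨κ, h1, h2, h3, h4, h5⟩ := ((hrhs.eventually_lt_const
    (show (0 : ℝ) < 1 / 4 by norm_num)).and (((hβ.comp hN).eventually_lt_const
    (show (0 : ℝ) < 1 / 2 by norm_num)).and ((hN.eventually hE).and
    ((hN.eventually_ge_atTop 1).and hbound)))).exists
  specialize h5 _ rfl
  simp only [Function.comp_apply] at h2
  generalize n (κ + κ) = N at *
  have h6 := two_pow_mul_exp_le h4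
  have h7 := tilted_exponent_le h4
  have h8 : Real.exp (ε N) ≤ Real.exp E := by
    rw [Real.exp_le_exp]
    have := (le_abs_self (ε N)).trans h3
    simpa using this
  -- Both factors are at least 1/2: the first because `β` tends to 0, the second by `h6`.
  have h9 : (1 : ℝ) / 4 ≤ (1 - β N) * (1 - 2 ^ (N * (Nat.log 2 N + 1) ^ 3) *
        Real.exp (-(codeLength N / (2 * (N + 1))))) := by
    nlinarith
  have h10 := Real.exp_le_exp.2 h7
  set x := Real.exp (-(tiltRate N * ((N * (Nat.log 2 N + 1) ^ 3 : ℕ) -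
        codeLength N / (32 * N))) + codeLength N * (tiltRate N ^ 2 * scoreVar N))
  set y := Real.exp (-(((Nat.log 2 N + 1 : ℕ) : ℝ) ^ 2 / 2048))
  have h11 : N * (Real.exp (ε N) * (x + γ κ) + δ N) ≤
      Real.exp E * (N * y + N * γ κ) + N * δ N := by
    calc N * (Real.exp (ε N) * (x + γ κ) + δ N) ≤ N * (Real.exp E * (y + γ κ) + δ N) := by
          have := hγ0 κ
          gcongr
      _ = _ := by ring
  linarith

/-- Private and accurate sanitizers for local queries break local generators. -/
theorem exists_not_exists_sanitizer (n : ℕ → ℕ) (c : ℝ) (hc : 0 < c)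
    (hn : (fun d : ℕ => (n d : ℝ)) =Θ[atTop] (fun d : ℕ => (d : ℝ) ^ c)) (L : ℕ)
    (hG : ∃ G : (κ : ℕ) → (Fin κ → Bool) → Fin (n κ ^ 7) → Bool,
      CountingQueries.IsLocalPRG (fun κ => n κ ^ 7) (fun κ => 1 / (n κ : ℝ) ^ 2) L G) :
    ∃ k : ℕ → ℕ, CountingQueries.IsSquarePlusLittleO k ∧
      ∃ s : Polynomial ℕ,
        ¬ ∃ S : CountingQueries.Sanitizer n k
            (fun d => CountingQueries.depthQueries 6 (s.eval (d + n d)) d),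
          S.Efficient ∧ S.DifferentiallyPrivate ∧ S.Accurate (49 / 100) := by
  obtain ⟨G, hG⟩ := hG
  refine ⟨codeLength, isSquarePlusLittleO_codeLength, queryPoly L, ?_⟩
  rintro ⟨S, ⟨tc⟩, ⟨ε, δ, hε, hδ, hdp⟩, β, hβ, hacc⟩
  obtain ⟨C, R, htest⟩ := exists_test_circuit tc
  have hrows := polyBounded_rows_double hn
  have hlen := hrows.attackInputLength L
  have hlen' := hlen.add (hlen.eval S.coins)
  -- The size of the distinguisher as a polynomial in the stretch, fixed before the bound `γ` on all
  -- advantages is extracted.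
  obtain ⟨P, hP1, hP⟩ := (PolyBounded.testSize C R (hlen'.eval tc.time) hlen'
    (((PolyBounded.const 32).mul hrows).mul
      (hrows.add (PolyBounded.const 1)))).exists_le_eval_rows_pow hc hn
  obtain ⟨γ, hγ, hγ0, hadv⟩ := hG.exists_forall_advantage_le P hP1
  obtain ⟨C', hC'⟩ := exists_rows_double_le hn
  have hlim := tendsto_rows hc hn
  have hβ0 : Tendsto β atTop (𝓝 0) := by
    refine hβ.trans_tendsto ?_
    simp only [one_div]
    exact tendsto_inv_atTop_zero.comp
      ((tendsto_pow_atTop two_ne_zero).comp tendsto_natCast_atTop_atTop)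
  refine not_eventually_tracing_bound hlim hC' hε hδ hβ0 hγ hγ0 ?_
  filter_upwards [hP, eventually_codeLength_le hc hn, eventually_rows_double_le_two_pow hn,
    (hlim.comp tendsto_add_self).eventually_ge_atTop 1, eventually_ge_atTop 1,
    (hlim.comp tendsto_add_self).eventually (hβ0.eventually_le_const zero_lt_one)]
    with κ hsize hk hN2 hN hκ hβ1
  rintro _ rfl
  choose I hI hIG using hG.isLocal κ
  choose q hloc hq using fun j : Fin (codeLength (n (κ + κ))) =>
    exists_decryption_query (N := n (κ + κ)) rowIndex
      (fun key => G κ key (Fin.castLE hk j)) (I (Fin.castLE hk j)) (hI _) (hIG _)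
  choose ℓ hℓ hbit using hloc
  refine attack_bound S (fun ℓ B => testSize C R (tc.time.eval ℓ) ℓ B)
    (fun d ℓ inp => htest d ℓ inp) hκ hN hN2 hk (G κ)
    (fun j y => ⟨q j y, (hq j y).1.trans (by norm_num),
      (hq j y).2.1.trans (decryptSize_le_eval _ _ _)⟩) ℓ hbit (fun j y => (hq j y).2.2) hβ1
    (fun A hA => hadv κ A (hA.trans (le_trans ?_ hsize))) (hdp _) (hacc _)
    (tiltRate_pos hN) (tiltRate_mul_le_one hN)
  have h1 : inputLength n codeLength (κ + κ) ℓ ≤ attackInputLength n L κ := inputLength_le hℓ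
  have h2 := add_le_add h1 (eval_le_eval S.coins h1)
  exact testSize_mono (eval_le_eval tc.time h2) h2 _

end CountingQueries

theorem theorem2 (n : ℕ → ℕ) (c : ℝ) (hc : 0 < c)
    (hn : (fun d : ℕ => (n d : ℝ)) =Θ[atTop] (fun d : ℕ => (d : ℝ) ^ c)) (L : ℕ)
    (hG : ∃ G : (κ : ℕ) → (Fin κ → Bool) → Fin (n κ ^ 7) → Bool,
      CountingQueries.IsLocalPRG (fun κ => n κ ^ 7) (fun κ => 1 / (n κ : ℝ) ^ 2) L G) :
    ∃ k : ℕ → ℕ, CountingQueries.IsSquarePlusLittleO k ∧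
      ∃ s : Polynomial ℕ,
        ¬ ∃ S : CountingQueries.Sanitizer n k
            (fun d => CountingQueries.depthQueries 6 (s.eval (d + n d)) d),
          S.Efficient ∧ S.DifferentiallyPrivate ∧ S.Accurate (49 / 100) :=
  CountingQueries.exists_not_exists_sanitizer n c hc hn L hG
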